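/- Conventions. "Definable" without a specified parameter set means definable with parameters. If $M$ and $N$ are structures with the same universe $G$, then $M$ is a \emph{reduct} of $N$, and $N$ an \emph{expansion} of $M$, if every subset of a finite power $G^k$ that is $\emptyset$-definable in $M$ is definable (with parameters from $G$) in $N$. An ordered abelian group is archimedean if for all $a$ and all $b>0$ there is $n\in\mathbb N$ with $a\le nb$; an abelian group $H$ has small quotients if $nH$ has finite index in $H$ for every $n\ge 1$. A structure is stable if its complete theory is stable, i.e. no formula has the order property. Statement. Let $N=(G,+,<)$ be elementarily equivalent to an archimedean ordered abelian group with small quotients, and let $M$ be a structure, in some language $L$, that is a reduct (not necessarily over $\emptyset$) of $N$ and an expansion of $(G,+)$. Let $\mathcal N=(\mathcal G,+,<)$ be a monster model of $\mathrm{Th}(N)$ containing $N$ as a small elementary substructure: $N\prec\mathcal N$, and $\mathcal N$ is $\kappa$-saturated and strongly $\kappa$-homogeneous for some infinite cardinal $\kappa>|G|$. Let $\mathcal M$ be the reduct of $\mathcal N$ to the language of $M$, i.e. the $L$-structure on $\mathcal G$ in which each symbol of $L$ is interpreted by the same $\{+,<\}$-formula with parameters from $G$ that defines its interpretation in $M$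 (by elementarity it does not matter which such formula is used). Then the following are equivalent: 1. $M$ is stable. 2. Every subset $D\subseteq G$ that is definable in $M$ is also definable in $(G,+)$. 3. Every subset $\mathcal D\subseteq\mathcal G$ that is definable in $\mathcal M$ is also definable in $(\mathcal G,+)$. -/

import Mathlib

open FirstOrder FirstOrder.Language Cardinal

/-! ### The languages of `(G, +)` and `(G, +, <)` -/

/-- The only function symbol: a binary `+`. -/
inductive PlusFunc : ℕ → Type
  | add : PlusFunc 2

/-- The only relation symbol: a binary `<`. -/
inductive LessRel : ℕ → Type
  | lt : LessRel 2

/-- The language `{+}`. -/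
def groupLang : FirstOrder.Language.{0, 0} := ⟨PlusFunc, fun _ => Empty⟩

/-- The language `{+, <}`. -/
def ordGroupLang : FirstOrder.Language.{0, 0} := ⟨PlusFunc, LessRel⟩

/-- The structure `(G, +)`. -/
instance groupStructure (G : Type*) [Add G] : groupLang.Structure G where
  funMap {_} s := match s with
    | PlusFunc.add => fun x => x 0 + x 1
  RelMap {_} r := nomatch r

/-- The structure `(G, +, <)`. -/
instance ordGroupStructure (G : Type*) [Add G] [LT G] : ordGroupLang.Structure G where
  funMap {_} s := match s with
    | PlusFunc.add => fun x => x 0 + x 1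
  RelMap {_} r := match r with
    | LessRel.lt => fun x => x 0 < x 1

/-- An abelian group has small quotients if `nH` has finite index in `H` for all `n ≥ 1`. -/
def HasSmallQuotients (H : Type*) [AddCommGroup H] : Prop :=
  ∀ n : ℕ, 1 ≤ n → (nsmulAddMonoidHom n : H →+ H).range.FiniteIndex

/-! ### Reducts, unary definable sets, stability -/

/-- For an `L₁`-structure and an `L₂`-structure on the same universe `M` and `A ⊆ M`: the first is
an `A`-reduct of the second (and the second is an `A`-expansion of the first), i.e. every set that
is `∅`-definable in the first is `A`-definable in the second. -/
def IsReductOver {M : Type*} (A : Set M) (L₁ L₂ : FirstOrder.Language)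
    [L₁.Structure M] [L₂.Structure M] : Prop :=
  ∀ (k : ℕ) (X : Set (Fin k → M)), (∅ : Set M).Definable L₁ X → A.Definable L₂ X

/-- Every subset of `M` that is definable (with parameters) in the `L`-structure `M` is also
definable (with parameters) in the `L₀`-structure `M`. -/
def NoNewUnarySets (L₀ L : FirstOrder.Language) (M : Type*)
    [L₀.Structure M] [L.Structure M] : Prop :=
  ∀ D : Set M, (Set.univ : Set M).Definable₁ L D → (Set.univ : Set M).Definable₁ L₀ D

/-- `M` is stable: no formula `φ(x, y)`, with `x` and `y` finite tuples of variables, has the order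
property in the complete theory of `M`, i.e. none has ladders of every finite length in `M`. -/
def IsStableStructure (L : FirstOrder.Language) (M : Type*) [L.Structure M] : Prop :=
  ∀ (m n : ℕ) (φ : L.Formula (Fin m ⊕ Fin n)), ∃ k : ℕ,
    ¬ ∃ (a : Fin k → Fin m → M) (b : Fin k → Fin n → M),
      ∀ i j : Fin k, φ.Realize (Sum.elim (a i) (b j)) ↔ i < j

/-! ### Monster models -/

/-- `M` is `κ`-saturated: for every `A ⊆ M` with `|A| < κ`, every set of formulas over `A` in one
variable that is finitely satisfiable in `M` is realized in `M`. -/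
def IsSaturatedAt (κ : Cardinal) (L : FirstOrder.Language) (M : Type*) [L.Structure M] : Prop :=
  ∀ A : Set M, #A < κ → ∀ p : Set (L[[A]].Formula (Fin 1)),
    (∀ s : Finset (L[[A]].Formula (Fin 1)), ↑s ⊆ p →
      ∃ c : M, ∀ φ ∈ s, φ.Realize (fun _ => c)) →
    ∃ c : M, ∀ φ ∈ p, φ.Realize (fun _ => c)

/-- `M` is strongly `κ`-homogeneous: every partial elementary map from a set of size `< κ` to `M`
extends to an automorphism of `M`. -/
def IsStronglyHomogeneousAt (κ : Cardinal) (L : FirstOrder.Language) (M : Type*)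
    [L.Structure M] : Prop :=
  ∀ A : Set M, #A < κ → ∀ g : A → M,
    (∀ φ : L.Formula A, φ.Realize (fun a : A => (a : M)) ↔ φ.Realize g) →
    ∃ σ : M ≃[L] M, ∀ a : A, σ a = g a

/-- `M` is a monster model (of its complete theory) with respect to the infinite cardinal `κ`, the
sets of size `< κ` being the small ones. -/
def IsMonsterModel (κ : Cardinal) (L : FirstOrder.Language) (M : Type*) [L.Structure M] : Prop :=
  ℵ₀ ≤ κ ∧ IsSaturatedAt κ L M ∧ IsStronglyHomogeneousAt κ L M

/-! ### The reduct of an elementary extension to the language of a reduct -/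

/-- Let `f : N ↪ₑ N'` be an elementary embedding of `L'`-structures, and let `M` be an `L`-structure
with the same universe `G` as `N` which is a reduct of `N`, possibly with parameters. Then each
symbol of `L` is interpreted in `M` by an `L'`-formula `θ` with parameters from `G`; in the reduct of
`N'` to the language `L` it is interpreted by the same formula, its parameters being moved by `f`.
(By elementarity, the choice of `θ` does not matter, and for a function symbol `θ` defines the graph
of a function on `N'` again.) -/
@[reducible] noncomputable def reductStructure (L : FirstOrder.Language)
    {L' : FirstOrder.Language} {G G' : Type*} [L.Structure G] [L'.Structure G] [L'.Structure G'] [Nonempty G'] (f : G ↪ₑ[L'] G') :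
    L.Structure G' where
  funMap {n} F x := Classical.epsilon fun y : G' =>
    ∃ θ : L'.Formula (G ⊕ Fin (n + 1)),
      (∀ (v : Fin n → G) (w : G),
        θ.Realize (Sum.elim id (Fin.snoc v w : Fin (n + 1) → G)) ↔ Structure.funMap F v = w) ∧
      θ.Realize (Sum.elim f (Fin.snoc x y : Fin (n + 1) → G'))
  RelMap {n} R x :=
    ∃ θ : L'.Formula (G ⊕ Fin n),
      (∀ v : Fin n → G, θ.Realize (Sum.elim id v) ↔ Structure.RelMap R v) ∧
      θ.Realize (Sum.elim f x)

/-! All three conditions are equivalent to a fourth, `UniformlySmall`. It says that every family of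
unary sets definable in `M` has some `n` and `k` such that each member, pulled back along any `y ↦ c
+ n • y`, has at most `k` elements or a complement with at most `k` elements.

Being archimedean is not first-order, but regularity is: an interval with more than `m` elements
meets every coset of `mG`. It passes to `G` together with the finiteness of the indices. Regularity
allows quantifiers to be eliminated down to signs of affine functions and congruences
(`eliminates_sign`, `Dfn.basic_sign`). On a coset of a suitable `nG` the congruences are constant. A
unary set definable in `N` is then determined there by finitely many signs (`SignDet`), hence is a
union of finitely many convex cells.

Each of the three conditions forces the sign-determined sets definable in `M` to be finite or
cofinite (`SignDetFinite`). If `E` is infinite and coinfinite, arbitrarily long progressions cross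
from an infinite cell outside `E` to one inside it (`SignDet.exists_progression`), so `x + y ∈ E`
has the order property. A set definable in the torsion-free group alone is finite or cofinite on
some `mG`, and an infinite cell meets `mG` in an infinite set.

It remains to make this uniform. In a dense order a finite sign-determined set has at most one point
per cell. If there is a least positive `u`, only the number of runs with step `u` is bounded in this
way; unbounded finite sets would then make the nonnegative multiples of `u` definable in `M`
(`dfn_multiples`), against `SignDetFinite`.

Conversely, uniform smallness gives the second condition by splitting a set along finitely many
cosets, and the third because the bound is a first-order statement and so covers parameters from
`𝒢`. Stability follows by induction on the number of variables: by Ramsey's theorem a long ladder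
yields either a long ladder in fewer variables or smaller fibres (`ladder_card_lt_of_small`). -/

/-! ### Simultaneous definability in two structures -/

section CoDef

variable {L₁ : FirstOrder.Language} {C G G' : Type*} [L₁.Structure G] [L₁.Structure G']

/-- One formula, with parameters indexed by `C`, defines `P` in `G` and `P'` in `G'`. -/
def CoDef (L₁ : FirstOrder.Language) {C G G' : Type*} [L₁.Structure G] [L₁.Structure G']
    (f : C → G) (f' : C → G') {α : Type*} (P : (α → G) → Prop) (P' : (α → G') → Prop) : Prop :=
  ∃ θ : L₁.Formula (C ⊕ α), (∀ v, θ.Realize (Sum.elim f v) ↔ P v) ∧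
    ∀ v, θ.Realize (Sum.elim f' v) ↔ P' v

/-- One formula defines the graph of `F` in `G` and the graph of `F'` in `G'`. -/
def CoDefFun (L₁ : FirstOrder.Language) {C G G' : Type*} [L₁.Structure G] [L₁.Structure G']
    (f : C → G) (f' : C → G') {α : Type*} (F : (α → G) → G) (F' : (α → G') → G') : Prop :=
  CoDef L₁ f f' (fun w : Option α → G => w none = F fun i => w (some i))
    (fun w : Option α → G' => w none = F' fun i => w (some i))

variable {f : C → G} {f' : C → G'} {α β γ : Type*}
  {P Q : (α → G) → Prop} {P' Q' : (α → G') → Prop}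

theorem CoDef.congr (h : CoDef L₁ f f' P P') (h₁ : ∀ v, P v ↔ Q v) (h₂ : ∀ v, P' v ↔ Q' v) :
    CoDef L₁ f f' Q Q' := by
  obtain ⟨θ, a, b⟩ := h
  exact ⟨θ, fun v => (a v).trans (h₁ v), fun v => (b v).trans (h₂ v)⟩

theorem CoDef.not (h : CoDef L₁ f f' P P') :
    CoDef L₁ f f' (fun v => ¬ P v) (fun v => ¬ P' v) := by
  obtain ⟨θ, a, b⟩ := h
  exact ⟨θ.not, fun v => by rw [Formula.realize_not, a], fun v => by rw [Formula.realize_not, b]⟩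

theorem CoDef.imp (h : CoDef L₁ f f' P P') (h' : CoDef L₁ f f' Q Q') :
    CoDef L₁ f f' (fun v => P v → Q v) (fun v => P' v → Q' v) := by
  obtain ⟨θ, a, b⟩ := h
  obtain ⟨η, c, d⟩ := h'
  exact ⟨θ.imp η, fun v => by rw [Formula.realize_imp, a, c],
    fun v => by rw [Formula.realize_imp, b, d]⟩

theorem CoDef.and (h : CoDef L₁ f f' P P') (h' : CoDef L₁ f f' Q Q') :
    CoDef L₁ f f' (fun v => P v ∧ Q v) (fun v => P' v ∧ Q' v) :=
  (h.imp h'.not).not.congr (fun _ => by tauto) (fun _ => by tauto)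

theorem CoDef.or (h : CoDef L₁ f f' P P') (h' : CoDef L₁ f f' Q Q') :
    CoDef L₁ f f' (fun v => P v ∨ Q v) (fun v => P' v ∨ Q' v) :=
  (h.not.imp h').congr (fun _ => by tauto) (fun _ => by tauto)

theorem CoDef.false :
    CoDef L₁ f f' (fun _ : α → G => False) (fun _ => False) :=
  ⟨⊥, fun v => by simp, fun v => by simp⟩

theorem CoDef.finite_forall {ι : Type*} [Finite ι] {P : ι → (α → G) → Prop}
    {P' : ι → (α → G') → Prop} (h : ∀ i, CoDef L₁ f f' (P i) (P' i)) :
    CoDef L₁ f f' (fun v => ∀ i, P i v) (fun v => ∀ i, P' i v) := by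
  choose θ a b using h
  exact ⟨Formula.iInf θ, fun v => by simp [Formula.realize_iInf, a],
    fun v => by simp [Formula.realize_iInf, b]⟩

theorem CoDef.finite_exists {ι : Type*} [Finite ι] {P : ι → (α → G) → Prop}
    {P' : ι → (α → G') → Prop} (h : ∀ i, CoDef L₁ f f' (P i) (P' i)) :
    CoDef L₁ f f' (fun v => ∃ i, P i v) (fun v => ∃ i, P' i v) :=
  (CoDef.finite_forall fun i => (h i).not).not.congr (fun _ => by simp) (fun _ => by simp)

theorem CoDef.reindex {P : (β → G) → Prop} {P' : (β → G') → Prop} (h : CoDef L₁ f f' P P')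
    (e : β → C ⊕ α) :
    CoDef L₁ f f' (fun v => P fun i => Sum.elim f v (e i))
      (fun v => P' fun i => Sum.elim f' v (e i)) := by
  obtain ⟨θ, a, b⟩ := h
  refine ⟨θ.relabel (Sum.elim Sum.inl e), fun v => ?_, fun v => ?_⟩
  · rw [Formula.realize_relabel]
    refine Iff.trans ?_ (a _)
    exact iff_of_eq (congrArg _ (funext fun x => by rcases x with x | x <;> rfl))
  · rw [Formula.realize_relabel]
    refine Iff.trans ?_ (b _)
    exact iff_of_eq (congrArg _ (funext fun x => by rcases x with x | x <;> rfl))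

theorem CoDef.relabel {P : (β → G) → Prop} {P' : (β → G') → Prop} (h : CoDef L₁ f f' P P')
    (e : β → α) :
    CoDef L₁ f f' (fun v => P fun i => v (e i)) (fun v => P' fun i => v (e i)) :=
  h.reindex fun i => Sum.inr (e i)

theorem CoDef.exists_tuple [Finite β] {P : (α → G) → (β → G) → Prop}
    {P' : (α → G') → (β → G') → Prop}
    (h : CoDef L₁ f f' (fun w : α ⊕ β → G => P (fun i => w (Sum.inl i)) fun i => w (Sum.inr i))
      (fun w : α ⊕ β → G' => P' (fun i => w (Sum.inl i)) fun i => w (Sum.inr i))) :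
    CoDef L₁ f f' (fun v => ∃ u, P v u) (fun v => ∃ u, P' v u) := by
  obtain ⟨θ, a, b⟩ := h
  refine ⟨Formula.iExs β (θ.relabel (Equiv.sumAssoc C α β).symm), fun v => ?_, fun v => ?_⟩
  · rw [Formula.realize_iExs]
    refine exists_congr fun u => ?_
    rw [Formula.realize_relabel]
    refine Iff.trans ?_ (a (Sum.elim v u))
    exact iff_of_eq (congrArg _ (funext fun x => by rcases x with x | x | x <;> rfl))
  · rw [Formula.realize_iExs]
    refine exists_congr fun u => ?_
    rw [Formula.realize_relabel]
    refine Iff.trans ?_ (b (Sum.elim v u))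
    exact iff_of_eq (congrArg _ (funext fun x => by rcases x with x | x | x <;> rfl))

theorem CoDef.forall_tuple [Finite β] {P : (α → G) → (β → G) → Prop}
    {P' : (α → G') → (β → G') → Prop}
    (h : CoDef L₁ f f' (fun w : α ⊕ β → G => P (fun i => w (Sum.inl i)) fun i => w (Sum.inr i))
      (fun w : α ⊕ β → G' => P' (fun i => w (Sum.inl i)) fun i => w (Sum.inr i))) :
    CoDef L₁ f f' (fun v => ∀ u, P v u) (fun v => ∀ u, P' v u) :=
  (CoDef.exists_tuple (P := fun v u => ¬ P v u) (P' := fun v u => ¬ P' v u) h.not).not.congr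
    (fun _ => by simp) (fun _ => by simp)

theorem CoDef.ex {P : (α → G) → G → Prop} {P' : (α → G') → G' → Prop}
    (h : CoDef L₁ f f' (fun w : Option α → G => P (fun i => w (some i)) (w none))
      (fun w : Option α → G' => P' (fun i => w (some i)) (w none))) :
    CoDef L₁ f f' (fun v => ∃ x, P v x) (fun v => ∃ x, P' v x) := by
  have := CoDef.exists_tuple (β := Unit) (P := fun v u => P v (u ())) (P' := fun v u => P' v (u ()))
    (h.relabel fun o => o.elim (Sum.inr ()) Sum.inl)
  exact this.congr (fun v => ⟨fun ⟨u, h⟩ => ⟨_, h⟩, fun ⟨x, h⟩ => ⟨fun _ => x, h⟩⟩)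
    (fun v => ⟨fun ⟨u, h⟩ => ⟨_, h⟩, fun ⟨x, h⟩ => ⟨fun _ => x, h⟩⟩)

theorem CoDef.all {P : (α → G) → G → Prop} {P' : (α → G') → G' → Prop}
    (h : CoDef L₁ f f' (fun w : Option α → G => P (fun i => w (some i)) (w none))
      (fun w : Option α → G' => P' (fun i => w (some i)) (w none))) :
    CoDef L₁ f f' (fun v => ∀ x, P v x) (fun v => ∀ x, P' v x) :=
  (CoDef.ex (P := fun v u => ¬ P v u) (P' := fun v u => ¬ P' v u) h.not).not.congr
    (fun _ => by simp) (fun _ => by simp)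

theorem CoDef.eq_var (i j : C ⊕ α) :
    CoDef L₁ f f' (fun v : α → G => Sum.elim f v i = Sum.elim f v j)
      (fun v => Sum.elim f' v i = Sum.elim f' v j) :=
  ⟨Term.equal (Term.var i) (Term.var j), fun v => by simp [Formula.realize_equal],
    fun v => by simp [Formula.realize_equal]⟩

theorem CoDefFun.proj (i : α) :
    CoDefFun L₁ f f' (fun v : α → G => v i) (fun v : α → G' => v i) :=
  CoDef.eq_var (.inr none) (.inr (some i))

theorem CoDefFun.const (c : C) :
    CoDefFun L₁ f f' (fun _ : α → G => f c) (fun _ : α → G' => f' c) :=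
  CoDef.eq_var (.inr none) (.inl c)

theorem CoDef.comp [Finite β] {P : (β → G) → Prop} {P' : (β → G') → Prop}
    (h : CoDef L₁ f f' P P') {F : β → (α → G) → G} {F' : β → (α → G') → G'}
    (hF : ∀ i, CoDefFun L₁ f f' (F i) (F' i)) :
    CoDef L₁ f f' (fun v => P fun i => F i v) (fun v => P' fun i => F' i v) := by
  have h₁ := CoDef.exists_tuple (α := α) (β := β) (P := fun v u => (∀ i, u i = F i v) ∧ P u)
    (P' := fun v u => (∀ i, u i = F' i v) ∧ P' u)
    ((CoDef.finite_forall fun i =>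
      (hF i).relabel (fun o => o.elim (Sum.inr i) Sum.inl)).and (h.relabel Sum.inr))
  exact h₁.congr
    (fun v => ⟨fun ⟨u, h, h'⟩ => (funext h : u = _) ▸ h', fun h => ⟨_, fun _ => rfl, h⟩⟩)
    (fun v => ⟨fun ⟨u, h, h'⟩ => (funext h : u = _) ▸ h', fun h => ⟨_, fun _ => rfl, h⟩⟩)

theorem CoDefFun.comp [Finite β] {E : (β → G) → G} {E' : (β → G') → G'}
    (h : CoDefFun L₁ f f' E E') {F : β → (α → G) → G} {F' : β → (α → G') → G'}
    (hF : ∀ i, CoDefFun L₁ f f' (F i) (F' i)) :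
    CoDefFun L₁ f f' (fun v => E fun i => F i v) (fun v => E' fun i => F' i v) := by
  have := CoDef.comp h (α := Option α) (F := fun o => o.elim (fun w => w none)
    fun i w => F i fun j => w (some j)) (F' := fun o => o.elim (fun w => w none)
    fun i w => F' i fun j => w (some j)) (by
      rintro (_ | i)
      · exact CoDefFun.proj none
      · exact (hF i).relabel (fun o => o.elim none fun j => some (some j)))
  exact this

theorem CoDef.eq {F E : (α → G) → G} {F' E' : (α → G') → G'}
    (hF : CoDefFun L₁ f f' F F') (hE : CoDefFun L₁ f f' E E') :
    CoDef L₁ f f' (fun v => F v = E v) (fun v => F' v = E' v) :=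
  (CoDef.ex (P := fun v x => x = F v ∧ x = E v) (P' := fun v x => x = F' v ∧ x = E' v)
    (hF.and hE)).congr (fun v => by simp) (fun v => by simp)

theorem CoDefFun.reindex {F : (β → G) → G} {F' : (β → G') → G'} (h : CoDefFun L₁ f f' F F')
    (e : β → C ⊕ α) :
    CoDefFun L₁ f f' (fun v => F fun i => Sum.elim f v (e i))
      (fun v => F' fun i => Sum.elim f' v (e i)) := by
  refine (CoDef.reindex h (α := Option α)
    (fun o => o.elim (.inr none) fun i => (e i).map id some)).congr ?_ ?_ <;> intro v
  · have : (fun i => Sum.elim f v ((e i).map id some)) =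
        fun i => Sum.elim f (fun j => v (some j)) (e i) := by
      funext i; rcases e i with _ | _ <;> rfl
    simp [this]
  · have : (fun i => Sum.elim f' v ((e i).map id some)) =
        fun i => Sum.elim f' (fun j => v (some j)) (e i) := by
      funext i; rcases e i with _ | _ <;> rfl
    simp [this]

/-- The interpretations of the symbols of `L` are defined by `L₁`-formulas, the same in `G` and in
`G'`. -/
structure Interprets (L L₁ : FirstOrder.Language) {C G G' : Type*} [L.Structure G] [L.Structure G']
    [L₁.Structure G] [L₁.Structure G'] (f : C → G) (f' : C → G') : Prop where
  funMap : ∀ {n} (F : L.Functions n), CoDefFun L₁ f f' (fun v => Structure.funMap F v)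
    (fun v => Structure.funMap F v)
  relMap : ∀ {n} (R : L.Relations n), CoDef L₁ f f' (fun v => Structure.RelMap R v)
    (fun v => Structure.RelMap R v)

variable {L : FirstOrder.Language} [L.Structure G] [L.Structure G']

theorem Interprets.term (H : Interprets L L₁ f f') (t : L.Term α) :
    CoDefFun L₁ f f' (fun v => t.realize v) (fun v => t.realize v) := by
  induction t with
  | var i => exact CoDefFun.proj i
  | func F ts ih => exact (H.funMap F).comp ih

theorem Interprets.boundedFormula (H : Interprets L L₁ f f') {n : ℕ} (φ : L.BoundedFormula α n) :
    CoDef L₁ f f' (fun w : α ⊕ Fin n → G => φ.Realize (fun i => w (Sum.inl i)) fun i => w (Sum.inr i))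
      (fun w => φ.Realize (fun i => w (Sum.inl i)) fun i => w (Sum.inr i)) := by
  induction φ with
  | falsum => exact CoDef.false
  | equal t₁ t₂ =>
    refine (CoDef.eq (H.term t₁) (H.term t₂)).congr ?_ ?_ <;> intro w <;>
    · change _ ↔ Term.realize _ t₁ = Term.realize _ t₂
      have : (Sum.elim (fun i => w (Sum.inl i)) fun i => w (Sum.inr i)) = w := by
        funext x; rcases x with x | x <;> rfl
      rw [this]
  | rel R ts =>
    refine ((H.relMap R).comp fun i => H.term (ts i)).congr ?_ ?_ <;> intro w <;>
    · change _ ↔ Structure.RelMap R fun i => Term.realize _ (ts i)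
      have : (Sum.elim (fun i => w (Sum.inl i)) fun i => w (Sum.inr i)) = w := by
        funext x; rcases x with x | x <;> rfl
      rw [this]
  | imp φ ψ h₁ h₂ => exact h₁.imp h₂
  | @all n φ ih =>
    refine (CoDef.all (α := α ⊕ Fin n) (P := fun w x => φ.Realize (fun i => w (Sum.inl i))
      (Fin.snoc (fun i => w (Sum.inr i)) x)) (P' := fun w x => φ.Realize (fun i => w (Sum.inl i))
      (Fin.snoc (fun i => w (Sum.inr i)) x)) ?_)
    refine (ih.relabel (Sum.elim (fun i => some (Sum.inl i))
      (Fin.snoc (α := fun _ => Option (α ⊕ Fin n)) (fun i => some (Sum.inr i)) none))).congr ?_ ?_ <;>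
    · intro w
      have : (fun i => w (Fin.snoc (α := fun _ => Option (α ⊕ Fin n))
          (fun i => some (Sum.inr i)) none i)) =
          (Fin.snoc (fun i => w (some (Sum.inr i))) (w none)) := by
        funext i
        refine Fin.lastCases ?_ (fun i => ?_) i <;> simp
      simp [this]

theorem Interprets.formula (H : Interprets L L₁ f f') (φ : L.Formula α) :
    CoDef L₁ f f' (fun w => φ.Realize w) (fun w => φ.Realize w) := by
  refine ((H.boundedFormula φ).relabel (Sum.elim id finZeroElim)).congr ?_ ?_ <;>
  · intro w
    rw [Formula.Realize]
    exact iff_of_eq (congrArg _ (Subsingleton.elim _ _))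

end CoDef

/-! ### Transfer -/

section Transfer

variable {L₁ : FirstOrder.Language} {C G G' : Type*} [L₁.Structure G] [L₁.Structure G']

/-- With no free variables left, the common formula is a sentence over the parameters, whose truth
`f` preserves. -/
theorem CoDef.transfer_elementary (f : G ↪ₑ[L₁] G') {P : Prop} {P' : Prop}
    (h : CoDef L₁ id f (fun _ : Empty → G => P) (fun _ : Empty → G' => P')) : P ↔ P' := by
  obtain ⟨θ, a, b⟩ := h
  refine (a Empty.elim).symm.trans (Iff.trans ?_ (b Empty.elim))
  rw [← f.map_formula]
  exact iff_of_eq (congrArg _ (funext fun x => by rcases x with x | x; rfl; exact x.elim))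

theorem CoDef.transfer_equivalent (e : G ≅[L₁] G') {P : Prop} {P' : Prop}
    (h : CoDef L₁ (Empty.elim : Empty → G) (Empty.elim : Empty → G') (fun _ : Empty → G => P)
      (fun _ : Empty → G' => P')) : P ↔ P' := by
  obtain ⟨θ, a, b⟩ := h
  have := e.realize_sentence (θ.relabel (Sum.elim id id))
  rw [Sentence.Realize, Sentence.Realize, Formula.realize_relabel, Formula.realize_relabel] at this
  refine (a Empty.elim).symm.trans (Iff.trans ?_ (b Empty.elim))
  convert! this <;> exact Subsingleton.elim _ _

end Transfer

/-! ### Definability with parameters -/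

section Dfn

variable {L : FirstOrder.Language} {G α β : Type*} [L.Structure G]

/-- `P` is definable with parameters. -/
abbrev Dfn (L : FirstOrder.Language) {G α : Type*} [L.Structure G] (P : (α → G) → Prop) : Prop :=
  CoDef L (id : G → G) (id : G → G) P P

/-- `F` has a graph which is definable with parameters. -/
abbrev DfnFun (L : FirstOrder.Language) {G α : Type*} [L.Structure G] (F : (α → G) → G) : Prop :=
  CoDefFun L (id : G → G) (id : G → G) F F

theorem dfn_iff_definable {P : (α → G) → Prop} :
    Dfn L P ↔ (Set.univ : Set G).Definable L {v | P v} := by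
  rw [Set.definable_iff_exists_formula_sum]
  constructor
  · rintro ⟨θ, a, -⟩
    refine ⟨θ.relabel (Sum.map (fun x => ⟨x, trivial⟩) id), ?_⟩
    ext v
    rw [Set.mem_ofPred_eq, Set.mem_ofPred_eq, Formula.realize_relabel, ← a]
    exact iff_of_eq (congrArg _ (funext fun x => by rcases x with x | x <;> rfl))
  · rintro ⟨φ, h⟩
    have key : ∀ v, (φ.relabel (Sum.map Subtype.val id)).Realize (Sum.elim id v) ↔ P v := by
      intro v
      have : P v ↔ v ∈ {v | P v} := Iff.rfl
      rw [this, h, Set.mem_ofPred_eq, Formula.realize_relabel]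
      exact iff_of_eq (congrArg _ (funext fun x => by rcases x with x | x <;> rfl))
    exact ⟨_, key, key⟩

theorem Dfn.exists_finset {P : (α → G) → Prop} (h : Dfn L P) :
    ∃ (A : Finset G) (φ : L.Formula (A ⊕ α)), ∀ v, P v ↔ φ.Realize (Sum.elim (↑) v) := by
  obtain ⟨A, -, h⟩ := Set.definable_iff_finitely_definable.1 (dfn_iff_definable.1 h)
  obtain ⟨φ, h⟩ := Set.definable_iff_exists_formula_sum.1 h
  exact ⟨A, φ, fun v => by
    have : P v ↔ v ∈ {v | P v} := Iff.rfl
    rw [this, h]; rfl⟩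

theorem Dfn.of_formula (φ : L.Formula α) : Dfn L (fun v : α → G => φ.Realize v) := by
  refine ⟨φ.relabel Sum.inr, fun v => ?_, fun v => ?_⟩ <;> rw [Formula.realize_relabel] <;> rfl

theorem DfnFun.const (c : G) : DfnFun L (fun _ : α → G => c) := CoDefFun.const c

theorem definable₁_iff_dfn {D : Set G} :
    (Set.univ : Set G).Definable₁ L D ↔ Dfn L (fun v : Unit → G => v () ∈ D) := by
  rw [Set.Definable₁, ← dfn_iff_definable]
  exact ⟨fun h => h.relabel fun _ => (), fun h => h.relabel fun _ => 0⟩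

theorem Interprets.dfn {L₁ : FirstOrder.Language} [L₁.Structure G]
    (H : Interprets L L₁ (id : G → G) id) {P : (α → G) → Prop} (h : Dfn L P) : Dfn L₁ P := by
  obtain ⟨θ, a, -⟩ := h
  exact ((H.formula θ).reindex id).congr a a

end Dfn

section CoDefFun

variable {L₁ : FirstOrder.Language} {C G G' α β : Type*} [L₁.Structure G] [L₁.Structure G']
  {f : C → G} {f' : C → G'}

theorem CoDefFun.relabel {F : (β → G) → G} {F' : (β → G') → G'} (h : CoDefFun L₁ f f' F F')
    (e : β → α) :
    CoDefFun L₁ f f' (fun v => F fun i => v (e i)) (fun v => F' fun i => v (e i)) :=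
  h.reindex fun i => Sum.inr (e i)

theorem CoDef.comp_option {P : (Option β → G) → Prop} {P' : (Option β → G') → Prop} [Finite β]
    {F : (α → G) → G} {F' : (α → G') → G'} (h : CoDef L₁ f f' P P')
    (hF : CoDefFun L₁ f f' F F') {v : β → (α → G) → G}
    {v' : β → (α → G') → G'} (hv : ∀ i, CoDefFun L₁ f f' (v i) (v' i)) :
    CoDef L₁ f f' (fun w => P fun o => o.elim (F w) fun i => v i w)
      (fun w => P' fun o => o.elim (F' w) fun i => v' i w) := by
  refine (h.comp (F := fun o => o.elim F v) (F' := fun o => o.elim F' v') ?_).congr ?_ ?_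
  · rintro (_ | i)
    exacts [hF, hv i]
  · intro w
    exact iff_of_eq (congrArg P (funext fun o => by cases o <;> rfl))
  · intro w
    exact iff_of_eq (congrArg P' (funext fun o => by cases o <;> rfl))

end CoDefFun

/-! ### Definability of the group operations and of the order -/

section AddCoDef

variable {L₁ : FirstOrder.Language} {C G G' α β : Type*} [AddCommGroup G] [AddCommGroup G']
  [L₁.Structure G] [L₁.Structure G'] {f : C → G} {f' : C → G'}

/-- The graphs of the two additions are defined by the same formula. -/
def AddCoDef (L₁ : FirstOrder.Language) {C G G' : Type*} [AddCommGroup G] [AddCommGroup G']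
    [L₁.Structure G] [L₁.Structure G'] (f : C → G) (f' : C → G') : Prop :=
  CoDef L₁ f f' (fun v : Fin 3 → G => v 0 + v 1 = v 2) (fun v => v 0 + v 1 = v 2)

variable {F E : (α → G) → G} {F' E' : (α → G') → G'}

theorem CoDefFun.add (hadd : AddCoDef L₁ f f') (hF : CoDefFun L₁ f f' F F')
    (hE : CoDefFun L₁ f f' E E') :
    CoDefFun L₁ f f' (fun v => F v + E v) (fun v => F' v + E' v) := by
  refine (hadd.comp (F := ![fun w => F fun i => w (some i), fun w => E fun i => w (some i),
    fun w => w none]) (F' := ![fun w => F' fun i => w (some i), fun w => E' fun i => w (some i),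
    fun w => w none]) ?_).congr (fun v => eq_comm) (fun v => eq_comm)
  intro i
  fin_cases i
  · exact hF.relabel some
  · exact hE.relabel some
  · exact CoDefFun.proj none

theorem CoDefFun.neg (hadd : AddCoDef L₁ f f') (hF : CoDefFun L₁ f f' F F') :
    CoDefFun L₁ f f' (fun v => - F v) (fun v => - F' v) := by
  refine (CoDef.eq (((CoDefFun.proj none).add hadd (hF.relabel some)).add hadd
    (CoDefFun.proj none)) (CoDefFun.proj none)).congr ?_ ?_ <;>
  · intro w
    exact _root_.add_eq_right.trans eq_neg_iff_add_eq_zero.symm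

theorem CoDefFun.zero (hadd : AddCoDef L₁ f f') :
    CoDefFun L₁ f f' (fun _ : α → G => 0) (fun _ : α → G' => 0) := by
  refine (CoDef.eq ((CoDefFun.proj none).add hadd (CoDefFun.proj none))
    (CoDefFun.proj none)).congr ?_ ?_ <;>
  · intro w
    exact _root_.add_eq_right

theorem CoDefFun.nsmul (hadd : AddCoDef L₁ f f') (hF : CoDefFun L₁ f f' F F') (n : ℕ) :
    CoDefFun L₁ f f' (fun v => n • F v) (fun v => n • F' v) := by
  induction n with
  | zero => simpa only [zero_smul] using CoDefFun.zero hadd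
  | succ n ih => simpa only [succ_nsmul] using ih.add hadd hF

theorem CoDefFun.sub (hadd : AddCoDef L₁ f f') (hF : CoDefFun L₁ f f' F F')
    (hE : CoDefFun L₁ f f' E E') :
    CoDefFun L₁ f f' (fun v => F v - E v) (fun v => F' v - E' v) := by
  simpa only [sub_eq_add_neg] using hF.add hadd (hE.neg hadd)

theorem addCoDef_groupLang (f : C → G) (f' : C → G') : AddCoDef groupLang f f' := by
  refine ⟨Term.equal (Functions.apply₂ (L := groupLang) PlusFunc.add (Term.var (Sum.inr 0))
    (Term.var (Sum.inr 1))) (Term.var (Sum.inr 2)), fun v => ?_, fun v => ?_⟩ <;>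
  · rw [Formula.realize_equal]
    exact Iff.rfl

variable [LinearOrder G] [LinearOrder G']

theorem addCoDef_ordGroupLang (f : C → G) (f' : C → G') : AddCoDef ordGroupLang f f' := by
  refine ⟨Term.equal (Functions.apply₂ (L := ordGroupLang) PlusFunc.add (Term.var (Sum.inr 0))
    (Term.var (Sum.inr 1))) (Term.var (Sum.inr 2)), fun v => ?_, fun v => ?_⟩ <;>
  · rw [Formula.realize_equal]
    exact Iff.rfl

theorem CoDef.lt {f : C → G} {f' : C → G'} (hF : CoDefFun ordGroupLang f f' F F')
    (hE : CoDefFun ordGroupLang f f' E E') :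
    CoDef ordGroupLang f f' (fun v => F v < E v) (fun v => F' v < E' v) := by
  have h : CoDef ordGroupLang f f' (fun v : Fin 2 → G => v 0 < v 1) (fun v => v 0 < v 1) := by
    refine ⟨Relations.formula (L := ordGroupLang) LessRel.lt
      ![Term.var (Sum.inr 0), Term.var (Sum.inr 1)], fun v => ?_, fun v => ?_⟩ <;>
      exact Iff.rfl
  refine h.comp (F := ![F, E]) (F' := ![F', E']) ?_
  intro i
  fin_cases i
  exacts [hF, hE]

theorem CoDef.le {f : C → G} {f' : C → G'} (hF : CoDefFun ordGroupLang f f' F F')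
    (hE : CoDefFun ordGroupLang f f' E E') :
    CoDef ordGroupLang f f' (fun v => F v ≤ E v) (fun v => F' v ≤ E' v) :=
  (CoDef.lt hE hF).not.congr (fun _ => not_lt) (fun _ => not_lt)

end AddCoDef

/-! ### Regular groups -/

section Regular

/-- Every interval with more than `m` elements meets every coset of `mG`. -/
def RegularAt (G : Type*) [AddCommGroup G] [LinearOrder G] (m : ℕ) : Prop :=
  ∀ (c : G) (a : Fin (m + 1) → G), (∀ i j, i < j → a i < a j) →
    ∃ y, a 0 ≤ c + m • y ∧ c + m • y ≤ a (Fin.last m)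

/-- The cosets of `nG` have representatives `r 0, …, r (k - 1)`. -/
def HasReps (G : Type*) [AddCommGroup G] (n k : ℕ) : Prop :=
  ∃ r : Fin k → G, ∀ x, ∃ i y, x = r i + n • y

/-- Finite index, restated through representatives, is a first-order sentence for each fixed `k`,
and so passes to elementarily equivalent groups. -/
theorem HasSmallQuotients.exists_hasReps {H : Type*} [AddCommGroup H] (h : HasSmallQuotients H)
    {n : ℕ} (hn : 0 < n) : ∃ k, HasReps H n k := by
  have := h n hn
  have : Finite (H ⧸ (nsmulAddMonoidHom n : H →+ H).range) :=
    AddSubgroup.finite_quotient_of_finiteIndex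
  obtain ⟨k, ⟨e⟩⟩ := Finite.exists_equiv_fin (H ⧸ (nsmulAddMonoidHom n : H →+ H).range)
  refine ⟨k, fun i => (e.symm i).out, fun x => ⟨e x, ?_⟩⟩
  have hx : QuotientAddGroup.mk (s := (nsmulAddMonoidHom n : H →+ H).range) (e.symm (e x)).out
      = QuotientAddGroup.mk x := by simp
  rw [QuotientAddGroup.eq] at hx
  obtain ⟨y, hy⟩ := hx
  refine ⟨y, ?_⟩
  change n • y = _ at hy
  rw [hy]; abel

theorem exists_pos_nsmul_le {H : Type*} [AddCommGroup H] [LinearOrder H] [IsOrderedAddMonoid H]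
    [DenselyOrdered H] (m : ℕ) {η : H} (hη : 0 < η) : ∃ p, 0 < p ∧ m • p ≤ η := by
  induction m generalizing η with
  | zero => exact ⟨η, hη, by simpa using hη.le⟩
  | succ m ih =>
    obtain ⟨q, hq, hqη⟩ := exists_between hη
    obtain ⟨p, hp, hpm⟩ := ih (sub_pos.2 hqη)
    refine ⟨min p q, lt_min hp hq, ?_⟩
    calc (m + 1) • min p q = m • min p q + min p q := succ_nsmul _ _
      _ ≤ m • p + q := add_le_add (nsmul_le_nsmul_right (min_le_left _ _) m) (min_le_right _ _)
      _ ≤ η - q + q := by gcongr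
      _ = η := sub_add_cancel _ _

theorem add_nsmul_le_of_strictMono {H : Type*} [AddCommGroup H] [LinearOrder H]
    [IsOrderedAddMonoid H] {u : H} (hu : ∀ x, 0 < x → u ≤ x) {m : ℕ} {a : Fin (m + 1) → H}
    (ha : ∀ i j, i < j → a i < a j) (i : Fin (m + 1)) : a 0 + (i : ℕ) • u ≤ a i := by
  induction i using Fin.induction with
  | zero => simp
  | succ i ih =>
    have h₁ := hu _ (sub_pos.2 (ha i.castSucc i.succ Fin.castSucc_lt_succ))
    have h₂ := add_le_add ih h₁
    rw [Fin.val_castSucc] at h₂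
    rw [Fin.val_succ, succ_nsmul, ← add_assoc]
    simpa using h₂

theorem exists_zsmul_eq_of_archimedean {H : Type*} [AddCommGroup H] [LinearOrder H]
    [IsOrderedAddMonoid H] [Archimedean H] {u : H} (h₀ : 0 < u) (hu : ∀ x, 0 < x → u ≤ x) (x : H) :
    ∃ k : ℤ, x = k • u := by
  obtain ⟨k, ⟨h₁, h₂⟩, -⟩ := existsUnique_zsmul_near_of_pos h₀ x
  refine ⟨k, (h₁.eq_or_lt.resolve_right fun h => ?_).symm⟩
  have := hu _ (sub_pos.2 h)
  rw [add_zsmul, one_zsmul, ← sub_lt_iff_lt_add'] at h₂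
  exact absurd h₂ this.not_gt

/-- If there is a least positive `u`, the group is `ℤu` and `m + 1` increasing elements span a
length of at least `m • u`. Otherwise the order is dense, some `p > 0` has `m • p` at most the
length of the interval, and steps of size `m • p` starting at `c` cannot jump over it. -/
theorem regularAt_of_archimedean (H : Type*) [AddCommGroup H] [LinearOrder H]
    [IsOrderedAddMonoid H] [Archimedean H] {m : ℕ} (hm : 0 < m) : RegularAt H m := by
  intro c a ha
  have h0 : a 0 < a (Fin.last m) := ha _ _ (Fin.lt_def.2 (by simpa using hm))
  by_cases hd : ∃ u : H, 0 < u ∧ ∀ x, 0 < x → u ≤ x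
  · obtain ⟨u, h₀, hu⟩ := hd
    have h₁ := add_nsmul_le_of_strictMono hu ha (Fin.last m)
    obtain ⟨k, hk⟩ := exists_zsmul_eq_of_archimedean h₀ hu c
    obtain ⟨l, hl⟩ := exists_zsmul_eq_of_archimedean h₀ hu (a 0)
    have hm' : (0 : ℤ) < m := by exact_mod_cast hm
    -- Removing the quotient of `k - l` by `m` leaves a point `(k - l) % m` steps above `a 0`.
    have e : c + m • (-((k - l) / (m : ℤ)) • u) = a 0 + ((k - l) % m) • u := by
      rw [hk, hl, ← natCast_zsmul, ← mul_zsmul, ← add_zsmul, ← add_zsmul]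
      congr 1
      have := Int.emod_add_mul_ediv (k - l) m
      linarith
    refine ⟨-((k - l) / (m : ℤ)) • u, ?_, ?_⟩
    · rw [e]
      exact le_add_of_nonneg_right (zsmul_nonneg h₀.le (Int.emod_nonneg _ hm'.ne'))
    · rw [e]
      refine le_trans ?_ h₁
      rw [Fin.val_last, ← natCast_zsmul]
      exact add_le_add le_rfl (zsmul_le_zsmul_left h₀.le (Int.emod_lt_of_pos _ hm').le)
  · have : DenselyOrdered H := by
      refine ⟨fun x y hxy => ?_⟩
      by_contra! h
      refine hd ⟨y - x, sub_pos.2 hxy, fun z hz => ?_⟩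
      simpa [sub_le_iff_le_add', add_comm] using h (x + z) (by simpa using hz)
    obtain ⟨p, hp, hpm⟩ := exists_pos_nsmul_le m (sub_pos.2 h0)
    obtain ⟨k, ⟨h₁, h₂⟩, -⟩ := existsUnique_add_zsmul_mem_Ico
      (nsmul_pos hp hm.ne') c (a 0)
    refine ⟨k • p, ?_, ?_⟩
    · rwa [smul_comm]
    · rw [smul_comm]
      exact h₂.le.trans (by rw [add_comm]; exact le_sub_iff_add_le.1 hpm)

variable {G G' : Type*} [AddCommGroup G] [LinearOrder G] [AddCommGroup G'] [LinearOrder G']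

theorem RegularAt.of_equiv (e : G ≅[ordGroupLang] G') {m : ℕ} (h : RegularAt G' m) :
    RegularAt G m := by
  refine (CoDef.transfer_equivalent e ?_).2 h
  unfold RegularAt
  have hadd := addCoDef_ordGroupLang (Empty.elim : Empty → G) (Empty.elim : Empty → G')
  refine CoDef.all (CoDef.forall_tuple (CoDef.imp ?_ (CoDef.ex (CoDef.and ?_ ?_))))
  · refine CoDef.finite_forall fun i => CoDef.finite_forall fun j => ?_
    by_cases hij : i < j
    · simpa only [hij, true_imp_iff] using CoDef.lt (CoDefFun.proj (Sum.inr i))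
        (CoDefFun.proj (Sum.inr j))
    · simpa only [hij, false_imp_iff, not_false_eq_true] using CoDef.false.not
  · exact CoDef.le (CoDefFun.proj (some (Sum.inr 0)))
      ((CoDefFun.proj (some (Sum.inl none))).add hadd ((CoDefFun.proj none).nsmul hadd m))
  · exact CoDef.le ((CoDefFun.proj (some (Sum.inl none))).add hadd
      ((CoDefFun.proj none).nsmul hadd m)) (CoDefFun.proj (some (Sum.inr (Fin.last m))))

theorem HasReps.of_equiv (e : G ≅[ordGroupLang] G') {n k : ℕ} (h : HasReps G' n k) :
    HasReps G n k := by
  refine (CoDef.transfer_equivalent e ?_).2 h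
  unfold HasReps
  have hadd := addCoDef_ordGroupLang (Empty.elim : Empty → G) (Empty.elim : Empty → G')
  refine CoDef.exists_tuple (CoDef.all (CoDef.finite_exists fun i => CoDef.ex (CoDef.eq ?_ ?_)))
  · exact CoDefFun.proj (some none)
  · exact (CoDefFun.proj (some (some (Sum.inr i)))).add hadd ((CoDefFun.proj none).nsmul hadd n)

end Regular

/-! ### The reduct of an elementary extension -/

section Reduct

variable {L L' : FirstOrder.Language} {G G' : Type*} [L.Structure G] [L'.Structure G]
  [L'.Structure G']

theorem CoDef.of_formula_params (f : G → G') {α : Type*} (θ : L'.Formula (G ⊕ α)) :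
    CoDef L' id f (fun v => θ.Realize (Sum.elim id v)) (fun v => θ.Realize (Sum.elim f v)) :=
  ⟨θ, fun _ => Iff.rfl, fun _ => Iff.rfl⟩

theorem realize_iff_of_elementary (f : G ↪ₑ[L'] G') {α : Type*} [Finite α]
    {θ η : L'.Formula (G ⊕ α)}
    (h : ∀ v, θ.Realize (Sum.elim id v) ↔ η.Realize (Sum.elim id v)) (v : α → G') :
    θ.Realize (Sum.elim f v) ↔ η.Realize (Sum.elim f v) := by
  have a := CoDef.of_formula_params f θ
  have b := CoDef.of_formula_params f η
  have := (CoDef.transfer_elementary f (CoDef.forall_tuple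
    (P := fun (_ : Empty → G) v => θ.Realize (Sum.elim id v) ↔ η.Realize (Sum.elim id v))
    (P' := fun (_ : Empty → G') v => θ.Realize (Sum.elim f v) ↔ η.Realize (Sum.elim f v))
    (((a.imp b).and (b.imp a)).congr (fun v => iff_iff_implies_and_implies.symm)
      (fun v => iff_iff_implies_and_implies.symm) |>.relabel Sum.inr))).1 h
  exact this v

theorem IsReductOver.exists_funMap (h : IsReductOver (Set.univ : Set G) L L') {n : ℕ}
    (F : L.Functions n) : ∃ θ : L'.Formula (G ⊕ Fin (n + 1)), ∀ (v : Fin n → G) (w : G),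
      θ.Realize (Sum.elim id (Fin.snoc v w : Fin (n + 1) → G)) ↔ Structure.funMap F v = w := by
  have := h (n + 1) {v | Structure.funMap F (fun i => v i.castSucc) = v (Fin.last n)} (by
    rw [Set.empty_definable_iff]
    refine ⟨Term.equal (Term.func F fun i => Term.var i.castSucc) (Term.var (Fin.last n)), ?_⟩
    ext v
    rw [Set.mem_ofPred_eq, Set.mem_ofPred_eq, Formula.realize_equal]
    exact Iff.rfl)
  obtain ⟨θ, a, -⟩ := dfn_iff_definable.2 this
  exact ⟨θ, fun v w => (a _).trans (by simp)⟩

theorem IsReductOver.exists_relMap (h : IsReductOver (Set.univ : Set G) L L') {n : ℕ}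
    (R : L.Relations n) : ∃ θ : L'.Formula (G ⊕ Fin n), ∀ v : Fin n → G,
      θ.Realize (Sum.elim id v) ↔ Structure.RelMap R v := by
  have := h n {v | Structure.RelMap R v} (by
    rw [Set.empty_definable_iff]
    refine ⟨Relations.formula R fun i => Term.var i, ?_⟩
    ext v
    rw [Set.mem_ofPred_eq, Set.mem_ofPred_eq, Formula.realize_rel]
    exact Iff.rfl)
  obtain ⟨θ, a, -⟩ := dfn_iff_definable.2 this
  exact ⟨θ, a⟩

theorem snoc_comp_some_none {n : ℕ} {X : Type*} (w : Option (Fin n) → X) :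
    (fun i => w (Fin.snoc (α := fun _ => Option (Fin n)) some none i)) =
      Fin.snoc (α := fun _ => X) (fun i => w (some i)) (w none) := by
  funext i
  refine Fin.lastCases ?_ (fun i => ?_) i <;> simp

theorem IsReductOver.interprets_id (h : IsReductOver (Set.univ : Set G) L L') :
    Interprets L L' (id : G → G) (id : G → G) where
  funMap {n} F := by
    obtain ⟨θ, hθ⟩ := h.exists_funMap F
    refine ((CoDef.of_formula_params id θ).relabel
      (Fin.snoc (α := fun _ => Option (Fin n)) some none)).congr ?_ ?_ <;>
    · intro w
      rw [snoc_comp_some_none, hθ, eq_comm]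
  relMap R := by
    obtain ⟨θ, hθ⟩ := h.exists_relMap R
    exact ⟨θ, hθ, hθ⟩

/-- Elementarity carries over to `G'` both that `θ` defines the graph of a function and that all
admissible choices of `θ` agree. Hence `Classical.epsilon` has only one value to choose. -/
theorem IsReductOver.interprets_reductStructure [Nonempty G']
    (h : IsReductOver (Set.univ : Set G) L L') (f : G ↪ₑ[L'] G') :
    letI := reductStructure L f
    Interprets L L' (id : G → G) f := by
  let _ := reductStructure L f
  constructor
  · intro n F
    obtain ⟨θ, hθ⟩ := h.exists_funMap F
    have hex : ∀ x : Fin n → G', ∃ y : G', ∀ z, θ.Realize (Sum.elim f (Fin.snoc x z : Fin (n + 1) → G')) ↔ z = y := by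
      have c : CoDef L' id f
          (fun w : Option (Option (Empty ⊕ Fin n)) → G =>
            θ.Realize (Sum.elim id (Fin.snoc (fun i => w (some (some (Sum.inr i)))) (w none) :
              Fin (n + 1) → G)))
          (fun w : Option (Option (Empty ⊕ Fin n)) → G' =>
            θ.Realize (Sum.elim f (Fin.snoc (fun i => w (some (some (Sum.inr i)))) (w none) :
              Fin (n + 1) → G'))) := by
        refine (((CoDef.of_formula_params f θ).relabel
          (Fin.snoc (α := fun _ => Option (Fin n)) some none)).relabel
          (fun o => o.elim none fun i => some (some (Sum.inr i)))).congr ?_ ?_ <;>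
        · intro w
          rw [snoc_comp_some_none fun o : Option (Fin n) =>
            w (o.elim none fun i => some (some (Sum.inr i)))]
          exact Iff.rfl
      have e := CoDef.eq (L₁ := L') (f := (id : G → G)) (f' := f)
        (CoDefFun.proj (none : Option (Option (Empty ⊕ Fin n)))) (CoDefFun.proj (some none))
      have := (CoDef.transfer_elementary f (CoDef.forall_tuple (α := Empty)
        (P := fun _ (x : Fin n → G) => ∃ y, ∀ z,
          θ.Realize (Sum.elim id (Fin.snoc x z : Fin (n + 1) → G)) ↔ z = y)
        (P' := fun _ (x : Fin n → G') => ∃ y, ∀ z,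
          θ.Realize (Sum.elim f (Fin.snoc x z : Fin (n + 1) → G')) ↔ z = y)
        (CoDef.ex (CoDef.all (((c.imp e).and (e.imp c)).congr (fun v => iff_iff_implies_and_implies.symm)
          (fun v => iff_iff_implies_and_implies.symm)))))).1
      exact this fun v => ⟨Structure.funMap F v, fun z => (hθ v z).trans eq_comm⟩
    refine ((CoDef.of_formula_params f θ).relabel
      (Fin.snoc (α := fun _ => Option (Fin n)) some none)).congr ?_ ?_
    · intro w
      rw [snoc_comp_some_none, hθ, eq_comm]
    · intro w
      rw [snoc_comp_some_none]
      obtain ⟨y, hy⟩ := hex fun i => w (some i)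
      rw [hy]
      let p : G' → Prop := fun z => ∃ η : L'.Formula (G ⊕ Fin (n + 1)),
        (∀ (v : Fin n → G) (w : G), η.Realize (Sum.elim id (Fin.snoc v w : Fin (n + 1) → G)) ↔
          Structure.funMap F v = w) ∧
        η.Realize (Sum.elim f (Fin.snoc (fun i => w (some i)) z : Fin (n + 1) → G'))
      have key : ∀ z, p z ↔ z = y := by
        intro z
        rw [← hy]
        refine ⟨fun ⟨η, h₁, h₂⟩ => ?_, fun h => ⟨θ, hθ, h⟩⟩
        refine (realize_iff_of_elementary f (fun v => ?_) _).1 h₂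
        obtain ⟨v, z, rfl⟩ : ∃ v' z, v = Fin.snoc (α := fun _ => G) v' z :=
          ⟨_, _, (Fin.snoc_init_self v).symm⟩
        rw [h₁, hθ]
      have : Structure.funMap F (fun i => w (some i)) = y :=
        (key _).1 (Classical.epsilon_spec (p := p) ⟨y, (key y).2 rfl⟩)
      exact (iff_of_eq (congrArg (w none = ·) this)).symm
  · intro n R
    obtain ⟨θ, hθ⟩ := h.exists_relMap R
    refine ⟨θ, hθ, fun v => ⟨fun h => ⟨θ, hθ, h⟩, fun ⟨η, h₁, h₂⟩ => ?_⟩⟩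
    exact (realize_iff_of_elementary f (fun v => (h₁ v).trans (hθ v).symm) _).1 h₂

end Reduct

/-! ### Quantifier elimination -/

section Affine

variable {G α β : Type*} [AddCommGroup G]

/-- Functions of the form `∑ cᵢ vᵢ + a` with integers `cᵢ`. -/
inductive IsAffine {G α : Type*} [AddCommGroup G] : ((α → G) → G) → Prop
  | proj (i : α) : IsAffine fun v => v i
  | const (c : G) : IsAffine fun _ => c
  | add {F E : (α → G) → G} : IsAffine F → IsAffine E → IsAffine fun v => F v + E v
  | neg {F : (α → G) → G} : IsAffine F → IsAffine fun v => - F v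

theorem IsAffine.sub {F E : (α → G) → G} (hF : IsAffine F) (hE : IsAffine E) :
    IsAffine fun v => F v - E v := by
  simpa only [sub_eq_add_neg] using hF.add hE.neg

theorem IsAffine.nsmul {F : (α → G) → G} (hF : IsAffine F) (n : ℕ) :
    IsAffine fun v => n • F v := by
  induction n with
  | zero => simpa only [zero_smul] using IsAffine.const 0
  | succ n ih => simpa only [succ_nsmul] using ih.add hF

theorem IsAffine.zsmul {F : (α → G) → G} (hF : IsAffine F) (k : ℤ) :
    IsAffine fun v => k • F v := by
  obtain ⟨n, rfl | rfl⟩ := k.eq_nat_or_neg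
  · simpa only [natCast_zsmul] using hF.nsmul n
  · simpa only [neg_zsmul, natCast_zsmul] using (hF.nsmul n).neg

theorem IsAffine.comp {F : (β → G) → G} (hF : IsAffine F) {E : β → (α → G) → G}
    (hE : ∀ i, IsAffine (E i)) : IsAffine fun v => F fun i => E i v := by
  induction hF with
  | proj i => exact hE i
  | const c => exact IsAffine.const c
  | add _ _ h₁ h₂ => exact h₁.add h₂
  | neg _ h => exact h.neg

theorem IsAffine.congr_mod {F : (α → G) → G} (hF : IsAffine F) {n : ℕ} {v w : α → G}
    (h : ∀ i, ∃ g, w i = v i + n • g) : ∃ g, F w = F v + n • g := by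
  induction hF with
  | proj i => exact h i
  | const c => exact ⟨0, by simp⟩
  | add _ _ h₁ h₂ =>
    obtain ⟨a, ha⟩ := h₁
    obtain ⟨b, hb⟩ := h₂
    exact ⟨a + b, by beta_reduce; rw [ha, hb, smul_add]; abel⟩
  | neg _ h =>
    obtain ⟨a, ha⟩ := h
    exact ⟨-a, by beta_reduce; rw [ha, smul_neg]; abel⟩

theorem IsAffine.exists_split {F : (Option α → G) → G} (hF : IsAffine F) :
    ∃ (k : ℤ) (E : (α → G) → G), IsAffine E ∧
      ∀ w, F w = k • w none + E fun i => w (some i) := by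
  induction hF with
  | proj i =>
    rcases i with _ | i
    · exact ⟨1, _, IsAffine.const 0, fun w => by simp⟩
    · exact ⟨0, _, IsAffine.proj i, fun w => by simp⟩
  | const c => exact ⟨0, _, IsAffine.const c, fun w => by simp⟩
  | add _ _ h₁ h₂ =>
    obtain ⟨k, E, h, h'⟩ := h₁
    obtain ⟨l, D, g, g'⟩ := h₂
    exact ⟨k + l, _, h.add g, fun w => by beta_reduce; rw [h', g', add_smul]; abel⟩
  | neg _ h =>
    obtain ⟨k, E, h, h'⟩ := h
    exact ⟨-k, _, h.neg, fun w => by beta_reduce; rw [h', neg_smul]; abel⟩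

variable {ι : Type*} {σ : G → ι}

/-- Membership in `P` is determined by the values of `σ` at finitely many affine functions and by
the residues of the coordinates modulo some `n`. -/
def Basic (σ : G → ι) (P : (α → G) → Prop) : Prop :=
  ∃ T : Set ((α → G) → G), T.Finite ∧ (∀ t ∈ T, IsAffine t) ∧ ∃ n : ℕ, 0 < n ∧
    ∀ v w, (∀ t ∈ T, σ (t v) = σ (t w)) → (∀ i, ∃ g, w i = v i + n • g) → P v → P w

theorem mod_symm {n : ℕ} {v w : α → G} (h : ∀ i, ∃ g, w i = v i + n • g) (i : α) :
    ∃ g, v i = w i + n • g := by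
  obtain ⟨g, hg⟩ := h i
  exact ⟨-g, by rw [hg, smul_neg]; abel⟩

theorem Basic.not {P : (α → G) → Prop} (h : Basic σ P) : Basic σ fun v => ¬ P v := by
  obtain ⟨T, hT, hA, n, hn, h⟩ := h
  exact ⟨T, hT, hA, n, hn, fun v w h₁ h₂ hP hw =>
    hP (h w v (fun t ht => (h₁ t ht).symm) (mod_symm h₂) hw)⟩

theorem Basic.and {P Q : (α → G) → Prop} (h : Basic σ P) (h' : Basic σ Q) :
    Basic σ fun v => P v ∧ Q v := by
  obtain ⟨T, hT, hA, n, hn, h⟩ := h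
  obtain ⟨T', hT', hA', n', hn', h'⟩ := h'
  refine ⟨T ∪ T', hT.union hT', fun t ht => ht.elim (hA t) (hA' t), n * n', Nat.mul_pos hn hn',
    fun v w h₁ h₂ hP => ⟨h v w (fun t ht => h₁ t (Or.inl ht)) (fun i => ?_) hP.1,
      h' v w (fun t ht => h₁ t (Or.inr ht)) (fun i => ?_) hP.2⟩⟩
  · obtain ⟨g, hg⟩ := h₂ i
    exact ⟨n' • g, by rw [hg, mul_smul]⟩
  · obtain ⟨g, hg⟩ := h₂ i
    exact ⟨n • g, by rw [hg, mul_comm, mul_smul]⟩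

theorem Basic.comp {P : (β → G) → Prop} (h : Basic σ P) {E : β → (α → G) → G}
    (hE : ∀ i, IsAffine (E i)) : Basic σ fun v => P fun i => E i v := by
  obtain ⟨T, hT, hA, n, hn, h⟩ := h
  refine ⟨(fun t v => t fun i => E i v) '' T, hT.image _, ?_, n, hn, fun v w h₁ h₂ hP => ?_⟩
  · rintro _ ⟨t, ht, rfl⟩
    exact (hA t ht).comp hE
  · exact h _ _ (fun t ht => h₁ _ ⟨t, ht, rfl⟩) (fun i => (hE i).congr_mod h₂) hP

/-- The properties of `σ` which allow the elimination of an existential quantifier. -/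
structure Eliminates (σ : G → ι) : Prop where
  eq_zero : ∀ {a b}, σ a = σ b → a = 0 → b = 0
  of_zsmul : ∀ {m : ℤ} {a b : G}, m ≠ 0 → σ (m • a) = σ (m • b) → σ a = σ b
  step : ∀ c n : ℕ, 0 < c → 0 < n → ∃ D : Set G, D.Finite ∧ ∀ S : Set (G × G), S.Finite →
    (∀ p ∈ S, ∃ g, p.2 = p.1 + (c * n) • g) →
    (∀ p ∈ S, ∀ q ∈ S, ∀ d ∈ D, σ (p.1 - q.1 + d) = σ (p.2 - q.2 + d)) →
    ∀ x, ∃ g, ∀ p ∈ S, σ (c • x + p.1) = σ (c • (x + n • g) + p.2)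

theorem exists_common_multiple {X : Type*} {T : Set X} (hT : T.Finite) (k : X → ℤ) :
    ∃ c : ℕ, 0 < c ∧ ∀ t ∈ T, k t ≠ 0 → ∃ m : ℤ, m ≠ 0 ∧ m * k t = c := by
  induction T, hT using Set.Finite.induction_on with
  | empty => exact ⟨1, one_pos, by simp⟩
  | @insert a T _ _ ih =>
    obtain ⟨c, hc, h⟩ := ih
    have hc' : (c : ℤ) ≠ 0 := by exact_mod_cast hc.ne'
    by_cases ha : k a = 0
    · refine ⟨c, hc, fun t ht hk => h t (ht.resolve_left ?_) hk⟩
      rintro rfl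
      exact hk ha
    · refine ⟨c * (k a).natAbs, Nat.mul_pos hc (Int.natAbs_pos.2 ha), ?_⟩
      rintro t (rfl | ht) hk
      · refine ⟨c * (k t).sign, mul_ne_zero hc' (by simpa using hk), ?_⟩
        rw [mul_assoc, Int.sign_mul_self_eq_natAbs]; push_cast; rfl
      · obtain ⟨m, hm, e⟩ := h t ht hk
        refine ⟨m * (k a).natAbs, mul_ne_zero hm (by simpa using ha), ?_⟩
        push_cast
        rw [← e]; ring

/-- Multiplying by the integers `m t` gives the quantified variable the same coefficient `c`
wherever it occurs. The parameters then matter only through differences of the remaining terms,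
shifted by the constants in `D`, and through the functions free of that variable. -/
theorem Basic.ex (hσ : Eliminates σ) {P : (α → G) → G → Prop}
    (h : Basic σ fun w : Option α → G => P (fun i => w (some i)) (w none)) :
    Basic σ fun v => ∃ x, P v x := by
  obtain ⟨T, hT, hA, n, hn, h⟩ := h
  choose! k E hE hk using fun t ht => (hA t ht).exists_split
  obtain ⟨c, hc, hm⟩ := exists_common_multiple hT k
  choose! m hm0 hm using hm
  obtain ⟨D, hD, hstep⟩ := hσ.step c n hc hn
  refine ⟨E '' T ∪ (fun q : (((Option α → G) → G) × ((Option α → G) → G)) × G => fun v =>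
      m q.1.1 • E q.1.1 v - m q.1.2 • E q.1.2 v + q.2) '' ((T ×ˢ T) ×ˢ D),
    (hT.image _).union (((hT.prod hT).prod hD).image _), ?_, c * n, Nat.mul_pos hc hn, ?_⟩
  · rintro _ (⟨t, ht, rfl⟩ | ⟨q, ⟨⟨h₁, h₂⟩, -⟩, rfl⟩)
    · exact hE t ht
    · exact (((hE _ h₁).zsmul _).sub ((hE _ h₂).zsmul _)).add (IsAffine.const _)
  · rintro v w hv hmod ⟨x, hx⟩
    obtain ⟨g, hg⟩ := hstep ((fun t => (m t • E t v, m t • E t w)) '' {t ∈ T | k t ≠ 0})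
      ((hT.subset fun t ht => ht.1).image _) (by
        rintro _ ⟨t, ⟨ht, -⟩, rfl⟩
        exact ((hE t ht).zsmul _).congr_mod hmod) (by
        rintro _ ⟨s, ⟨hs, -⟩, rfl⟩ _ ⟨t, ⟨ht, -⟩, rfl⟩ d hd
        exact hv _ (Or.inr ⟨((s, t), d), ⟨⟨hs, ht⟩, hd⟩, rfl⟩)) x
    -- A witness for `v` is moved within its class modulo `n` to a witness for `w`.
    refine ⟨x + n • g, ?_⟩
    refine h (fun o => o.elim x v) (fun o => o.elim (x + n • g) w) (fun t ht => ?_) ?_ hx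
    · rw [hk t ht, hk t ht]
      by_cases h0 : k t = 0
      · simpa [h0] using hv _ (Or.inl ⟨t, ht, rfl⟩)
      · refine hσ.of_zsmul (hm0 t ht h0) ?_
        have e : ∀ y z : G, m t • (k t • y + z) = c • y + m t • z := fun y z => by
          rw [smul_add, smul_smul, hm t ht h0, natCast_zsmul]
        rw [e, e]
        exact hg _ ⟨t, ⟨ht, h0⟩, rfl⟩
    · rintro (_ | i)
      · exact ⟨g, rfl⟩
      · obtain ⟨g, hg⟩ := hmod i
        exact ⟨c • g, by rw [smul_smul, mul_comm]; exact hg⟩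

variable {L : FirstOrder.Language} [L.Structure G]

theorem isAffine_realize (hF : ∀ {n} (F : L.Functions n), IsAffine fun v : Fin n → G =>
    Structure.funMap F v) (t : L.Term α) : IsAffine fun v : α → G => t.realize v := by
  induction t with
  | var i => exact IsAffine.proj i
  | func F ts ih => exact (hF F).comp ih

theorem basic_boundedFormula (hσ : Eliminates σ)
    (hF : ∀ {n} (F : L.Functions n), IsAffine fun v : Fin n → G => Structure.funMap F v)
    (hR : ∀ {n} (R : L.Relations n), Basic σ fun v : Fin n → G => Structure.RelMap R v)
    {n : ℕ} (φ : L.BoundedFormula α n) :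
    Basic σ fun w : α ⊕ Fin n → G =>
      φ.Realize (fun i => w (Sum.inl i)) fun i => w (Sum.inr i) := by
  have hw : ∀ {n} (w : α ⊕ Fin n → G),
      (Sum.elim (fun i => w (Sum.inl i)) fun i => w (Sum.inr i)) = w := by
    intro n w
    funext x; rcases x with x | x <;> rfl
  induction φ with
  | falsum => exact ⟨∅, Set.finite_empty, by simp, 1, one_pos, fun _ _ _ _ h => h⟩
  | @equal n t₁ t₂ =>
    have h := (isAffine_realize hF t₁).sub (isAffine_realize hF t₂)
    refine ⟨{fun v => t₁.realize v - t₂.realize v}, Set.finite_singleton _, fun t ht => ?_, 1, one_pos, fun v w h _ h' => ?_⟩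
    · rw [Set.mem_singleton_iff.1 ht]
      exact h
    · change Term.realize _ t₁ = Term.realize _ t₂ at h'
      change Term.realize _ t₁ = Term.realize _ t₂
      rw [hw] at h' ⊢
      exact sub_eq_zero.1 (hσ.eq_zero (h _ rfl) (sub_eq_zero.2 h'))
  | rel R ts =>
    refine cast (congrArg (Basic σ) (funext fun w => ?_))
      ((hR R).comp fun i => isAffine_realize hF (ts i))
    change _ = Structure.RelMap R fun i => Term.realize _ (ts i)
    rw [hw]
  | imp φ ψ h₁ h₂ =>
    refine cast (congrArg (Basic σ) (funext fun w => ?_)) (h₁.and h₂.not).not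
    rw [BoundedFormula.realize_imp, not_and_not_right]
  | @all n φ ih =>
    have h : Basic σ fun w : Option (α ⊕ Fin n) → G =>
        ¬ φ.Realize (fun i => w (some (Sum.inl i)))
          (Fin.snoc (fun i => w (some (Sum.inr i))) (w none)) := by
      refine cast (congrArg (Basic σ) (funext fun w => ?_))
        (ih.not.comp (E := fun i w => w (Sum.elim (fun i => some (Sum.inl i))
          (Fin.snoc (α := fun _ => Option (α ⊕ Fin n)) (fun i => some (Sum.inr i)) none) i))
          fun i => IsAffine.proj _)
      congr 2
      funext i
      refine Fin.lastCases ?_ (fun i => ?_) i <;> simp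
    have h' := (Basic.ex hσ (P := fun v x => ¬ φ.Realize (fun i => v (Sum.inl i))
      (Fin.snoc (fun i => v (Sum.inr i)) x)) h).not
    simpa using h'

theorem Dfn.basic (hσ : Eliminates σ)
    (hF : ∀ {n} (F : L.Functions n), IsAffine fun v : Fin n → G => Structure.funMap F v)
    (hR : ∀ {n} (R : L.Relations n), Basic σ fun v : Fin n → G => Structure.RelMap R v)
    {P : (α → G) → Prop} (h : Dfn L P) : Basic σ P := by
  obtain ⟨θ, a, -⟩ := h
  have h := (basic_boundedFormula hσ hF hR θ).comp (α := α)
    (E := Sum.elim (Sum.elim (fun g _ => g) fun i v => v i) finZeroElim) (by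
      rintro ((g | i) | i)
      · exact IsAffine.const g
      · exact IsAffine.proj i
      · exact i.elim0)
  refine cast (congrArg (Basic σ) (funext fun v => propext ?_)) h
  refine Iff.trans ?_ (a v)
  rw [Formula.Realize]
  refine iff_of_eq (congr (congrArg _ (funext fun x => ?_)) (Subsingleton.elim _ _))
  rcases x with x | x <;> rfl

theorem Dfn.basic_eq_zero (hσ : Eliminates fun x : G => x = 0) {P : (α → G) → Prop}
    (h : Dfn groupLang P) : Basic (fun x : G => x = 0) P := by
  refine Dfn.basic hσ ?_ ?_ h
  · rintro _ ⟨⟩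
    exact (IsAffine.proj 0).add (IsAffine.proj 1)
  · intro _ R
    exact nomatch R

/-- If some term `c • x + p.1` vanishes, the congruence between `p.1` and `p.2` supplies a shift
making the second term vanish too, and differences decide the rest. Otherwise each second term
vanishes for at most one shift, and an infinite group has a shift avoiding all of these. -/
theorem eliminates_eq_zero [IsAddTorsionFree G] [Infinite G] :
    Eliminates fun x : G => x = 0 where
  eq_zero h := (iff_of_eq h).1
  of_zsmul hm h := by simpa [hm] using h
  step c n hc hn := by
    refine ⟨{0}, Set.finite_singleton _, fun S hS hmod hσ x => ?_⟩
    by_cases hp : ∃ p ∈ S, c • x + p.1 = 0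
    · obtain ⟨p, hpS, hp⟩ := hp
      obtain ⟨g, hg⟩ := hmod p hpS
      refine ⟨-g, fun q hq => ?_⟩
      have := hσ q hq p hpS 0 rfl
      have e₁ : q.1 - p.1 + 0 = c • x + q.1 := by
        rw [eq_neg_of_add_eq_zero_left hp]; abel
      have e₂ : q.2 - p.2 + 0 = c • (x + n • -g) + q.2 := by
        rw [smul_add, smul_smul, smul_neg, hg, eq_neg_of_add_eq_zero_left hp]; abel
      rwa [e₁, e₂] at this
    · push Not at hp
      have hfin : (⋃ q ∈ S, {g : G | c • (x + n • g) + q.2 = 0}).Finite := by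
        refine hS.biUnion fun q _ => Set.Subsingleton.finite fun a ha b hb => ?_
        have h : c • (x + n • a) + q.2 = c • (x + n • b) + q.2 := ha.trans hb.symm
        rw [add_left_inj, smul_right_inj hc.ne', add_right_inj, smul_right_inj hn.ne'] at h
        exact h
      obtain ⟨g, hg⟩ := hfin.exists_notMem
      refine ⟨g, fun q hq => ?_⟩
      have h₁ := hp q hq
      have h₂ : ¬ c • (x + n • g) + q.2 = 0 := fun h => hg (Set.mem_biUnion hq h)
      simp only [h₁, h₂]

end Affine

/-! ### Signs in regular groups -/

section Sign

theorem sign_eq_sign_iff {G : Type*} [AddCommGroup G] [LinearOrder G] {a b : G} :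
    SignType.sign a = SignType.sign b ↔ (0 < a ↔ 0 < b) ∧ (a < 0 ↔ b < 0) := by
  rcases lt_trichotomy a 0 with ha | ha | ha <;> rcases lt_trichotomy b 0 with hb | hb | hb <;>
    simp [ha, hb, ha.not_gt, hb.not_gt]

variable {G : Type*} [AddCommGroup G] [LinearOrder G] [IsOrderedAddMonoid G]

theorem sign_neg_eq_sign_neg {a b : G} (h : SignType.sign a = SignType.sign b) :
    SignType.sign (-a) = SignType.sign (-b) := by
  rw [sign_eq_sign_iff] at h ⊢
  simpa [and_comm] using h

theorem zsmul_pos_iff_of_pos {m : ℤ} (hm : 0 < m) {a : G} : 0 < m • a ↔ 0 < a := by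
  refine ⟨fun h => ?_, fun h => zsmul_pos h hm⟩
  by_contra ha
  exact absurd (zsmul_nonneg (neg_nonneg.2 (not_lt.1 ha)) hm.le) (by simpa using h)

theorem sign_of_zsmul {m : ℤ} {a b : G} (hm : m ≠ 0)
    (h : SignType.sign (m • a) = SignType.sign (m • b)) : SignType.sign a = SignType.sign b := by
  have key : ∀ {m : ℤ} {a b : G}, 0 < m → SignType.sign (m • a) = SignType.sign (m • b) →
      SignType.sign a = SignType.sign b := by
    intro m a b hm h
    have e : ∀ a : G, (m • a < 0 ↔ a < 0) := fun a => by
      rw [← neg_pos, ← smul_neg, zsmul_pos_iff_of_pos hm, neg_pos]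
    rw [sign_eq_sign_iff] at h ⊢
    rwa [zsmul_pos_iff_of_pos hm, zsmul_pos_iff_of_pos hm, e, e] at h
  rcases hm.lt_or_gt with hm | hm
  · refine key (neg_pos.2 hm) ?_
    rw [neg_smul, neg_smul]
    exact sign_neg_eq_sign_neg h
  · exact key hm h

theorem exists_pos_le_abs {S : Set G} (hS : S.Finite) {a : G} (ha : 0 < a) :
    ∃ η, 0 < η ∧ ∀ z ∈ S, z ≠ 0 → η ≤ |z| := by
  induction S, hS using Set.Finite.induction_on with
  | empty => exact ⟨a, ha, by simp⟩
  | @insert b S _ _ ih =>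
    obtain ⟨η, hη, h⟩ := ih
    by_cases hb : b = 0
    · refine ⟨η, hη, fun z hz hz0 => h z (hz.resolve_left ?_) hz0⟩
      rintro rfl
      exact hz0 hb
    · refine ⟨min η |b|, lt_min hη (abs_pos.2 hb), ?_⟩
      rintro z (rfl | hz) hz0
      · exact min_le_right _ _
      · exact (min_le_left _ _).trans (h z hz hz0)

/-- The least positive element. -/
def IsLeastPos (u : G) : Prop := 0 < u ∧ ∀ x, 0 < x → u ≤ x

theorem densely_of_not_leastPos (h : ¬ ∃ u : G, IsLeastPos u) {x y : G} (hxy : x < y) :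
    ∃ z, x < z ∧ z < y := by
  by_contra! h'
  refine h ⟨y - x, sub_pos.2 hxy, fun z hz => ?_⟩
  simpa [sub_le_iff_le_add', add_comm] using h' (x + z) (by simpa using hz)

theorem exists_strictMono_between (h : ¬ ∃ u : G, IsLeastPos u) {x y : G} (hxy : x < y) (m : ℕ) :
    ∃ a : Fin (m + 1) → G, (∀ i j, i < j → a i < a j) ∧ x < a 0 ∧ a (Fin.last m) < y := by
  induction m with
  | zero =>
    obtain ⟨z, hz⟩ := densely_of_not_leastPos h hxy
    exact ⟨fun _ => z, fun i j hij => by omega, hz⟩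
  | succ m ih =>
    obtain ⟨a, ha, h0, h1⟩ := ih
    obtain ⟨z, hz, hz'⟩ := densely_of_not_leastPos h h1
    refine ⟨Fin.snoc (α := fun _ => G) a z, fun i j hij => ?_, ?_, by simpa using hz'⟩
    · induction j using Fin.lastCases with
      | last =>
        induction i using Fin.lastCases with
        | last => exact absurd hij (lt_irrefl _)
        | cast i =>
          simp only [Fin.snoc_castSucc, Fin.snoc_last]
          rcases (Fin.le_last i).eq_or_lt with rfl | hi
          · exact hz
          · exact (ha _ _ hi).trans hz
      | cast j =>
        induction i using Fin.lastCases with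
        | last => exact absurd hij (Fin.le_last _).not_gt
        | cast i => simpa using ha i j (by simpa using hij)
    · rw [← Fin.castSucc_zero, Fin.snoc_castSucc]
      exact h0

theorem RegularAt.exists_between {m : ℕ} (hr : RegularAt G m) (h : ¬ ∃ u : G, IsLeastPos u)
    (c : G) {x y : G} (hxy : x < y) : ∃ g, x < c + m • g ∧ c + m • g < y := by
  obtain ⟨a, ha, h0, h1⟩ := exists_strictMono_between h hxy m
  obtain ⟨g, hg, hg'⟩ := hr c a ha
  exact ⟨g, h0.trans_le hg, hg'.trans_lt h1⟩

theorem IsLeastPos.exists_eq_nsmul {u : G} (hu : IsLeastPos u) {N : ℕ} {z : G} (h0 : 0 ≤ z)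
    (hz : z ≤ N • u) : ∃ j ≤ N, z = j • u := by
  induction N generalizing z with
  | zero => exact ⟨0, le_rfl, by rw [zero_smul] at hz ⊢; exact le_antisymm hz h0⟩
  | succ N ih =>
    rcases h0.eq_or_lt with rfl | h0
    · exact ⟨0, by omega, by simp⟩
    · obtain ⟨j, hj, e⟩ := ih (sub_nonneg.2 (hu.2 z h0)) (by
        rw [sub_le_iff_le_add, ← succ_nsmul]; exact hz)
      exact ⟨j + 1, by omega, by rw [succ_nsmul, ← e, sub_add_cancel]⟩

theorem RegularAt.exists_eq_nsmul {u : G} (hu : IsLeastPos u) {N : ℕ} (hr : RegularAt G N)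
    (hN : 0 < N) (c : G) : ∃ (g : G) (j : ℕ), 0 < j ∧ j ≤ N ∧ c + N • g = j • u := by
  obtain ⟨g, h₁, h₂⟩ := hr c (fun i => (i : ℕ) • u) fun i j hij => by
    exact nsmul_lt_nsmul_left hu.1 hij
  simp only [Fin.val_zero, zero_smul, Fin.val_last] at h₁ h₂
  obtain ⟨j, hj, e⟩ := hu.exists_eq_nsmul h₁ h₂
  rcases Nat.eq_zero_or_pos j with rfl | hj0
  -- The residue `0` is represented by `N`, since a positive multiple of `u` is wanted.
  · refine ⟨g + u, N, hN, le_rfl, ?_⟩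
    rw [smul_add, ← add_assoc, e, zero_smul, zero_add]
  · exact ⟨g, j, hj0, hj, e⟩

/-- The constants needed to eliminate a quantifier with modulus `N`. -/
theorem exists_shift_of_pos (hr : ∀ m, 0 < m → RegularAt G m) {c n : ℕ} (hc : 0 < c)
    (hn : 0 < n) {D : Set G}
    (hD : (∃ u : G, IsLeastPos u ∧ ∀ j : ℕ, j ≤ c * n → j • u ∈ D) ∨
      ((¬ ∃ u : G, IsLeastPos u) ∧ 0 ∈ D))
    {S : Set (G × G)} (hS : S.Finite) (hmod : ∀ p ∈ S, ∃ g, p.2 = p.1 + (c * n) • g)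
    (hσ : ∀ p ∈ S, ∀ q ∈ S, ∀ d ∈ D,
      SignType.sign (p.1 - q.1 + d) = SignType.sign (p.2 - q.2 + d))
    (x : G) {p : G × G} (hp : p ∈ S) (hpos : 0 < c • x + p.1)
    (hmin : ∀ q ∈ S, |c • x + p.1| ≤ |c • x + q.1|) :
    ∃ g, ∀ q ∈ S, SignType.sign (c • x + q.1) = SignType.sign (c • (x + n • g) + q.2) := by
  have hN : 0 < c * n := Nat.mul_pos hc hn
  rw [abs_of_pos hpos] at hmin
  rcases hD with ⟨u, hu, hD⟩ | ⟨hu, hD⟩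
  -- Discrete case: the second term of `p` is moved to `j • u`. The first term of `p` exceeds `j •
  -- u` by `(c * n) • h` with `h ≥ 0`. Lowering all first terms by this amount keeps their signs,
  -- because no positive one is below that of `p`; `hσ` at `j • u` then passes to the second terms.
  · obtain ⟨g, j, hj, hjN, hg⟩ := (hr _ hN).exists_eq_nsmul hu hN (c • x + p.2)
    obtain ⟨g', hg'⟩ := hmod p hp
    refine ⟨g, fun q hq => ?_⟩
    have hs := hσ q hq p hp _ (hD j hjN)
    have e₂ : q.2 - p.2 + j • u = c • (x + n • g) + q.2 := by
      rw [← hg, smul_add, smul_smul]; abel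
    have eA : c • x + p.1 = j • u + (c * n) • (-(g + g')) := by
      rw [← hg, hg']; simp only [smul_add, smul_neg]; abel
    set h := -(g + g') with hh
    have h0 : 0 ≤ h := by
      by_contra hneg
      have h₁ := hu.2 (-h) (by simpa using hneg)
      have h₂ : (c * n) • u ≤ (c * n) • (-h) := nsmul_le_nsmul_right h₁ _
      have h₃ : j • u ≤ (c * n) • u := nsmul_le_nsmul_left hu.1.le hjN
      rw [eA] at hpos
      rw [smul_neg] at h₂
      exact absurd (h₃.trans h₂) (not_le.2 (by simpa [lt_neg_iff_add_neg', neg_lt_iff_pos_add] using hpos))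
    have e₁ : q.1 - p.1 + j • u = (c • x + q.1) - (c * n) • h := by
      have : j • u = c • x + p.1 - (c * n) • h := by rw [eA]; abel
      rw [this]; abel
    have hju : 0 < j • u := nsmul_pos hu.1 hj.ne'
    have hNh : 0 ≤ (c * n) • h := nsmul_nonneg h0 _
    rw [← e₂, ← hs, e₁]
    have hq' := hmin q hq
    rw [eA] at hq'
    rw [sign_eq_sign_iff]
    rcases lt_trichotomy (c • x + q.1) 0 with hB | hB | hB
    · have : c • x + q.1 - (c * n) • h < 0 := (sub_le_self _ hNh).trans_lt hB
      simp [hB, this, hB.not_gt, this.not_gt]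
    · rw [hB, abs_zero, ← eA] at hq'
      exact absurd hq' hpos.not_ge
    · rw [abs_of_pos hB] at hq'
      have : 0 < c • x + q.1 - (c * n) • h :=
        hju.trans_le (le_sub_iff_add_le.2 hq')
      simp [hB, this, hB.not_gt, this.not_gt]
  -- Dense case: the second term of `p` is moved to a positive `ε` below every nonzero `|q.2 -
  -- p.2|`. The other terms then take the sign of `q.2 - p.2`, or are positive when this difference
  -- is `0`.
  · obtain ⟨η, hη, hηS⟩ := exists_pos_le_abs (hS.image fun q => q.2 - p.2) hpos
    obtain ⟨g, hg, hg'⟩ := (hr _ hN).exists_between hu (c • x + p.2) hη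
    refine ⟨g, fun q hq => ?_⟩
    have hs := hσ q hq p hp _ hD
    rw [add_zero, add_zero] at hs
    have hq' := hmin q hq
    have hηq := hηS _ ⟨q, hq, rfl⟩
    set ε := c • x + p.2 + (c * n) • g with hε
    have e₂ : c • (x + n • g) + q.2 = ε + (q.2 - p.2) := by
      rw [hε, smul_add, smul_smul]; abel
    have e₁ : c • x + q.1 = (c • x + p.1) + (q.1 - p.1) := by abel
    rw [e₂, sign_eq_sign_iff]
    rw [sign_eq_sign_iff] at hs
    rcases lt_trichotomy (q.2 - p.2) 0 with hB | hB | hB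
    · have h₁ : ε + (q.2 - p.2) < 0 := by
        have := hηq hB.ne
        rw [abs_of_neg hB] at this
        have := hg'.trans_le this
        rwa [lt_neg_iff_add_neg] at this
      have h₂ : q.1 - p.1 < 0 := hs.2.2 hB
      have h₃ : c • x + q.1 < 0 := by
        by_contra h
        rw [abs_of_nonneg (not_lt.1 h), e₁] at hq'
        exact absurd (nonneg_of_le_add_right hq') h₂.not_ge
      simp [h₁, h₃, h₁.not_gt, h₃.not_gt]
    · have : q.1 - p.1 = 0 :=
        le_antisymm (not_lt.1 fun h => (hs.1.1 h).ne' hB) (not_lt.1 fun h => (hs.2.1 h).ne hB)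
      rw [hB, e₁, this, add_zero, add_zero]
      simp [hg, hpos, hg.not_gt, hpos.not_gt]
    · have h₁ : 0 < ε + (q.2 - p.2) := add_pos hg hB
      have h₂ : 0 < q.1 - p.1 := hs.1.2 hB
      have h₃ : 0 < c • x + q.1 := by rw [e₁]; exact add_pos hpos h₂
      simp [h₁, h₃, h₁.not_gt, h₃.not_gt]

/-- Everything is measured from the pair whose term is nearest to `0`. If that term is `0`, the
congruence supplies the shift. The negative case reduces to the positive one by changing all signs,
which is why `D` is chosen closed under negation. -/
theorem eliminates_sign (hr : ∀ m, 0 < m → RegularAt G m) :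
    Eliminates fun x : G => SignType.sign x where
  eq_zero h ha := by
    rw [ha, sign_zero] at h
    exact sign_eq_zero_iff.1 h.symm
  of_zsmul := sign_of_zsmul
  step c n hc hn := by
    obtain ⟨D, hDf, hneg, h0, hD⟩ : ∃ D : Set G, D.Finite ∧ (∀ d ∈ D, -d ∈ D) ∧ 0 ∈ D ∧
        ((∃ u : G, IsLeastPos u ∧ ∀ j : ℕ, j ≤ c * n → j • u ∈ D) ∨
          ((¬ ∃ u : G, IsLeastPos u) ∧ 0 ∈ D)) := by
      by_cases h : ∃ u : G, IsLeastPos u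
      · obtain ⟨u, hu⟩ := h
        refine ⟨(fun j : ℤ => j • u) '' Set.Icc (-(c * n : ℕ)) (c * n : ℕ),
          (Set.finite_Icc _ _).image _, ?_, ⟨0, ⟨neg_nonpos.2 (Nat.cast_nonneg _), Nat.cast_nonneg _⟩, by simp⟩,
          Or.inl ⟨u, hu, fun j hj =>
            ⟨j, ⟨by omega, by exact_mod_cast hj⟩, by simp⟩⟩⟩
        rintro _ ⟨j, ⟨h₁, h₂⟩, rfl⟩
        exact ⟨-j, ⟨by omega, by omega⟩, by simp⟩
      · exact ⟨{0}, Set.finite_singleton _, by simp, rfl, Or.inr ⟨h, rfl⟩⟩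
    refine ⟨D, hDf, fun S hS hmod hσ x => ?_⟩
    rcases S.eq_empty_or_nonempty with rfl | hne
    · exact ⟨0, by simp⟩
    obtain ⟨p, hp, hmin⟩ := Set.exists_min_image S (fun q => |c • x + q.1|) hS hne
    rcases lt_trichotomy (c • x + p.1) 0 with hA | hA | hA
    · obtain ⟨g, hg⟩ := exists_shift_of_pos hr hc hn hD (S := Neg.neg '' S) (hS.image _) (by
          rintro _ ⟨q, hq, rfl⟩
          obtain ⟨g, hg⟩ := hmod q hq
          exact ⟨-g, by simp only [Prod.fst_neg, Prod.snd_neg, hg, smul_neg]; abel⟩) (by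
          rintro _ ⟨q, hq, rfl⟩ _ ⟨r, hr, rfl⟩ d hd
          have := sign_neg_eq_sign_neg (hσ q hq r hr _ (hneg d hd))
          convert this using 2 <;> simp <;> abel) (-x) (p := -p) ⟨p, hp, rfl⟩ (by
          rw [smul_neg, Prod.fst_neg, ← neg_add]; exact neg_pos.2 hA) (by
          rintro _ ⟨q, hq, rfl⟩
          rw [smul_neg, Prod.fst_neg, Prod.fst_neg, ← neg_add, ← neg_add, abs_neg, abs_neg]
          exact hmin q hq)
      refine ⟨-g, fun q hq => ?_⟩
      have := sign_neg_eq_sign_neg (hg (-q) ⟨q, hq, rfl⟩)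
      convert this using 2 <;> simp <;> abel
    · obtain ⟨g, hg⟩ := hmod p hp
      refine ⟨-g, fun q hq => ?_⟩
      have := hσ q hq p hp 0 h0
      have e₁ : q.1 - p.1 + 0 = c • x + q.1 := by
        rw [eq_neg_of_add_eq_zero_left hA]; abel
      have e₂ : q.2 - p.2 + 0 = c • (x + n • -g) + q.2 := by
        rw [smul_add, smul_smul, smul_neg, hg, eq_neg_of_add_eq_zero_left hA]; abel
      rwa [e₁, e₂] at this
    · exact exists_shift_of_pos hr hc hn hD hS hmod hσ x hp hA hmin

theorem Dfn.basic_sign (hr : ∀ m, 0 < m → RegularAt G m) {α : Type*} {P : (α → G) → Prop}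
    (h : Dfn ordGroupLang P) : Basic (fun x : G => SignType.sign x) P := by
  refine Dfn.basic (eliminates_sign hr) ?_ ?_ h
  · rintro _ ⟨⟩
    exact (IsAffine.proj 0).add (IsAffine.proj 1)
  · rintro _ ⟨⟩
    refine ⟨{fun v => v 1 - v 0}, Set.finite_singleton _, fun t ht => ?_, 1, one_pos,
      fun v w h _ h' => ?_⟩
    · rw [Set.mem_singleton_iff.1 ht]
      exact (IsAffine.proj 1).sub (IsAffine.proj 0)
    · have := sign_eq_sign_iff.1 (h _ rfl)
      exact sub_pos.1 (this.1.1 (sub_pos.2 h'))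

end Sign

/-! ### Sets determined by the signs of affine functions -/

section SignDet

theorem exists_strictMono_mem {G : Type*} [LinearOrder G] {C : Set G} (hC : C.Infinite) (M : ℕ) :
    ∃ a : Fin M → G, (∀ i j, i < j → a i < a j) ∧ ∀ i, a i ∈ C := by
  obtain ⟨s, hs, hcard⟩ := hC.exists_subset_card_eq M
  exact ⟨s.orderEmbOfFin hcard, fun i j h => (s.orderEmbOfFin hcard).strictMono h,
    fun i => hs (s.orderEmbOfFin_mem hcard i)⟩

/-- No term of `B` follows a term of `A`, so a term outside `A` is preceded by terms of `B` only,
and from index `B.ncard` on these are too many. -/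
theorem mem_of_run {G : Type*} {A B : Set G} (hB : B.Finite) {q : ℕ → G} (hq : Function.Injective q) {M : ℕ}
    (hAB : ∀ i ≤ M, q i ∈ A ∨ q i ∈ B) (hup : ∀ i j, i ≤ j → j ≤ M → q i ∈ A → q j ∉ B) {i : ℕ}
    (hi : B.ncard ≤ i) (hiM : i ≤ M) : q i ∈ A := by
  refine (hAB i hiM).resolve_right fun hiB => ?_
  have hall : ∀ j ≤ i, q j ∈ B := fun j hj =>
    (hAB j (hj.trans hiM)).resolve_left fun hA => hup j i hj hiM hA hiB
  have := Finset.card_le_card_of_injOn (s := Finset.range (i + 1)) (t := hB.toFinset) q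
    (fun j hj => by simpa using hall j (by simpa [Nat.lt_succ_iff] using hj)) hq.injOn
  rw [Finset.card_range, ← Set.ncard_eq_toFinset_card B hB] at this
  omega

variable {G : Type*} [AddCommGroup G] [LinearOrder G]

/-- The signs of the affine functions `(t i).1 • y + (t i).2`. -/
def signs {r : ℕ} (t : Fin r → ℤ × G) (y : G) (i : Fin r) : SignType :=
  SignType.sign ((t i).1 • y + (t i).2)

/-- Membership in `E` is determined by the signs of `r` affine functions. -/
def SignDet (r : ℕ) (E : Set G) : Prop :=
  ∃ t : Fin r → ℤ × G, ∀ y y', signs t y = signs t y' → y ∈ E → y' ∈ E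

theorem SignDet.compl {r : ℕ} {E : Set G} (h : SignDet r E) : SignDet r Eᶜ := by
  obtain ⟨t, h⟩ := h
  exact ⟨t, fun y y' e hy hy' => hy (h y' y e.symm hy')⟩

/-- On one coset of `nG` the congruences are constant and only signs remain. The parameters enter
the affine functions through their constant terms alone, so `r` does not depend on them. -/
theorem Basic.exists_signDet {β : Type*} {P : (Option β → G) → Prop}
    (h : Basic (fun x : G => SignType.sign x) P) :
    ∃ n : ℕ, 0 < n ∧ ∃ r, ∀ (b : β → G) (c : G),
      SignDet r {y | P fun o => o.elim (c + n • y) b} := by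
  obtain ⟨T, hT, hA, n, hn, h⟩ := h
  obtain ⟨r, f, -, rfl⟩ := hT.fin_param
  choose k E hE hk using fun i => (hA (f i) ⟨i, rfl⟩).exists_split
  refine ⟨n, hn, r, fun b c => ⟨fun i => (k i * n, k i • c + E i b), fun y y' e => ?_⟩⟩
  refine h _ _ ?_ ?_
  · rintro _ ⟨i, rfl⟩
    have := congrFun e i
    have e' : ∀ y : G, k i • (c + n • y) + E i b = (k i * n) • y + (k i • c + E i b) := fun y => by
      rw [smul_add, mul_smul, natCast_zsmul]; abel
    rw [hk, hk]
    simp only [Option.elim_none, Option.elim_some, e']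
    exact this
  · rintro (_ | i)
    · exact ⟨y' - y, by simp only [Option.elim_none, smul_sub]; abel⟩
    · exact ⟨0, by simp⟩

theorem SignDet.exists_infinite_cell {r : ℕ} {t : Fin r → ℤ × G} {E : Set G} (hE : E.Infinite) :
    ∃ x ∈ E, {y | signs t y = signs t x}.Infinite := by
  by_contra! h
  refine hE (Set.Finite.subset (Set.finite_iUnion (f := fun σ : Fin r → SignType =>
    {y | y ∈ E ∧ signs t y = σ}) fun σ => ?_) fun y hy => Set.mem_iUnion.2 ⟨signs t y, hy, rfl⟩)
  by_cases hσ : ∃ x ∈ E, signs t x = σ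
  · obtain ⟨x, hx, rfl⟩ := hσ
    exact (h x hx).subset fun y hy => hy.2
  · exact Set.finite_empty.subset fun y hy => hσ ⟨y, hy⟩

variable [IsOrderedAddMonoid G]

/-- Cells are convex, because each affine function is monotone or antitone. -/
theorem signs_eq_of_mem_Icc {r : ℕ} {t : Fin r → ℤ × G} {x y z : G} (h : signs t x = signs t y)
    (h₁ : x ≤ z) (h₂ : z ≤ y) : signs t z = signs t x := by
  funext i
  have hi := congrFun h i
  have hmono : Monotone fun a : G => SignType.sign a := SignType.sign.monotone
  rcases le_total 0 (t i).1 with hk | hk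
  · have a₁ : signs t x i ≤ signs t z i := hmono (by gcongr)
    have a₂ : signs t z i ≤ signs t y i := hmono (by gcongr)
    exact le_antisymm (hi ▸ a₂) a₁
  · have e : ∀ {a b : G}, a ≤ b → (t i).1 • b ≤ (t i).1 • a := fun {a b} hab => by
      have := zsmul_le_zsmul_right (neg_nonneg.2 hk) hab
      simpa using this
    have a₁ : signs t z i ≤ signs t x i := hmono (add_le_add (e h₁) le_rfl)
    have a₂ : signs t y i ≤ signs t z i := hmono (add_le_add (e h₂) le_rfl)
    exact le_antisymm a₁ (hi ▸ a₂)

/-- Cutting `N * (m + 1)` elements of the cell into `N` blocks of `m + 1` consecutive ones yields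
`N` elements of the coset by regularity; convexity keeps them in the cell. -/
theorem signs_cell_infinite {r : ℕ} (t : Fin r → ℤ × G) {m : ℕ} (hr : RegularAt G m) {x : G}
    (hx : {y | signs t y = signs t x}.Infinite) (c : G) :
    {y | signs t (c + m • y) = signs t x}.Infinite := by
  intro hfin
  set N := hfin.toFinset.card + 1
  obtain ⟨a, ha, haC⟩ := exists_strictMono_mem hx (N * (m + 1))
  have hlt : ∀ (i : Fin N) (j : Fin (m + 1)), (i : ℕ) * (m + 1) + j < N * (m + 1) := fun i j => by
    calc (i : ℕ) * (m + 1) + j < i * (m + 1) + (m + 1) := by omega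
      _ = (i + 1) * (m + 1) := by ring
      _ ≤ N * (m + 1) := Nat.mul_le_mul_right _ i.2
  choose y hy hy' using fun i : Fin N => hr c (fun j => a ⟨i * (m + 1) + j, hlt i j⟩)
    fun j k hjk => ha _ _ (by simpa using hjk)
  have hinj : Function.Injective y := by
    have key : ∀ i j, i < j → c + m • y i < c + m • y j := fun i j hij =>
      (hy' i).trans_lt ((ha _ _ (by
        rw [Fin.lt_def]
        have : ((i : ℕ) + 1) * (m + 1) ≤ j * (m + 1) := Nat.mul_le_mul_right _ hij
        simp only [Fin.val_last, Fin.val_zero]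
        rw [add_mul] at this; omega)).trans_le (hy j))
    intro i j hij
    rcases lt_trichotomy i j with h | h | h
    · exact absurd (key i j h) (by rw [hij]; exact lt_irrefl _)
    · exact h
    · exact absurd (key j i h) (by rw [hij]; exact lt_irrefl _)
  have hmem : ∀ i, y i ∈ hfin.toFinset := fun i => by
    rw [Set.Finite.mem_toFinset]
    exact (signs_eq_of_mem_Icc ((haC _).trans (haC _).symm) (hy i) (hy' i)).trans (haC _)
  have := Finset.card_le_card_of_injOn (s := Finset.univ) y (fun i _ => hmem i) hinj.injOn
  rw [Finset.card_univ, Fintype.card_fin] at this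
  omega

theorem SignDet.finite_or_finite_compl_of_nsmul {r : ℕ} {E : Set G} (h : SignDet r E) {m : ℕ}
    (hr : RegularAt G m) (hm : {y | m • y ∈ E}.Finite ∨ {y | m • y ∈ E}ᶜ.Finite) :
    E.Finite ∨ Eᶜ.Finite := by
  by_contra! hinf
  have key : ∀ E : Set G, SignDet r E → E.Infinite → {y | m • y ∈ E}.Infinite := by
    rintro E ⟨t, ht⟩ hE
    obtain ⟨x, hx, hinf⟩ := SignDet.exists_infinite_cell (t := t) hE
    refine (signs_cell_infinite t hr hinf 0).mono fun y hy => ht x _ ?_ hx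
    rw [← hy, zero_add]
  exact hm.elim (key E h hinf.1) (key Eᶜ h.compl hinf.2)

/-! ### Progressions crossing the boundary between two infinite cells -/

/-- Two infinite cells, one inside `E` and one outside, with no other infinite cell between. -/
theorem exists_adjacent_cells {r : ℕ} {t : Fin r → ℤ × G} {E : Set G}
    (h : ∀ y y', signs t y = signs t y' → y ∈ E → y' ∈ E) (h₁ : E.Infinite) (h₂ : Eᶜ.Infinite) :
    ∃ x ∈ E, ∃ y ∉ E, {z | signs t z = signs t x}.Infinite ∧ {z | signs t z = signs t y}.Infinite ∧
      ∀ z ∈ Set.uIcc x y, {z' | signs t z' = signs t z}.Infinite →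
        signs t z = signs t x ∨ signs t z = signs t y := by
  let I : Set (Fin r → SignType) := {σ | {y | signs t y = σ}.Infinite}
  have hrep : ∀ σ ∈ I, ∃ y, signs t y = σ := fun σ hσ => hσ.nonempty
  choose! rep hrep using hrep
  obtain ⟨x₀, hx₀, hx₀'⟩ := SignDet.exists_infinite_cell (t := t) h₁
  obtain ⟨y₀, hy₀, hy₀'⟩ := SignDet.exists_infinite_cell (t := t) h₂
  have hc : ∀ y y', signs t y = signs t y' → y ∉ E → y' ∉ E := fun y y' e hy hy' =>
    hy (h y' y e.symm hy')
  -- Representatives at minimal distance give adjacent cells: the representative of a third infinite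
  -- cell between them could replace one of the two and shorten the distance.
  obtain ⟨⟨σ, τ⟩, ⟨⟨hσ, hτ⟩, hσE, hτE⟩, hmin⟩ := Set.exists_min_image
    {q : (Fin r → SignType) × (Fin r → SignType) | (q.1 ∈ I ∧ q.2 ∈ I) ∧ rep q.1 ∈ E ∧ rep q.2 ∉ E}
    (fun q => |rep q.1 - rep q.2|) (Set.toFinite _)
    ⟨(signs t x₀, signs t y₀), ⟨hx₀', hy₀'⟩, h _ _ (hrep _ hx₀').symm hx₀,
      hc _ _ (hrep _ hy₀').symm hy₀⟩
  have e₁ := hrep σ hσ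
  have e₂ := hrep τ hτ
  refine ⟨rep σ, hσE, rep τ, hτE, by rw [e₁]; exact hσ, by rw [e₂]; exact hτ, fun z hz hzi => ?_⟩
  by_contra! hne
  set q := rep (signs t z)
  have eq : signs t q = signs t z := hrep _ hzi
  -- By convexity, `z` and the representative `q` of its cell lie on the same side of every point
  -- outside that cell.
  have hout : ∀ w, signs t w ≠ signs t z → ((w < z → w < q) ∧ (z < w → q < w)) := by
    intro w hw
    refine ⟨fun hwz => ?_, fun hwz => ?_⟩ <;> by_contra! hq
    · exact hw ((signs_eq_of_mem_Icc eq hq hwz.le).trans eq)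
    · exact hw (signs_eq_of_mem_Icc eq.symm hwz.le hq)
  have o₁ := hout (rep σ) hne.1.symm
  have o₂ := hout (rep τ) hne.2.symm
  have z₁ : z ≠ rep σ := fun e => hne.1 (by rw [e])
  have z₂ : z ≠ rep τ := fun e => hne.2 (by rw [e])
  have hbetween : (rep σ < q ∧ q < rep τ) ∨ (rep τ < q ∧ q < rep σ) := by
    rcases Set.mem_uIcc.1 hz with ⟨a, b⟩ | ⟨a, b⟩
    · exact Or.inl ⟨o₁.1 (a.lt_of_ne z₁.symm), o₂.2 (b.lt_of_ne z₂)⟩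
    · exact Or.inr ⟨o₂.1 (a.lt_of_ne z₂.symm), o₁.2 (b.lt_of_ne z₁)⟩
  by_cases hqE : q ∈ E
  · have := hmin (signs t z, τ) ⟨⟨hzi, hτ⟩, hqE, hτE⟩
    refine this.not_gt ?_
    rcases hbetween with ⟨a, b⟩ | ⟨a, b⟩
    · change |q - rep τ| < |rep σ - rep τ|
      rw [abs_of_neg (sub_neg.2 b), abs_of_neg (sub_neg.2 (a.trans b))]
      simpa using a
    · change |q - rep τ| < |rep σ - rep τ|
      rw [abs_of_pos (sub_pos.2 a), abs_of_pos (sub_pos.2 (a.trans b))]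
      simpa using b
  · have := hmin (σ, signs t z) ⟨⟨hσ, hzi⟩, hσE, hqE⟩
    refine this.not_gt ?_
    rcases hbetween with ⟨a, b⟩ | ⟨a, b⟩
    · change |rep σ - q| < |rep σ - rep τ|
      rw [abs_of_neg (sub_neg.2 a), abs_of_neg (sub_neg.2 (a.trans b))]
      simpa using b
    · change |rep σ - q| < |rep σ - rep τ|
      rw [abs_of_pos (sub_pos.2 b), abs_of_pos (sub_pos.2 (a.trans b))]
      simpa using a

theorem exists_nsmul_lt_of_not_leastPos (h : ¬ ∃ u : G, IsLeastPos u) (m : ℕ) {η : G}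
    (hη : 0 < η) : ∃ p, 0 < p ∧ m • p ≤ η := by
  have : DenselyOrdered G := ⟨fun _ _ hxy => densely_of_not_leastPos h hxy⟩
  exact exists_pos_nsmul_le m hη

/-- The progression is squeezed around the zero of `k • z + e`. The bound `δ` is at most `|k • z +
e|` at `x`, at `y` and at the points of `B` where this is nonzero, and all terms stay below `δ`. The
centre `p` has its value between `-(k • w)` and `0`, so one step changes the sign. -/
theorem exists_progression_dense (hr : ∀ m, 0 < m → RegularAt G m)
    (hd : ¬ ∃ u : G, IsLeastPos u) {k : ℕ} (hk : 0 < k) {e : G} {B : Set G} (hB : B.Finite)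
    {x y : G} (hx : k • x + e < 0) (hy : 0 < k • y + e) (N : ℕ) :
    ∃ p w : G, (∀ i, 0 < i → i ≤ N → 0 < k • (p + i • w) + e ∧ p + i • w ∈ Set.Icc x y \ B) ∧
      ∀ i ≤ N, k • (p - i • w) + e < 0 ∧ p - i • w ∈ Set.Icc x y \ B := by
  obtain ⟨δ, hδ, hδB⟩ := exists_pos_le_abs
    (S := (fun z => k • z + e) '' insert y (insert x B)) (((hB.insert x).insert y).image _) hy
  obtain ⟨w, hw, hwδ⟩ := exists_nsmul_lt_of_not_leastPos hd ((N + 1) * k) hδ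
  have hkw : 0 < k • w := nsmul_pos hw hk.ne'
  obtain ⟨p, hp, hp'⟩ := (hr k hk).exists_between hd e (neg_neg_of_pos hkw)
  have hmul : ∀ i : ℕ, k • (i • w) = i • (k • w) := fun i => smul_comm _ _ _
  have hN : N • (k • w) + k • w ≤ δ := by
    rw [← succ_nsmul, ← mul_smul]; exact hwδ
  have hmem : ∀ z, |k • z + e| < δ → k • z + e ≠ 0 → z ∈ Set.Icc x y \ B := by
    intro z hz hz0
    obtain ⟨h₁, h₂⟩ := abs_lt.1 hz
    have hx' := hδB _ ⟨x, by simp, rfl⟩ hx.ne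
    have hy' := hδB _ ⟨y, by simp, rfl⟩ hy.ne'
    rw [abs_of_neg hx] at hx'
    rw [abs_of_pos hy] at hy'
    have hx'' : k • x + e < k • z + e := (le_neg.1 hx').trans_lt h₁
    have hy'' : k • z + e < k • y + e := h₂.trans_le hy'
    refine ⟨⟨(lt_of_nsmul_lt_nsmul_right k (lt_of_add_lt_add_right hx'')).le,
      (lt_of_nsmul_lt_nsmul_right k (lt_of_add_lt_add_right hy'')).le⟩, fun hzB => ?_⟩
    exact (hδB _ ⟨z, Or.inr (Or.inr hzB), rfl⟩ hz0).not_gt hz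
  refine ⟨p, w, fun i hi hiN => ?_, fun i hiN => ?_⟩
  · have e₁ : k • (p + i • w) + e = (e + k • p) + i • (k • w) := by
      rw [smul_add, hmul]; abel
    have hi1 : k • w ≤ i • (k • w) := by
      simpa using nsmul_le_nsmul_left hkw.le (show 1 ≤ i from hi)
    have hi2 : i • (k • w) ≤ N • (k • w) := nsmul_le_nsmul_left hkw.le hiN
    have hpos : 0 < k • (p + i • w) + e := by
      rw [e₁]
      have := add_lt_add_of_lt_of_le hp hi1
      rwa [neg_add_cancel] at this
    refine ⟨hpos, hmem _ ?_ hpos.ne'⟩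
    rw [abs_of_pos hpos, e₁]
    calc e + k • p + i • (k • w) < 0 + N • (k • w) := add_lt_add_of_lt_of_le hp' hi2
      _ ≤ δ := by rw [zero_add]; exact (le_add_of_nonneg_right hkw.le).trans hN
  · have e₁ : k • (p - i • w) + e = (e + k • p) - i • (k • w) := by
      rw [smul_sub, hmul]; abel
    have hi2 : i • (k • w) ≤ N • (k • w) := nsmul_le_nsmul_left hkw.le hiN
    have hi0 : 0 ≤ i • (k • w) := nsmul_nonneg hkw.le _
    have hneg : k • (p - i • w) + e < 0 := by
      rw [e₁]
      exact (sub_le_self _ hi0).trans_lt hp'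
    refine ⟨hneg, hmem _ ?_ hneg.ne⟩
    rw [abs_of_neg hneg, e₁, neg_sub]
    calc i • (k • w) - (e + k • p) < N • (k • w) - (-(k • w)) :=
          (sub_le_sub_right hi2 _).trans_lt (sub_lt_sub_left hp _)
      _ ≤ δ := by rw [sub_neg_eq_add]; exact hN

/-- Stepping by `u` away from `g`, where `k • z + e` changes sign, one meets only one of the two
cells and the finite set `B`; by `mem_of_run` only the cell remains after `B.ncard` steps. A wide
enough step jumps over the exceptional stretch. -/
theorem exists_progression_discrete {u : G} (hu : IsLeastPos u) {r : ℕ} {t : Fin r → ℤ × G}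
    {k : ℕ} (hk : 0 < k) (hr : RegularAt G k) {e : G} {B : Set G} (hB : B.Finite) {x y : G}
    (hx : ∀ z, signs t z = signs t x → k • z + e < 0)
    (hy : ∀ z, signs t z = signs t y → 0 < k • z + e)
    (hxi : {z | signs t z = signs t x}.Infinite) (hyi : {z | signs t z = signs t y}.Infinite)
    (hBx : ∀ z ∈ B, signs t z ≠ signs t x) (hBy : ∀ z ∈ B, signs t z ≠ signs t y)
    (hbet : ∀ z, ∀ x' y', signs t x' = signs t x → signs t y' = signs t y → x' ≤ z → z ≤ y' →
      signs t z = signs t x ∨ signs t z = signs t y ∨ z ∈ B) (N : ℕ) :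
    ∃ p w : G, (∀ i, 0 < i → i ≤ N → signs t (p + i • w) = signs t y) ∧
      ∀ i ≤ N, signs t (p - i • w) = signs t x := by
  obtain ⟨g, j, hj, hjk, hg⟩ := hr.exists_eq_nsmul hu hk e
  -- With centre `g - β • u` and step `(2 * β) • u`, the terms on either side lie at least `β` steps
  -- of `u` away from `g`, and at most `M` steps.
  set β := B.ncard + 2
  set M := 2 * β * N + β
  have hmono : ∀ {a b : G}, k • a + e < k • b + e → a < b := fun h =>
    lt_of_nsmul_lt_nsmul_right k (lt_of_add_lt_add_right h)
  have hle : ∀ {a b : G}, a < b → a + u ≤ b := fun h => by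
    have := hu.2 _ (sub_pos.2 h)
    rwa [le_sub_iff_add_le'] at this
  have hpos : ∀ i : ℕ, 0 < k • (g + i • u) + e := fun i => by
    have : k • (g + i • u) + e = j • u + k • (i • u) := by rw [← hg, smul_add]; abel
    rw [this]
    exact add_pos_of_pos_of_nonneg (nsmul_pos hu.1 hj.ne') (nsmul_nonneg (nsmul_nonneg hu.1.le _) _)
  -- The descent starts at `g - 2 • u`, because at `g - u` the value may be `0`.
  have hneg : ∀ i : ℕ, k • (g - (i + 2) • u) + e < 0 := fun i => by
    have : k • (g - (i + 2) • u) + e = j • u - (k * (i + 2)) • u := by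
      rw [← hg, smul_sub, mul_smul]; abel
    rw [this, sub_neg]
    refine nsmul_lt_nsmul_left hu.1 (hjk.trans_lt ?_)
    nlinarith
  obtain ⟨a, ha, haC⟩ := exists_strictMono_mem hxi (M + 1 + 1)
  obtain ⟨b, hb, hbC⟩ := exists_strictMono_mem hyi (M + 1)
  have ha' : a (Fin.last (M + 1)) < g := hmono (by
    have := hpos 0
    rw [zero_smul, add_zero] at this
    exact (hx _ (haC _)).trans this)
  have hb' : g ≤ b 0 := by
    have h₁ : k • (g - u) + e ≤ 0 := by
      have : k • (g - u) + e = j • u - k • u := by rw [← hg, smul_sub]; abel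
      rw [this, sub_nonpos]
      exact nsmul_le_nsmul_left hu.1.le hjk
    simpa using hle (hmono (h₁.trans_lt (hy _ (hbC 0))))
  have ha₀ : a 0 + (M + 1) • u ≤ a (Fin.last (M + 1)) := by
    simpa using add_nsmul_le_of_strictMono hu.2 ha (Fin.last (M + 1))
  have hb₀ : b 0 + M • u ≤ b (Fin.last M) := by
    simpa using add_nsmul_le_of_strictMono hu.2 hb (Fin.last M)
  have hR : ∀ i ≤ M, g + i • u ≤ b (Fin.last M) := fun i hi =>
    (add_le_add hb' (nsmul_le_nsmul_left hu.1.le hi)).trans hb₀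
  have hL : ∀ i ≤ M, a 0 ≤ g - (i + 2) • u := fun i hi => by
    rw [le_sub_iff_add_le]
    calc a 0 + (i + 2) • u ≤ a 0 + (M + 2) • u := by
          gcongr
          exact hu.1.le
      _ = a 0 + (M + 1) • u + u :=
          (congrArg (a 0 + ·) (succ_nsmul u (M + 1))).trans (add_assoc _ _ _).symm
      _ ≤ a (Fin.last (M + 1)) + u := by gcongr
      _ ≤ g := hle ha'
  have hinj : Function.Injective fun i : ℕ => i • u := (nsmul_left_strictMono hu.1).injective
  have hup : ∀ i, B.ncard ≤ i → i ≤ M → signs t (g + i • u) = signs t y := by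
    intro i hi hiM
    refine mem_of_run (A := {z | signs t z = signs t y}) hB (q := fun i => g + i • u)
      (fun i j h => hinj (add_left_cancel h)) (M := M) (fun i hi => ?_) (fun i j hij hj hA hjB => ?_)
      hi hiM
    · rcases hbet (g + i • u) (a 0) (b (Fin.last M)) (haC _) (hbC _)
        (hmono ((hx _ (haC _)).trans (hpos i))).le (hR i hi) with h | h | h
      · exact absurd (hx _ h) (hpos i).not_gt
      · exact Or.inl h
      · exact Or.inr h
    · refine hBy _ hjB ((signs_eq_of_mem_Icc (hA.trans (hbC (Fin.last M)).symm) ?_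
        (hR j hj)).trans hA)
      exact add_le_add le_rfl (nsmul_le_nsmul_left hu.1.le hij)
  have hdown : ∀ i, B.ncard ≤ i → i ≤ M → signs t (g - (i + 2) • u) = signs t x := by
    intro i hi hiM
    refine mem_of_run (A := {z | signs t z = signs t x}) hB (q := fun i => g - (i + 2) • u)
      (fun i j h => ?_) (M := M) (fun i hi => ?_) (fun i j hij hj hA hjB => ?_) hi hiM
    · have := hinj (sub_right_injective h)
      omega
    · rcases hbet (g - (i + 2) • u) (a 0) (b 0) (haC _) (hbC _) (hL i hi)
        (hmono ((hneg i).trans (hy _ (hbC _)))).le with h | h | h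
      · exact Or.inl h
      · exact absurd (hy _ h) (hneg i).not_gt
      · exact Or.inr h
    · refine hBx _ hjB ((signs_eq_of_mem_Icc ((haC 0).trans hA.symm) (hL j hj) ?_).trans (haC 0))
      exact sub_le_sub_left (nsmul_le_nsmul_left hu.1.le (by omega)) _
  refine ⟨g - β • u, (2 * β) • u, fun i hi hiN => ?_, fun i hiN => ?_⟩
  · have h₁ : β ≤ 2 * β * i := by nlinarith
    have h₂ : 2 * β * i ≤ 2 * β * N := Nat.mul_le_mul_left _ hiN
    have : g - β • u + i • (2 * β) • u = g + (2 * β * i - β) • u := by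
      rw [sub_nsmul u h₁, ← mul_smul, mul_comm i]; abel
    rw [this]
    refine hup _ ?_ ?_
    · have : 2 * β * 1 ≤ 2 * β * i := Nat.mul_le_mul_left _ hi
      omega
    · omega
  · have h₂ : 2 * β * i ≤ 2 * β * N := Nat.mul_le_mul_left _ hiN
    have : g - β • u - i • (2 * β) • u = g - ((2 * β * i + B.ncard) + 2) • u := by
      rw [← mul_smul, mul_comm i, sub_sub, ← add_smul]
      congr 2
      omega
    rw [this]
    exact hdown _ (by omega) (by omega)

/-- A coordinate in which the two sign vectors differ has nonzero coefficient, positive after a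
change of sign. Being injective, it cannot vanish throughout an infinite cell, so its signs on the
two cells are opposite. -/
theorem exists_separating {r : ℕ} {t : Fin r → ℤ × G} {x y : G} (hxy : x < y)
    (hne : signs t x ≠ signs t y) (hxi : {z | signs t z = signs t x}.Infinite)
    (hyi : {z | signs t z = signs t y}.Infinite) :
    ∃ (k : ℕ) (e : G), 0 < k ∧ (∀ z, signs t z = signs t x → k • z + e < 0) ∧
      ∀ z, signs t z = signs t y → 0 < k • z + e := by
  obtain ⟨i, hi⟩ := Function.ne_iff.1 hne
  obtain ⟨k, e, hk, hs, hne'⟩ : ∃ (k : ℕ) (e : G), 0 < k ∧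
      (∀ z z', signs t z = signs t z' →
        SignType.sign (k • z + e) = SignType.sign (k • z' + e)) ∧
      SignType.sign (k • x + e) ≠ SignType.sign (k • y + e) := by
    rcases lt_trichotomy (t i).1 0 with h | h | h
    · have e : ∀ z : G, (t i).1.natAbs • z + -(t i).2 = -((t i).1 • z + (t i).2) := fun z => by
        rw [← natCast_zsmul, Int.ofNat_natAbs_of_nonpos h.le, neg_smul]; abel
      refine ⟨(t i).1.natAbs, -(t i).2, Int.natAbs_pos.2 h.ne, fun z z' hz => ?_, fun hz => hi ?_⟩
      · rw [e, e]
        exact sign_neg_eq_sign_neg (congrFun hz i)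
      · rw [e, e] at hz
        have := sign_neg_eq_sign_neg hz
        rwa [neg_neg, neg_neg] at this
    · exact absurd (by simp [signs, h]) hi
    · have e : ∀ z : G, (t i).1.natAbs • z + (t i).2 = (t i).1 • z + (t i).2 := fun z => by
        rw [← natCast_zsmul, Int.natAbs_of_nonneg h.le]
      refine ⟨(t i).1.natAbs, (t i).2, Int.natAbs_pos.2 h.ne', fun z z' hz => ?_, fun hz => hi ?_⟩
      · rw [e, e]
        exact congrFun hz i
      · rw [e, e] at hz
        exact hz
  have hnz : ∀ x, {z | signs t z = signs t x}.Infinite → k • x + e ≠ 0 := by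
    intro x hx h0
    refine hx (Set.Subsingleton.finite fun a ha b hb => ?_)
    have : ∀ z, signs t z = signs t x → k • z + e = 0 := fun z hz => by
      have := hs z x hz
      rwa [h0, sign_zero, sign_eq_zero_iff] at this
    have h := (this a ha).trans (this b hb).symm
    exact (smul_right_inj hk.ne').1 (add_right_cancel h)
  have hlt : k • x + e < k • y + e := by gcongr
  have hx0 : k • x + e < 0 := by
    refine (hnz x hxi).lt_or_gt.resolve_right fun h => hne' ?_
    rw [sign_pos h, sign_pos (h.trans hlt)]
  have hy0 : 0 < k • y + e := by
    refine (hnz y hyi).lt_or_gt.resolve_left fun h => hne' ?_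
    rw [sign_neg h, sign_neg (hlt.trans h)]
  exact ⟨k, e, hk, fun z hz => (sign_eq_sign_iff.1 (hs z x hz)).2.2 hx0,
    fun z hz => (sign_eq_sign_iff.1 (hs z y hz)).1.2 hy0⟩

theorem exists_progression (hr : ∀ m, 0 < m → RegularAt G m) {r : ℕ} {t : Fin r → ℤ × G}
    {x y : G} (hxy : x < y) (hne : signs t x ≠ signs t y)
    (hxi : {z | signs t z = signs t x}.Infinite) (hyi : {z | signs t z = signs t y}.Infinite)
    (hbet : ∀ z ∈ Set.Icc x y, {z' | signs t z' = signs t z}.Infinite →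
      signs t z = signs t x ∨ signs t z = signs t y) (N : ℕ) :
    ∃ p w : G, (∀ i, 0 < i → i ≤ N → signs t (p + i • w) = signs t y) ∧
      ∀ i ≤ N, signs t (p - i • w) = signs t x := by
  obtain ⟨k, e, hk, hx, hy⟩ := exists_separating hxy hne hxi hyi
  set B := {z | {z' | signs t z' = signs t z}.Finite} with hBdef
  have hB : B.Finite := by
    by_contra hinf
    obtain ⟨z, hz, hz'⟩ := SignDet.exists_infinite_cell (t := t) hinf
    exact hz' hz
  have hbet' : ∀ z ∈ Set.Icc x y, signs t z = signs t x ∨ signs t z = signs t y ∨ z ∈ B := by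
    intro z hz
    by_cases hzB : z ∈ B
    · exact Or.inr (Or.inr hzB)
    · exact (hbet z hz hzB).imp_right Or.inl
  by_cases hd : ∃ u : G, IsLeastPos u
  · obtain ⟨u, hu⟩ := hd
    refine exists_progression_discrete hu hk (hr k hk) hB hx hy hxi hyi (fun z hz h => ?_)
      (fun z hz h => ?_) (fun z x' y' hx' hy' h₁ h₂ => ?_) N
    · exact hxi (by rw [← h]; exact hz)
    · exact hyi (by rw [← h]; exact hz)
    · rcases le_or_gt x z with h | h
      · rcases le_or_gt z y with h' | h'
        · exact hbet' z ⟨h, h'⟩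
        · exact Or.inr (Or.inl (signs_eq_of_mem_Icc hy'.symm h'.le h₂))
      · exact Or.inl ((signs_eq_of_mem_Icc hx' h₁ h.le).trans hx')
  · obtain ⟨p, w, h₁, h₂⟩ := exists_progression_dense hr hd hk hB (hx x rfl) (hy y rfl) N
    refine ⟨p, w, fun i hi hiN => ?_, fun i hiN => ?_⟩
    · obtain ⟨h, h', h''⟩ := h₁ i hi hiN
      rcases hbet' _ h' with h₃ | h₃ | h₃
      · exact absurd (hx _ h₃) h.not_gt
      · exact h₃
      · exact absurd h₃ h''
    · obtain ⟨h, h', h''⟩ := h₂ i hiN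
      rcases hbet' _ h' with h₃ | h₃ | h₃
      · exact h₃
      · exact absurd (hy _ h₃) h.not_gt
      · exact absurd h₃ h''

theorem SignDet.exists_progression (hr : ∀ m, 0 < m → RegularAt G m) {r : ℕ} {E : Set G}
    (h : SignDet r E) (h₁ : E.Infinite) (h₂ : Eᶜ.Infinite) (N : ℕ) :
    ∃ p w : G, (∀ i, 0 < i → i ≤ N → p + i • w ∈ E) ∧ ∀ i ≤ N, p - i • w ∉ E := by
  obtain ⟨t, h⟩ := h
  obtain ⟨x, hx, y, hy, hxi, hyi, hbet⟩ := exists_adjacent_cells h h₁ h₂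
  have hne : signs t x ≠ signs t y := fun e => hy (h x y e hx)
  have hxE : ∀ z, signs t z = signs t x → z ∈ E := fun z hz => h x z hz.symm hx
  have hyE : ∀ z, signs t z = signs t y → z ∉ E := fun z hz hzE => hy (h z y hz hzE)
  rcases lt_trichotomy x y with hxy | rfl | hxy
  · rw [Set.uIcc_of_lt hxy] at hbet
    -- Here `E` is on the lower side and the progression must be reversed. Recentring at `p + w`
    -- adjusts the asymmetric index ranges, at the cost of one term.
    obtain ⟨p, w, h₁, h₂⟩ := _root_.exists_progression hr hxy hne hxi hyi hbet (N + 1)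
    refine ⟨p + w, -w, fun i hi hiN => ?_, fun i hiN => ?_⟩
    · obtain ⟨i, rfl⟩ := Nat.exists_eq_succ_of_ne_zero hi.ne'
      have : p + w + (i + 1) • -w = p - i • w := by rw [smul_neg, succ_nsmul]; abel
      rw [this]
      exact hxE _ (h₂ i (by omega))
    · have : p + w - i • -w = p + (i + 1) • w := by rw [smul_neg, succ_nsmul]; abel
      rw [this]
      exact hyE _ (h₁ _ (by omega) (by omega))
  · exact absurd rfl hne
  · rw [Set.uIcc_of_gt hxy] at hbet
    obtain ⟨p, w, h₁, h₂⟩ := _root_.exists_progression hr hxy hne.symm hyi hxi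
      (fun z hz hzi => (hbet z hz hzi).symm) N
    exact ⟨p, w, fun i hi hiN => hxE _ (h₁ i hi hiN), fun i hiN => hyE _ (h₂ i hiN)⟩

end SignDet

/-! ### Ramsey's theorem for pairs -/

/-- The usual induction: one of the two colour classes above the least element is large enough for a
smaller pair of sizes. Only pairs `i < j` are coloured, so `c` need not be symmetric. -/
theorem exists_homogeneous (m n : ℕ) : ∃ N : ℕ, ∀ (X : Type) [LinearOrder X] (c : X → X → Prop)
    (S : Finset X), N ≤ S.card →
      (∃ T ⊆ S, T.card = m ∧ ∀ i ∈ T, ∀ j ∈ T, i < j → c i j) ∨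
        ∃ T ⊆ S, T.card = n ∧ ∀ i ∈ T, ∀ j ∈ T, i < j → ¬ c i j := by
  induction m generalizing n with
  | zero => exact ⟨0, fun X _ c S _ => Or.inl ⟨∅, by simp, by simp, by simp⟩⟩
  | succ m ihm =>
    induction n with
    | zero => exact ⟨0, fun X _ c S _ => Or.inr ⟨∅, by simp, by simp, by simp⟩⟩
    | succ n ihn =>
      obtain ⟨N₁, h₁⟩ := ihm (n + 1)
      obtain ⟨N₂, h₂⟩ := ihn
      refine ⟨N₁ + N₂ + 1, fun X _ c S hS => ?_⟩
      classical
      have hne : S.Nonempty := Finset.card_pos.1 (by omega)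
      set x := S.min' hne
      have hx : x ∈ S := S.min'_mem hne
      set A := (S.erase x).filter fun j => c x j
      set B := (S.erase x).filter fun j => ¬ c x j
      have hcard : A.card + B.card = S.card - 1 := by
        rw [Finset.card_filter_add_card_filter_not, Finset.card_erase_of_mem hx]
      have hA : A ⊆ S := (Finset.filter_subset _ _).trans (Finset.erase_subset _ _)
      have hB : B ⊆ S := (Finset.filter_subset _ _).trans (Finset.erase_subset _ _)
      have hlt : ∀ i ∈ S.erase x, x < i := fun i hi =>
        (S.min'_le i (Finset.mem_of_mem_erase hi)).lt_of_ne (Finset.ne_of_mem_erase hi).symm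
      have hext : ∀ (p : X → X → Prop) (T : Finset X), T ⊆ S.erase x → (∀ i ∈ T, p x i) →
          (∀ i ∈ T, ∀ j ∈ T, i < j → p i j) →
          ∃ T' ⊆ S, T'.card = T.card + 1 ∧ ∀ i ∈ T', ∀ j ∈ T', i < j → p i j := by
        intro p T hT hp hh
        refine ⟨insert x T, Finset.insert_subset hx (hT.trans (Finset.erase_subset _ _)),
          Finset.card_insert_of_notMem fun h => Finset.notMem_erase x S (hT h), ?_⟩
        intro i hi j hj hij
        rcases Finset.mem_insert.1 hi with rfl | hi
        · rcases Finset.mem_insert.1 hj with rfl | hj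
          · exact absurd hij (lt_irrefl _)
          · exact hp j hj
        · rcases Finset.mem_insert.1 hj with rfl | hj
          · exact absurd hij (hlt i (hT hi)).not_gt
          · exact hh i hi j hj hij
      rcases le_or_gt N₁ A.card with hle | hle
      · rcases h₁ X c A hle with ⟨T, hT, hc, hh⟩ | ⟨T, hT, hc, hh⟩
        · left
          rw [← hc]
          exact hext c T (hT.trans (Finset.filter_subset _ _))
            (fun i hi => (Finset.mem_filter.1 (hT hi)).2) hh
        · exact Or.inr ⟨T, hT.trans hA, hc, hh⟩
      · rcases h₂ X c B (by omega) with ⟨T, hT, hc, hh⟩ | ⟨T, hT, hc, hh⟩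
        · exact Or.inl ⟨T, hT.trans hB, hc, hh⟩
        · right
          rw [← hc]
          exact hext (fun i j => ¬ c i j) T (hT.trans (Finset.filter_subset _ _))
            (fun i hi => (Finset.mem_filter.1 (hT hi)).2) hh

/-! ### Ladders -/

section Ladder

variable {V W : Type*}

/-- `a`, `b` form a ladder for `R`, indexed by `S`. -/
def IsLadder {X V W : Type*} [LinearOrder X] (R : V → W → Prop) (S : Finset X) (a : X → V)
    (b : X → W) : Prop :=
  ∀ i ∈ S, ∀ j ∈ S, i < j → R (a i) (b j) ∧ ¬ R (a j) (b i)

/-- The ladders for `R` have bounded length. -/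
def BoundedLadders {V W : Type*} (R : V → W → Prop) : Prop :=
  ∃ N : ℕ, ∀ (X : Type) [LinearOrder X] (S : Finset X) (a : X → V) (b : X → W),
    IsLadder R S a b → S.card < N

theorem IsLadder.mono {X : Type*} [LinearOrder X] {R : V → W → Prop} {S T : Finset X} {a : X → V}
    {b : X → W} (h : IsLadder R S a b) (hT : T ⊆ S) : IsLadder R T a b :=
  fun i hi j hj hij => h i (hT hi) j (hT hj) hij

/-- Reversing the index order exchanges the two halves of the condition; nothing is demanded on the
diagonal, so none of it is lost. -/
theorem IsLadder.dual {X : Type*} [LinearOrder X] {R : V → W → Prop} {S : Finset X} {a : X → V}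
    {b : X → W} (h : IsLadder R S a b) :
    IsLadder (X := Xᵒᵈ) (fun v w => ¬ R v w) (show Finset Xᵒᵈ from S) a b :=
  fun i hi j hj hij => ⟨(h j hj i hi hij).2, not_not.2 (h j hj i hi hij).1⟩

theorem BoundedLadders.not {R : V → W → Prop} (h : BoundedLadders R) :
    BoundedLadders fun v w => ¬ R v w := by
  obtain ⟨N, h⟩ := h
  refine ⟨N, fun X _ S a b hS => h Xᵒᵈ S a b ?_⟩
  simpa only [not_not] using hS.dual

theorem not_encard_le_iff {G : Type*} {S : Set G} {k : ℕ} :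
    ¬ S.encard ≤ k ↔ ∃ x : Fin (k + 1) → G, (∀ i j, i ≠ j → x i ≠ x j) ∧ ∀ i, x i ∈ S := by
  rw [not_le]
  constructor
  · intro h
    obtain ⟨T, hTS, hT⟩ := Set.exists_subset_encard_eq (s := S) (k := (k + 1 : ℕ)) (by
      rw [Nat.cast_add, Nat.cast_one]
      exact Order.add_one_le_of_lt h)
    have hfin : T.Finite := Set.finite_of_encard_eq_coe hT
    have hc : hfin.toFinset.card = k + 1 := by
      rw [hfin.encard_eq_coe_toFinset_card] at hT
      exact_mod_cast hT
    let e := (hfin.toFinset.equivFinOfCardEq hc).symm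
    exact ⟨fun i => e i, fun i j hij h => hij (e.injective (Subtype.ext h)),
      fun i => hTS (hfin.mem_toFinset.1 (e i).2)⟩
  · rintro ⟨x, hx, hS⟩
    have hinj : Function.Injective x := fun i j h => by
      by_contra hij
      exact hx i j hij h
    have h₁ : (Set.range x).encard = (k + 1 : ℕ) := by
      rw [← Set.image_univ, hinj.encard_image, Set.encard_univ]
      simp
    have h₂ := Set.encard_le_encard (Set.range_subset_iff.2 hS)
    rw [h₁] at h₂
    refine lt_of_lt_of_le ?_ h₂
    exact_mod_cast Nat.lt_succ_self k

/-- A bound on the size of fibres is first-order: it denies the existence of `k + 1` distinct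
elements. -/
theorem CoDef.encard_le {L₁ : FirstOrder.Language} {C G G' α : Type*} [L₁.Structure G]
    [L₁.Structure G'] {f : C → G} {f' : C → G'} {Q : (α → G) → G → Prop}
    {Q' : (α → G') → G' → Prop}
    (h : CoDef L₁ f f' (fun w : Option α → G => Q (fun i => w (some i)) (w none))
      (fun w : Option α → G' => Q' (fun i => w (some i)) (w none))) (k : ℕ) :
    CoDef L₁ f f' (fun v => {z | Q v z}.encard ≤ k) (fun v => {z | Q' v z}.encard ≤ k) := by
  have h' : CoDef L₁ f f'
      (fun v => ∃ x : Fin (k + 1) → G, (∀ i j, i ≠ j → x i ≠ x j) ∧ ∀ i, Q v (x i))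
      (fun v => ∃ x : Fin (k + 1) → G', (∀ i j, i ≠ j → x i ≠ x j) ∧ ∀ i, Q' v (x i)) := by
    refine CoDef.exists_tuple (CoDef.and
      (CoDef.finite_forall fun i => CoDef.finite_forall fun j => ?_)
      (CoDef.finite_forall fun i => ?_))
    · by_cases hij : i = j
      · simpa only [hij, ne_eq, not_true_eq_false, false_imp_iff, not_false_eq_true] using
          CoDef.false.not
      · simpa only [hij, ne_eq, not_false_eq_true, true_imp_iff] using
          (CoDef.eq (CoDefFun.proj (Sum.inr i)) (CoDefFun.proj (Sum.inr j))).not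
    · exact h.relabel fun o => o.elim (Sum.inr i) Sum.inl
  exact h'.not.congr (fun v => not_iff_comm.1 not_encard_le_iff)
    (fun v => not_iff_comm.1 not_encard_le_iff)

end Ladder

/-! ### Stability from small fibres -/

section Stability

variable {L : FirstOrder.Language} {G : Type*} [L.Structure G]

theorem apply_option_elim {X Y Z : Type*} (w : Y → Z) (x : Y) (f : X → Y) :
    (fun o : Option X => w (o.elim x f)) = fun o => o.elim (w x) fun i => w (f i) := by
  funext o; cases o <;> rfl

/-- The definable relations between `α`-tuples and other tuples have bounded ladders. -/
def LaddersBounded (L : FirstOrder.Language) (G : Type*) [L.Structure G] (α : Type) : Prop :=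
  ∀ (β : Type) [Finite β] (R : (α → G) → (β → G) → Prop),
    Dfn L (fun w : α ⊕ β → G => R (fun i => w (Sum.inl i)) fun i => w (Sum.inr i)) →
      BoundedLadders R

theorem LaddersBounded.of_equiv {α α' : Type} (e : α ≃ α') (h : LaddersBounded L G α) :
    LaddersBounded L G α' := by
  intro β _ R hR
  obtain ⟨N, hN⟩ := h β (fun v w => R (fun i => v (e.symm i)) w)
    (hR.relabel (Sum.map e.symm id))
  refine ⟨N, fun X _ S a b hS => hN X S (fun x i => a x (e i)) b ?_⟩
  simpa [IsLadder] using hS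

theorem laddersBounded_empty (α : Type) [IsEmpty α] : LaddersBounded L G α := by
  intro β _ R _
  refine ⟨4, fun X _ S a b hS => ?_⟩
  by_contra! h
  let o := S.orderEmbOfFin rfl
  have hm : ∀ i, o i ∈ S := fun i => S.orderEmbOfFin_mem rfl i
  have h₁ := (hS _ (hm ⟨0, by omega⟩) _ (hm ⟨1, by omega⟩) (o.strictMono (by simp))).1
  have h₂ := (hS _ (hm ⟨1, by omega⟩) _ (hm ⟨2, by omega⟩) (o.strictMono (by simp))).2
  rw [Subsingleton.elim (a (o ⟨2, _⟩)) (a (o ⟨0, by omega⟩))] at h₂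
  exact h₂ h₁

/-- Colour `i < j` by whether the whole `Q`-fibre over the tail of `a i` satisfies `R` against `b
j`. If this holds on a large set, the tails form a ladder for a relation on `α`-tuples, since `a j`
itself witnesses the failure against `b i`. If it fails throughout, adding `R` against the last `b
m` to `Q` strictly shrinks every fibre while keeping `a i`, and induction on `k` applies. -/
theorem ladder_card_lt_of_small {α : Type} (hα : LaddersBounded L G α) (k : ℕ) {β : Type}
    [Finite β] {R : (Option α → G) → (β → G) → Prop}
    (hR : Dfn L (fun w : Option α ⊕ β → G => R (fun i => w (Sum.inl i)) fun i => w (Sum.inr i)))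
    {β' : Type} [Finite β'] {Q : (Option α → G) → (β' → G) → Prop}
    (hQ : Dfn L (fun w : Option α ⊕ β' → G => Q (fun i => w (Sum.inl i)) fun i => w (Sum.inr i))) :
    ∃ N : ℕ, ∀ (X : Type) [LinearOrder X] (S : Finset X) (a : X → Option α → G) (b : X → β → G)
      (e : β' → G), IsLadder R S a b → (∀ i ∈ S, Q (a i) e) →
        (∀ i ∈ S, {z | Q (fun o => o.elim z fun j => a i (some j)) e}.encard ≤ k) →
          S.card < N := by
  have hself : ∀ v : Option α → G, (fun o : Option α => o.elim (v none) fun j => v (some j)) = v :=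
    fun v => by funext o; cases o <;> rfl
  induction k generalizing β' Q with
  | zero =>
    refine ⟨1, fun X _ S a b e _ hS hk => ?_⟩
    rw [Nat.lt_one_iff, Finset.card_eq_zero, Finset.eq_empty_iff_forall_notMem]
    intro i hi
    have := hk i hi
    rw [Nat.cast_zero, nonpos_iff_eq_zero, Set.encard_eq_zero] at this
    have h : a i none ∈ {z | Q (fun o => o.elim z fun j => a i (some j)) e} := by
      change Q _ e
      rw [hself]
      exact hS i hi
    rw [this] at h
    exact h
  | succ k ih =>
    have hψ : Dfn L (fun w : α ⊕ (β ⊕ β') → G => ∀ z,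
        Q (fun o => o.elim z fun i => w (Sum.inl i)) (fun i => w (Sum.inr (Sum.inr i))) →
          R (fun o => o.elim z fun i => w (Sum.inl i)) fun i => w (Sum.inr (Sum.inl i))) := by
      refine CoDef.all (CoDef.imp ?_ ?_)
      · have h := hQ.relabel (Sum.elim (fun o => o.elim none fun i => some (Sum.inl i))
          fun i => some (Sum.inr (Sum.inr i)) : Option α ⊕ β' → Option (α ⊕ (β ⊕ β')))
        simp only [Sum.elim_inl, Sum.elim_inr, apply_option_elim] at h
        exact h
      · have h := hR.relabel (Sum.elim (fun o => o.elim none fun i => some (Sum.inl i))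
          fun i => some (Sum.inr (Sum.inl i)) : Option α ⊕ β → Option (α ⊕ (β ⊕ β')))
        simp only [Sum.elim_inl, Sum.elim_inr, apply_option_elim] at h
        exact h
    obtain ⟨N₁, h₁⟩ := hα (β ⊕ β') (fun x y => ∀ z,
        Q (fun o => o.elim z x) (fun i => y (Sum.inr i)) →
          R (fun o => o.elim z x) fun i => y (Sum.inl i)) hψ
    have hQ' : Dfn L (fun w : Option α ⊕ (β' ⊕ β) → G =>
        Q (fun i => w (Sum.inl i)) (fun i => w (Sum.inr (Sum.inl i))) ∧
          R (fun i => w (Sum.inl i)) fun i => w (Sum.inr (Sum.inr i))) :=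
      (hQ.relabel (Sum.map id Sum.inl)).and (hR.relabel (Sum.map id Sum.inr))
    obtain ⟨N₂, h₂⟩ := ih (Q := fun x y => Q x (fun i => y (Sum.inl i)) ∧ R x fun i => y (Sum.inr i))
      hQ'
    obtain ⟨N, hN⟩ := exists_homogeneous N₁ (N₂ + 1)
    refine ⟨N, fun X _ S a b e hS hSQ hk => ?_⟩
    by_contra! hle
    rcases hN X (fun i j => ∀ z, Q (fun o => o.elim z fun l => a i (some l)) e →
      R (fun o => o.elim z fun l => a i (some l)) (b j)) S hle with ⟨T, hT, hc, hh⟩ | ⟨T, hT, hc, hh⟩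
    · refine (h₁ X T (fun i l => a i (some l)) (fun j => Sum.elim (b j) e) ?_).ne hc
      intro i hi j hj hij
      refine ⟨hh i hi j hj hij, fun h => ?_⟩
      have := h (a j none)
      simp only [Sum.elim_inl, Sum.elim_inr, hself] at this
      exact (hS i (hT hi) j (hT hj) hij).2 (this (hSQ j (hT hj)))
    · have hne : T.Nonempty := Finset.card_pos.1 (by omega)
      set m := T.max' hne
      have hm : m ∈ T := T.max'_mem hne
      have hT' : ∀ i ∈ T.erase m, i ∈ T ∧ i < m := fun i hi =>
        ⟨Finset.mem_of_mem_erase hi,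
          (T.le_max' i (Finset.mem_of_mem_erase hi)).lt_of_ne (Finset.ne_of_mem_erase hi)⟩
      have := h₂ X (T.erase m) a b (Sum.elim e (b m))
        (hS.mono ((Finset.erase_subset _ _).trans hT))
        (fun i hi => ⟨hSQ i (hT (hT' i hi).1), (hS i (hT (hT' i hi).1) m (hT hm) (hT' i hi).2).1⟩)
        (fun i hi => by
          have hki := hk i (hT (hT' i hi).1)
          have hni := hh i (hT' i hi).1 m hm (hT' i hi).2
          push Not at hni
          obtain ⟨z, hz, hz'⟩ := hni
          have hfin : {z | Q (fun o => o.elim z fun j => a i (some j)) e}.Finite :=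
            Set.finite_of_encard_le_coe hki
          refine Order.le_of_lt_add_one (lt_of_lt_of_le ?_ hki)
          refine (hfin.subset fun z hz => hz.1).encard_lt_encard ?_
          exact ⟨fun z hz => hz.1, fun h => hz' (h hz).2⟩)
      rw [Finset.card_erase_of_mem hm, hc] at this
      omega

/-- Smallness of the fibre is itself a definable relation with bounded ladders. By Ramsey, either
the fibres over `a i` against `b j` with `i < j` are all small, or they are all large and those with
`i > j` are uniformly small or large. The mixed pattern is a ladder for largeness. In the two
others, fixing the last or the first `b` leaves fibres of `R` or of its negation that are all small.
-/
theorem boundedLadders_of_small_fibres {α : Type} (hα : LaddersBounded L G α) {k : ℕ} {β : Type}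
    [Finite β] {R : (Option α → G) → (β → G) → Prop}
    (hR : Dfn L (fun w : Option α ⊕ β → G => R (fun i => w (Sum.inl i)) fun i => w (Sum.inr i)))
    (hk : ∀ x y, {z | R (fun o => o.elim z x) y}.encard ≤ k ∨
      {z | ¬ R (fun o => o.elim z x) y}.encard ≤ k) : BoundedLadders R := by
  have hθ : BoundedLadders fun (x : α → G) y => {z | R (fun o => o.elim z x) y}.encard ≤ k := by
    refine hα β _ (CoDef.encard_le ?_ k)
    have h := hR.relabel (Sum.elim (fun o => o.elim none fun i => some (Sum.inl i))
      fun i => some (Sum.inr i) : Option α ⊕ β → Option (α ⊕ β))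
    simp only [Sum.elim_inl, Sum.elim_inr, apply_option_elim] at h
    exact h
  obtain ⟨N₀, h₀⟩ := hθ.not
  obtain ⟨N₁, h₁⟩ := ladder_card_lt_of_small hα k hR hR
  obtain ⟨N₂, h₂⟩ := ladder_card_lt_of_small hα k (R := fun x y => ¬ R x y)
    hR.not (Q := fun x y => ¬ R x y) hR.not
  obtain ⟨M, hM⟩ := exists_homogeneous N₀ (N₂ + 1)
  obtain ⟨N, hN⟩ := exists_homogeneous (N₁ + 1) M
  refine ⟨N, fun X _ S a b hS => ?_⟩
  by_contra! hle
  rcases hN X (fun i j => {z | R (fun o => o.elim z fun l => a i (some l)) (b j)}.encard ≤ k) S hle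
    with ⟨T, hT, hc, hh⟩ | ⟨T, hT, hc, hh⟩
  · have hne : T.Nonempty := Finset.card_pos.1 (by omega)
    set m := T.max' hne
    have hm : m ∈ T := T.max'_mem hne
    have hT' : ∀ i ∈ T.erase m, i ∈ T ∧ i < m := fun i hi =>
      ⟨Finset.mem_of_mem_erase hi,
        (T.le_max' i (Finset.mem_of_mem_erase hi)).lt_of_ne (Finset.ne_of_mem_erase hi)⟩
    have := h₁ X (T.erase m) a b (b m) (hS.mono ((Finset.erase_subset _ _).trans hT))
      (fun i hi => (hS i (hT (hT' i hi).1) m (hT hm) (hT' i hi).2).1)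
      (fun i hi => hh i (hT' i hi).1 m hm (hT' i hi).2)
    rw [Finset.card_erase_of_mem hm, hc] at this
    omega
  · rcases hM X (fun i j => {z | R (fun o => o.elim z fun l => a j (some l)) (b i)}.encard ≤ k) T
      hc.ge with ⟨T', hT', hc', hh'⟩ | ⟨T', hT', hc', hh'⟩
    · refine (h₀ X T' (fun i l => a i (some l)) b ?_).ne hc'
      exact fun i hi j hj hij => ⟨hh i (hT' hi) j (hT' hj) hij, not_not.2 (hh' i hi j hj hij)⟩
    · have hne : T'.Nonempty := Finset.card_pos.1 (by omega)
      set m := T'.min' hne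
      have hm : m ∈ T' := T'.min'_mem hne
      have hlt : ∀ i ∈ T'.erase m, i ∈ T' ∧ m < i := fun i hi =>
        ⟨Finset.mem_of_mem_erase hi,
          (T'.min'_le i (Finset.mem_of_mem_erase hi)).lt_of_ne (Finset.ne_of_mem_erase hi).symm⟩
      have hS' := (hS.mono (hT'.trans hT)).mono (Finset.erase_subset m _)
      have hlt' : @Finset.card X (T'.erase m) < N₂ := h₂ Xᵒᵈ (T'.erase m) a b (b m) hS'.dual
        (fun i hi => (hS m (hT (hT' hm)) i (hT (hT' (hlt i hi).1)) (hlt i hi).2).2)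
        (fun i hi => (hk _ _).resolve_left (hh' m hm i (hlt i hi).1 (hlt i hi).2))
      rw [Finset.card_erase_of_mem hm, hc'] at hlt'
      omega

/-- Parameters of the defining formula are absorbed into the second tuple. -/
theorem IsStableStructure.boundedLadders (h : IsStableStructure L G) {m : ℕ}
    {R : (Fin m → G) → (Fin m → G) → Prop}
    (hR : Dfn L (fun w : Fin m ⊕ Fin m → G => R (fun i => w (Sum.inl i)) fun i => w (Sum.inr i))) :
    ∃ N : ℕ, ¬ ∃ a b : Fin N → Fin m → G, ∀ i j, R (a i) (b j) ↔ i < j := by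
  obtain ⟨A, φ, hφ⟩ := hR.exists_finset
  obtain ⟨l, ⟨e⟩⟩ := Finite.exists_equiv_fin (A ⊕ Fin m)
  obtain ⟨N, hN⟩ := h m l (φ.relabel (Sum.elim (fun x => Sum.inr (e (Sum.inl x)))
    (Sum.elim Sum.inl fun x => Sum.inr (e (Sum.inr x)))))
  refine ⟨N, fun ⟨a, b, hab⟩ => hN ⟨a, fun j x => Sum.elim (↑) (b j) (e.symm x), fun i j => ?_⟩⟩
  rw [← hab, Formula.realize_relabel]
  refine Iff.trans (iff_of_eq (congrArg _ (funext fun x => ?_))) (hφ (Sum.elim (a i) (b j))).symm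
  rcases x with x | x | x <;> simp

/-! ### From uniform smallness to stability -/

variable [AddCommGroup G]

/-- On every coset of some `nG`, the members of a definable family of subsets of `G` are of
bounded size or have complements of bounded size. -/
def UniformlySmall (L : FirstOrder.Language) (G : Type*) [L.Structure G] [AddCommGroup G] : Prop :=
  ∀ (β : Type) [Finite β] (P : (Option β → G) → Prop), Dfn L P →
    ∃ n : ℕ, 0 < n ∧ ∃ k : ℕ, ∀ (b : β → G) (c : G),
      {y | P fun o => o.elim (c + n • y) b}.encard ≤ k ∨
        {y | ¬ P fun o => o.elim (c + n • y) b}.encard ≤ k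

/-- By pigeonhole many first coordinates lie in one coset `r j + nG`. Writing them as `r j + n • y`,
with `r j` moved to the right-hand tuple, makes the fibres in `y` small or their complements small.
-/
theorem UniformlySmall.laddersBounded_option (h : UniformlySmall L G)
    (hadd : AddCoDef L (id : G → G) (id : G → G)) (hrep : ∀ n, 0 < n → ∃ k, HasReps G n k)
    {α : Type} [Finite α] (hα : LaddersBounded L G α) : LaddersBounded L G (Option α) := by
  intro β _ R hR
  obtain ⟨n, hn, k, hk⟩ := h (α ⊕ β)
    (fun w => R (fun o => o.elim (w none) fun i => w (some (Sum.inl i)))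
      fun i => w (some (Sum.inr i))) (by
      have h := hR.relabel (Sum.elim (fun o => o.elim none fun i => some (Sum.inl i))
        fun i => some (Sum.inr i) : Option α ⊕ β → Option (α ⊕ β))
      simp only [Sum.elim_inl, Sum.elim_inr, apply_option_elim] at h
      exact h)
  have hR' : Dfn L (fun w : Option α ⊕ Option β → G =>
      R (fun o => o.elim (w (Sum.inr none) + n • w (Sum.inl none)) fun i => w (Sum.inl (some i)))
        fun i => w (Sum.inr (some i))) := by
    refine (CoDef.comp hR (F := Sum.elim (fun o => o.elim
      (fun w => w (Sum.inr none) + n • w (Sum.inl none)) fun i w => w (Sum.inl (some i)))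
      fun i w => w (Sum.inr (some i))) (F' := Sum.elim (fun o => o.elim
      (fun w => w (Sum.inr none) + n • w (Sum.inl none)) fun i w => w (Sum.inl (some i)))
      fun i w => w (Sum.inr (some i))) ?_).congr ?_ ?_
    · rintro ((_ | i) | i)
      · exact (CoDefFun.proj _).add hadd ((CoDefFun.proj _).nsmul hadd n)
      · exact CoDefFun.proj _
      · exact CoDefFun.proj _
    all_goals
      intro w
      refine iff_of_eq (congrArg (fun x => R x _) (funext fun o => ?_))
      cases o <;> rfl
  obtain ⟨N, hN⟩ := boundedLadders_of_small_fibres hα (k := k)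
    (R := fun x y => R (fun o => o.elim (y none + n • x none) fun i => x (some i))
      fun i => y (some i)) hR' (fun x y => hk (Sum.elim x fun i => y (some i)) (y none))
  obtain ⟨K, r, hr⟩ := hrep n hn
  refine ⟨K * N + 1, fun X _ S a b hS => ?_⟩
  by_contra! hle
  choose c y hy using fun i => hr (a i none)
  have hK : (Finset.univ : Finset (Fin K)).Nonempty := by
    have : S.Nonempty := Finset.card_pos.1 (by omega)
    obtain ⟨i, -⟩ := this
    exact ⟨c i, Finset.mem_univ _⟩
  obtain ⟨j, -, hj⟩ := Finset.exists_le_card_fiber_of_mul_le_card_of_maps_to (s := S)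
    (t := Finset.univ) (f := c) (n := N) (fun _ _ => Finset.mem_univ _) hK (by
      rw [Finset.card_univ, Fintype.card_fin]; omega)
  refine (hN X (S.filter fun i => c i = j) (fun i o => o.elim (y i) fun l => a i (some l))
    (fun i o => o.elim (r j) (b i)) ?_).not_ge hj
  have key : ∀ i ∈ S.filter (fun i => c i = j), (fun o : Option α =>
      o.elim (r j + n • y i) fun l => a i (some l)) = a i := by
    intro i hi
    rw [← (Finset.mem_filter.1 hi).2, ← hy i]
    funext o; cases o <;> rfl
  intro i hi i' hi' hii'
  have := hS i (Finset.mem_filter.1 hi).1 i' (Finset.mem_filter.1 hi').1 hii'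
  simp only [Option.elim_none, Option.elim_some, key i hi, key i' hi']
  exact this

theorem UniformlySmall.isStableStructure (h : UniformlySmall L G)
    (hadd : AddCoDef L (id : G → G) (id : G → G)) (hrep : ∀ n, 0 < n → ∃ k, HasReps G n k) :
    IsStableStructure L G := by
  have hfin : ∀ m, LaddersBounded L G (Fin m) := by
    intro m
    induction m with
    | zero => exact laddersBounded_empty _
    | succ m ih => exact (h.laddersBounded_option hadd hrep ih).of_equiv (finSuccEquiv m).symm
  intro m n φ
  obtain ⟨N, hN⟩ := hfin m (Fin n) (fun x y => φ.Realize (Sum.elim x y)) (by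
    refine (Dfn.of_formula φ).congr ?_ ?_ <;>
    · intro v
      refine iff_of_eq (congrArg _ (funext fun x => ?_))
      rcases x with x | x <;> rfl)
  refine ⟨N, fun ⟨a, b, hab⟩ => ?_⟩
  have := hN (Fin N) Finset.univ a b fun i _ j _ hij =>
    ⟨(hab i j).2 hij, fun h => ((hab j i).1 h).not_gt hij⟩
  simp at this

end Stability

/-! ### Uniform bounds -/

theorem encard_le_of_injOn_signs {G : Type*} [AddCommGroup G] [LinearOrder G] {r : ℕ} {t : Fin r → ℤ × G} {R : Set G}
    (h : Set.InjOn (signs t) R) : R.encard ≤ (Nat.card (Fin r → SignType) : ℕ) := by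
  rw [← h.encard_image]
  refine (Set.encard_le_encard (Set.subset_univ _)).trans ?_
  rw [Set.encard_univ, ENat.card_eq_coe_natCard]

theorem exists_last_nsmul {G : Type*} [AddCommGroup G] {p : G → Prop} {y u : G} (h0 : p y) {j : ℕ} (hj : ¬ p (y + j • u)) :
    ∃ i < j, p (y + i • u) ∧ ¬ p (y + i • u + u) := by
  induction j with
  | zero => exact absurd h0 (by simpa using hj)
  | succ j ih =>
    by_cases hp : p (y + j • u)
    · exact ⟨j, Nat.lt_succ_self _, hp, by rwa [add_assoc, ← succ_nsmul]⟩
    · obtain ⟨i, hi, h⟩ := ih hp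
      exact ⟨i, hi.trans (Nat.lt_succ_self _), h⟩

section Uniform

variable {L : FirstOrder.Language} {G : Type*} [L.Structure G] [AddCommGroup G] [LinearOrder G]
  [IsOrderedAddMonoid G]

/-- The definable subsets of `G` which are determined by the signs of finitely many affine functions
are finite or cofinite. -/
def SignDetFinite (L : FirstOrder.Language) (G : Type*) [L.Structure G] [AddCommGroup G]
    [LinearOrder G] : Prop :=
  ∀ (E : Set G) (r : ℕ), Dfn L (fun v : Unit → G => v () ∈ E) → SignDet r E →
    E.Finite ∨ Eᶜ.Finite

theorem IsStableStructure.signDetFinite (h : IsStableStructure L G)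
    (hadd : AddCoDef L (id : G → G) (id : G → G)) (hr : ∀ m, 0 < m → RegularAt G m) :
    SignDetFinite L G := by
  intro E r hE hdet
  by_contra! hinf
  obtain ⟨N, hN⟩ := h.boundedLadders (m := 1) (R := fun x y => x 0 + y 0 ∈ E)
    (CoDef.comp hE (F := fun _ w => w (Sum.inl 0) + w (Sum.inr 0))
      (F' := fun _ w => w (Sum.inl 0) + w (Sum.inr 0))
      fun _ => (CoDefFun.proj _).add hadd (CoDefFun.proj _))
  obtain ⟨p, w, h₁, h₂⟩ := hdet.exists_progression hr hinf.1 hinf.2 N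
  refine hN ⟨fun i _ => p - (i : ℕ) • w, fun j _ => (j : ℕ) • w, fun i j => ?_⟩
  rcases lt_or_ge i j with hij | hij
  · have hij' : (i : ℕ) ≤ j := hij.le
    have : p - (i : ℕ) • w + (j : ℕ) • w = p + ((j : ℕ) - i) • w := by
      rw [sub_nsmul w hij']; abel
    simp only [hij, iff_true, this]
    exact h₁ _ (Nat.sub_pos_of_lt hij) (by omega)
  · have hij' : (j : ℕ) ≤ i := hij
    have : p - (i : ℕ) • w + (j : ℕ) • w = p - ((i : ℕ) - j) • w := by
      rw [sub_nsmul w hij']; abel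
    simp only [hij.not_gt, iff_false, this]
    exact h₂ _ (by omega)

theorem signDetFinite_of_nsmul (hr : ∀ m, 0 < m → RegularAt G m)
    (h : ∀ D : Set G, Dfn L (fun v : Unit → G => v () ∈ D) →
      ∃ m : ℕ, 0 < m ∧ ({y | m • y ∈ D}.Finite ∨ {y | m • y ∈ D}ᶜ.Finite)) :
    SignDetFinite L G := by
  intro E r hE hdet
  obtain ⟨m, hm, h⟩ := h E hE
  exact hdet.finite_or_finite_compl_of_nsmul (hr m hm) h

theorem injOn_signs_of_runs {r : ℕ} {t : Fin r → ℤ × G} {E R : Set G}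
    (h : ∀ y y', signs t y = signs t y' → y ∈ E → y' ∈ E) (hR : R ⊆ E)
    (hgap : ∀ y ∈ R, ∀ y' ∈ R, y < y' → ∃ z, y ≤ z ∧ z ≤ y' ∧ z ∉ E) :
    Set.InjOn (signs t) R := by
  have key : ∀ y ∈ R, ∀ y' ∈ R, y < y' → signs t y ≠ signs t y' := by
    intro y hy y' hy' hlt he
    obtain ⟨z, h₁, h₂, hz⟩ := hgap y hy y' hy' hlt
    exact hz (h y z (signs_eq_of_mem_Icc he h₁ h₂).symm (hR hy))
  intro y hy y' hy' he
  rcases lt_trichotomy y y' with hlt | heq | hlt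
  · exact absurd he (key y hy y' hy' hlt)
  · exact heq
  · exact absurd he.symm (key y' hy' y hy hlt)

theorem SignDet.encard_le_of_dense (hd : ¬ ∃ u : G, IsLeastPos u) {r : ℕ} {E : Set G}
    (h : SignDet r E) (hE : E.Finite) : E.encard ≤ (Nat.card (Fin r → SignType) : ℕ) := by
  obtain ⟨t, h⟩ := h
  refine encard_le_of_injOn_signs (injOn_signs_of_runs h Set.Subset.rfl fun y _ y' _ hlt => ?_)
  by_contra! hall
  have : DenselyOrdered G := ⟨fun _ _ hxy => densely_of_not_leastPos hd hxy⟩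
  exact (Set.Icc_infinite hlt) (hE.subset fun z hz => hall z hz.1 hz.2)

/-- The successor of one end of a run lies outside `E` and not beyond the next end, so different
ends lie in different cells. This bounds the number of runs, not their lengths. -/
theorem SignDet.encard_ends_le {u : G} (hu : IsLeastPos u) {r : ℕ} {E : Set G}
    (h : SignDet r E) : {y | y ∈ E ∧ y + u ∉ E}.encard ≤ (Nat.card (Fin r → SignType) : ℕ) := by
  obtain ⟨t, h⟩ := h
  refine encard_le_of_injOn_signs (injOn_signs_of_runs h (fun y hy => hy.1)
    fun y hy y' _ hlt => ⟨y + u, le_add_of_nonneg_right hu.1.le, ?_, hy.2⟩)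
  exact le_sub_iff_add_le'.1 (hu.2 _ (sub_pos.2 hlt))

theorem exists_nsmul_notMem {S : Set G} (hS : S.Finite) {u : G} (hu : u ≠ 0) (y : G) :
    ∃ j : ℕ, y + j • u ∉ S := by
  by_contra! h
  have hinj : Function.Injective fun j : ℕ => y + j • u := fun i j hij => by
    have h' : i • u = j • u := add_left_cancel hij
    rcases lt_trichotomy u 0 with h0 | h0 | h0
    · refine (nsmul_left_strictMono (neg_pos.2 h0)).injective ?_
      simp [h']
    · exact absurd h0 hu
    · exact (nsmul_left_strictMono h0).injective h'
  exact Set.infinite_of_injective_forall_mem hinj h hS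

/-- When all `u`-runs of `F v` are long, a suitable translate meets `F v` in a single run. A
multiple of `u` is then recognised as the offset of a point of such an intersection from its only
starting point `p`. -/
theorem dfn_multiples_of_deep (hadd : AddCoDef L (id : G → G) (id : G → G)) {u : G}
    (hu : IsLeastPos u) {γ : Type} [Finite γ] {F : (γ → G) → G → Prop}
    (hF : Dfn L fun w : Option γ → G => F (fun i => w (some i)) (w none))
    (hfin : ∀ v, {y | F v y}.Finite)
    (hdeep : ∀ s : ℕ, ∃ v, (∃ y, F v y) ∧
      ∀ y, F v y → ¬ F v (y + u) → ∀ i ≤ s, F v (y - i • u)) :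
    Dfn L fun v : Unit → G => ∃ i : ℕ, v () = i • u := by
  have hdef : Dfn L fun x : Unit → G => ∃ (v : γ → G) (d p : G),
      (F v p ∧ F v (p - d)) ∧ ¬ (F v (p - u) ∧ F v (p - u - d)) ∧
        (∀ q, F v q ∧ F v (q - d) → ¬ (F v (q - u) ∧ F v (q - u - d)) → q = p) ∧
          F v (p + x ()) ∧ F v (p + x () - d) := by
    have hu' : ∀ {α : Type} , DfnFun L (fun _ : α → G => u) := fun {α} => DfnFun.const u
    refine CoDef.exists_tuple (CoDef.ex (CoDef.ex ?_))
    have key : ∀ {T : (Option (Option (Unit ⊕ γ)) → G) → G}, DfnFun L T →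
        Dfn L fun w => F (fun i => w (some (some (Sum.inr i)))) (T w) := fun hT =>
      hF.comp_option hT (v := fun i w => w (some (some (Sum.inr i))))
        (v' := fun i w => w (some (some (Sum.inr i)))) fun i => CoDefFun.proj _
    have key' : ∀ {T : (Option (Option (Option (Unit ⊕ γ))) → G) → G}, DfnFun L T →
        Dfn L fun w => F (fun i => w (some (some (some (Sum.inr i))))) (T w) := fun hT =>
      hF.comp_option hT (v := fun i w => w (some (some (some (Sum.inr i)))))
        (v' := fun i w => w (some (some (some (Sum.inr i))))) fun i => CoDefFun.proj _
    have hp := CoDefFun.proj (L₁ := L) (f := (id : G → G)) (f' := (id : G → G))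
      (none : Option (Option (Unit ⊕ γ)))
    have hd := CoDefFun.proj (L₁ := L) (f := (id : G → G)) (f' := (id : G → G))
      (some none : Option (Option (Unit ⊕ γ)))
    have hx := CoDefFun.proj (L₁ := L) (f := (id : G → G)) (f' := (id : G → G))
      (some (some (Sum.inl ())) : Option (Option (Unit ⊕ γ)))
    have hq := CoDefFun.proj (L₁ := L) (f := (id : G → G)) (f' := (id : G → G))
      (none : Option (Option (Option (Unit ⊕ γ))))
    have hp' := CoDefFun.proj (L₁ := L) (f := (id : G → G)) (f' := (id : G → G))
      (some none : Option (Option (Option (Unit ⊕ γ))))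
    have hd' := CoDefFun.proj (L₁ := L) (f := (id : G → G)) (f' := (id : G → G))
      (some (some none) : Option (Option (Option (Unit ⊕ γ))))
    refine ((key hp).and (key (hp.sub hadd hd))).and (CoDef.and
      ((key (hp.sub hadd hu')).and (key ((hp.sub hadd hu').sub hadd hd))).not
      (CoDef.and (CoDef.all ?_)
        ((key (hp.add hadd hx)).and (key ((hp.add hadd hx).sub hadd hd)))))
    exact CoDef.imp ((key' hq).and (key' (hq.sub hadd hd'))) (CoDef.imp
      ((key' (hq.sub hadd hu')).and (key' ((hq.sub hadd hu').sub hadd hd'))).not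
      (CoDef.eq hq hp'))
  have hiff : ∀ x : Unit → G, (∃ (v : γ → G) (d p : G),
      (F v p ∧ F v (p - d)) ∧ ¬ (F v (p - u) ∧ F v (p - u - d)) ∧
        (∀ q, F v q ∧ F v (q - d) → ¬ (F v (q - u) ∧ F v (q - u - d)) → q = p) ∧
          F v (p + x ()) ∧ F v (p + x () - d)) ↔ ∃ i : ℕ, x () = i • u := by
    intro x
    constructor
    · rintro ⟨v, d, p, -, -, huniq, hx⟩
      -- Descending by `u` from `p + x ()` inside the finite intersection ends at a starting point,
      -- which must be `p`.
      obtain ⟨j, hj⟩ := exists_nsmul_notMem (hfin v) (neg_ne_zero.2 hu.1.ne') (p + x ())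
      obtain ⟨i, -, h₁, h₂⟩ := exists_last_nsmul (p := fun q => F v q ∧ F v (q - d)) hx
        fun h => hj h.1
      have := huniq _ h₁ (by rwa [← sub_eq_add_neg] at h₂)
      refine ⟨i, ?_⟩
      rw [smul_neg, ← sub_eq_add_neg, add_sub_assoc] at this
      exact sub_eq_zero.1 (add_eq_left.1 this)
    · rintro ⟨i, hi⟩
      obtain ⟨v, ⟨y, hy⟩, hv⟩ := hdeep i
      obtain ⟨q, hq, hmax⟩ := Set.exists_max_image _ id (hfin v) ⟨y, hy⟩
      obtain ⟨p₀, hp₀, hmin⟩ := Set.exists_min_image _ id (hfin v) ⟨y, hy⟩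
      have hqu : ¬ F v (q + u) := fun h => (hmax _ h).not_gt (lt_add_of_pos_right q hu.1)
      have hpu : ¬ F v (p₀ - u) := fun h => (hmin _ h).not_gt (sub_lt_self p₀ hu.1)
      have hrun : ∀ j ≤ i, F v (p₀ + j • u) := by
        intro j hj
        by_contra h
        obtain ⟨l, hl, h₁, h₂⟩ := exists_last_nsmul (p := F v) hp₀ h
        refine hpu ?_
        have := hv _ h₁ h₂ (l + 1) (by omega)
        have e : p₀ + l • u - (l + 1) • u = p₀ - u := by rw [succ_nsmul]; abel
        rwa [e] at this
      have hrun' : ∀ j ≤ i, F v (q - j • u) := hv q hq hqu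
      -- The translate by this `d` has least element `q - i • u`, while `F v` has greatest element
      -- `q`; both contain everything in between.
      refine ⟨v, q - i • u - p₀, q - i • u, ⟨hrun' i le_rfl, ?_⟩, ?_, ?_, ?_, ?_⟩
      · rw [sub_sub_cancel]; exact hp₀
      · rintro ⟨-, h⟩
        refine hpu ?_
        rwa [sub_sub, add_comm u, ← sub_sub, sub_sub_cancel] at h
      · rintro q' ⟨h₁, h₂⟩ h₃
        have hle : q - i • u ≤ q' := by
          have := hmin _ h₂
          simp only [id] at this
          rw [le_sub_iff_add_le, add_sub_cancel] at this
          exact this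
        have hle' : q' ≤ q := hmax _ h₁
        obtain ⟨j, hj, e⟩ := hu.exists_eq_nsmul (sub_nonneg.2 hle) (N := i) (by
          rw [sub_le_iff_le_add, add_sub_cancel]; exact hle')
        rcases Nat.eq_zero_or_pos j with rfl | hj0
        · rw [zero_smul] at e
          exact sub_eq_zero.1 e
        · obtain ⟨j, rfl⟩ := Nat.exists_eq_succ_of_ne_zero hj0.ne'
          have e' : q' - u = q - i • u + j • u := by
            rw [sub_eq_iff_eq_add.1 e, Nat.succ_eq_add_one, succ_nsmul]; abel
          refine absurd ⟨?_, ?_⟩ h₃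
          · have : q' - u = q - (i - j) • u := by
              rw [e', sub_nsmul u (by omega)]; abel
            rw [this]
            exact hrun' _ (by omega)
          · have : q' - u - (q - i • u - p₀) = p₀ + j • u := by rw [e']; abel
            rw [this]
            exact hrun j (by omega)
      · rw [hi, sub_add_cancel]; exact hq
      · have : q - i • u + x () - (q - i • u - p₀) = p₀ + i • u := by rw [hi]; abel
        rw [this]
        exact hrun i le_rfl
  exact hdef.congr hiff hiff

/-- Induction on the bound `K` for the number of runs. If arbitrarily large members have a run of at
most `s` elements, eroding all runs by `s` removes that run and only boundedly many points.
Otherwise large members have only long runs and `dfn_multiples_of_deep` applies. -/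
theorem dfn_multiples (hadd : AddCoDef L (id : G → G) (id : G → G)) {u : G} (hu : IsLeastPos u)
    {γ : Type} [Finite γ] (K : ℕ) {F : (γ → G) → G → Prop}
    (hF : Dfn L fun w : Option γ → G => F (fun i => w (some i)) (w none))
    (hfin : ∀ v, {y | F v y}.Finite)
    (hbig : ∀ l : ℕ, ∃ v, l ≤ {y | F v y}.ncard ∧ {y | F v y ∧ ¬ F v (y + u)}.ncard ≤ K) :
    Dfn L fun v : Unit → G => ∃ i : ℕ, v () = i • u := by
  have hfin' : ∀ v, {y | F v y ∧ ¬ F v (y + u)}.Finite := fun v =>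
    (hfin v).subset fun y hy => hy.1
  induction K generalizing F with
  | zero =>
    refine dfn_multiples_of_deep hadd hu hF hfin fun s => ?_
    obtain ⟨v, h₁, h₂⟩ := hbig 1
    have h0 := (Set.ncard_eq_zero (hfin' v)).1 (Nat.le_zero.1 h₂)
    refine ⟨v, (Set.ncard_pos (hfin v)).1 h₁, fun y hy hy' => ?_⟩
    exact absurd (show y ∈ {y | F v y ∧ ¬ F v (y + u)} from ⟨hy, hy'⟩) (by rw [h0]; simp)
  | succ K ih =>
    by_cases hA : ∃ s : ℕ, ∀ l : ℕ, ∃ v, (l ≤ {y | F v y}.ncard ∧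
        {y | F v y ∧ ¬ F v (y + u)}.ncard ≤ K + 1) ∧
          ∃ y, (F v y ∧ ¬ F v (y + u)) ∧ ∃ i ≤ s, ¬ F v (y - i • u)
    · obtain ⟨s, hs⟩ := hA
      have hsub : ∀ v, {y | ∀ i : Fin (s + 1), F v (y + (i : ℕ) • u)} ⊆ {y | F v y} :=
        fun v y hy => by simpa using hy 0
      refine ih (F := fun v y => ∀ i : Fin (s + 1), F v (y + (i : ℕ) • u)) ?_
        (fun v => (hfin v).subset (hsub v)) (fun l => ?_)
        (fun v => ((hfin v).subset (hsub v)).subset fun y hy => hy.1)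
      · refine CoDef.finite_forall fun i => ?_
        exact hF.comp_option (F := fun w => w none + (i : ℕ) • u)
          (F' := fun w => w none + (i : ℕ) • u) (v := fun i w => w (some i))
          (v' := fun i w => w (some i))
          ((CoDefFun.proj _).add hadd (DfnFun.const _)) fun i => CoDefFun.proj _
      · obtain ⟨v, ⟨h₁, h₂⟩, y, hy, i, his, hi⟩ := hs (l + s * (K + 1))
        refine ⟨v, ?_, ?_⟩
        -- Each point lost by erosion lies fewer than `s` steps below the end of a run, so at most
        -- `s * (K + 1)` are lost.
        · have hcover : {y | F v y} ⊆ {y | ∀ i : Fin (s + 1), F v (y + (i : ℕ) • u)} ∪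
              (fun q : ℕ × G => q.2 - q.1 • u) ''
                (Set.Iio s ×ˢ {y | F v y ∧ ¬ F v (y + u)}) := by
            intro z hz
            by_cases hz' : ∀ i : Fin (s + 1), F v (z + (i : ℕ) • u)
            · exact Or.inl hz'
            · push Not at hz'
              obtain ⟨j, hj⟩ := hz'
              obtain ⟨i, hij, h⟩ := exists_last_nsmul (p := F v) hz hj
              exact Or.inr ⟨(i, z + i • u), ⟨Set.mem_Iio.2 (by omega), h⟩, by simp⟩
          have hfp : (Set.Iio s ×ˢ {y | F v y ∧ ¬ F v (y + u)}).Finite :=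
            (Set.finite_Iio s).prod (hfin' v)
          have c₁ := Set.ncard_le_ncard hcover
            (((hfin v).subset (hsub v)).union (hfp.image _))
          have c₂ := Set.ncard_union_le {y | ∀ i : Fin (s + 1), F v (y + (i : ℕ) • u)}
            ((fun q : ℕ × G => q.2 - q.1 • u) '' (Set.Iio s ×ˢ {y | F v y ∧ ¬ F v (y + u)}))
          have c₃ := Set.ncard_image_le (f := fun q : ℕ × G => q.2 - q.1 • u) hfp
          rw [Set.ncard_prod] at c₃
          have c₄ : (Set.Iio s).ncard = s := by simp
          have c₅ : s * {y | F v y ∧ ¬ F v (y + u)}.ncard ≤ s * (K + 1) :=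
            Nat.mul_le_mul_left _ h₂
          rw [c₄] at c₃
          omega
        · have hinj : Set.InjOn (fun z : G => z + s • u) {y |
              (∀ i : Fin (s + 1), F v (y + (i : ℕ) • u)) ∧
                ¬ ∀ i : Fin (s + 1), F v (y + u + (i : ℕ) • u)} :=
            fun a _ b _ hab => add_right_cancel hab
          rw [← hinj.ncard_image]
          -- Translation by `s • u` sends ends of eroded runs to ends of runs, and misses the end
          -- `y` of the short one.
          have hss : (fun z : G => z + s • u) '' {y |
              (∀ i : Fin (s + 1), F v (y + (i : ℕ) • u)) ∧
                ¬ ∀ i : Fin (s + 1), F v (y + u + (i : ℕ) • u)} ⊆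
              {y | F v y ∧ ¬ F v (y + u)} \ {y} := by
            rintro _ ⟨z, ⟨hz, hz'⟩, rfl⟩
            refine ⟨⟨hz (Fin.last s), fun h => hz' fun j => ?_⟩, fun h => ?_⟩
            · rcases (Fin.le_last j).eq_or_lt with rfl | hj
              · have : z + u + (Fin.last s : ℕ) • u = z + s • u + u := by
                  rw [Fin.val_last]; abel
                rw [this]; exact h
              · have hj' : (j : ℕ) < s := hj
                have := hz ⟨j + 1, by omega⟩
                rwa [succ_nsmul', ← add_assoc] at this
            · refine hi ?_
              have h' : z + s • u = y := h
              have : y - i • u = z + (s - i) • u := by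
                rw [← h', sub_nsmul u his]; abel
              rw [this]
              exact hz ⟨s - i, by omega⟩
          have := Set.ncard_le_ncard hss ((hfin' v).subset Set.sdiff_subset)
          rw [Set.ncard_sdiff_singleton_of_mem (show y ∈ {y | F v y ∧ ¬ F v (y + u)} from hy)] at this
          exact this.trans (by omega)
    · push Not at hA
      refine dfn_multiples_of_deep hadd hu hF hfin fun s => ?_
      obtain ⟨l, hl⟩ := hA s
      obtain ⟨v, h₁, h₂⟩ := hbig (max l 1)
      refine ⟨v, (Set.ncard_pos (hfin v)).1 ((le_max_right l 1).trans h₁), fun y hy hy' => hl v ⟨(le_max_left l 1).trans h₁, h₂⟩ y ⟨hy, hy'⟩⟩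

end Uniform

theorem Dfn.comp_affine {L : FirstOrder.Language} {G : Type*} [L.Structure G] [AddCommGroup G]
    (hadd : AddCoDef L (id : G → G) (id : G → G)) {β : Type*} [Finite β]
    {P : (Option β → G) → Prop} (hP : Dfn L P) (n : ℕ) (b : β → G) (c : G) :
    Dfn L fun v : Unit → G => v () ∈ {y | P fun o => o.elim (c + n • y) b} := by
  have h := hP.comp (F := fun o v => o.elim (c + n • v ()) b)
    (F' := fun (o : Option β) (v : Unit → G) => o.elim (c + n • v ()) b) (by
      rintro (_ | i)
      · exact CoDefFun.add hadd (DfnFun.const c) ((CoDefFun.proj ()).nsmul hadd n)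
      · exact DfnFun.const (b i))
  exact h

/-! ### Uniform bounds for the families definable in `M` -/

section UniformBound

variable {L : FirstOrder.Language} {G : Type*} [L.Structure G] [AddCommGroup G] [LinearOrder G]
  [IsOrderedAddMonoid G]

/-- The `y` with `n • y` a nonnegative multiple of `u` include all `j • u` and no `-((j + 1) • u)`,
so they are neither finite nor cofinite. -/
theorem SignDetFinite.not_dfn_multiples (h : SignDetFinite L G)
    (hadd : AddCoDef L (id : G → G) (id : G → G))
    (H : Interprets L ordGroupLang (id : G → G) (id : G → G))
    (hr : ∀ m, 0 < m → RegularAt G m) {u : G} (hu : 0 < u) :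
    ¬ Dfn L fun v : Unit → G => ∃ i : ℕ, v () = i • u := by
  intro hD
  have hD' : Dfn L fun v : Option Empty → G => ∃ i : ℕ, v none = i • u := hD.relabel fun _ => none
  obtain ⟨n, hn, r, hdet⟩ := ((H.dfn hD').basic_sign hr).exists_signDet
  have hmono := nsmul_left_strictMono hu
  rcases h _ r (hD'.comp_affine hadd n Empty.elim 0) (hdet Empty.elim 0) with hfin | hfin
  · refine Set.infinite_of_injective_forall_mem hmono.injective (fun j => ?_) hfin
    refine ⟨n * j, ?_⟩
    change 0 + n • j • u = _
    rw [zero_add, mul_smul]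
  · refine Set.infinite_of_injective_forall_mem (f := fun j : ℕ => -((j + 1) • u))
      (fun i j hij => ?_) (fun j => ?_) hfin
    · have := hmono.injective (neg_injective hij)
      omega
    · rintro ⟨i, hi⟩
      replace hi : 0 + n • -((j + 1) • u) = i • u := hi
      have h₁ : 0 < n • (j + 1) • u := nsmul_pos (nsmul_pos hu j.succ_ne_zero) hn.ne'
      have h₂ : 0 ≤ i • u := nsmul_nonneg hu.le i
      rw [← hi, zero_add, smul_neg] at h₂
      exact h₁.not_ge (neg_nonneg.1 h₂)

theorem SignDetFinite.exists_encard_le (h : SignDetFinite L G)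
    (hadd : AddCoDef L (id : G → G) (id : G → G))
    (H : Interprets L ordGroupLang (id : G → G) (id : G → G))
    (hr : ∀ m, 0 < m → RegularAt G m) {u : G} (hu : IsLeastPos u) {γ : Type} [Finite γ]
    {Q : (γ → G) → G → Prop} (hQ : Dfn L fun w : Option γ → G => Q (fun i => w (some i)) (w none))
    {r : ℕ} (hdet : ∀ v, SignDet r {y | Q v y}) :
    ∃ k : ℕ, ∀ v, {y | Q v y}.Finite → {y | Q v y}.encard ≤ k := by
  have : Nontrivial G := ⟨⟨u, 0, hu.1.ne'⟩⟩
  have hinf : Infinite G := inferInstance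
  by_contra! hbig
  have hQ1 : ∀ v, Dfn L fun w : Unit → G => w () ∈ {y | Q v y} := fun v =>
    hQ.comp_option (F := fun w => w ()) (F' := fun w => w ()) (v := fun i _ => v i)
      (v' := fun i _ => v i) (CoDefFun.proj _) fun i => DfnFun.const (v i)
  -- The second clause singles out the finite members definably: a finite set is disjoint from some
  -- translate of itself, a cofinite one never is. So `F` keeps finite members and empties the
  -- others.
  set F : (γ → G) → G → Prop := fun v y => Q v y ∧ ∃ d, ∀ x, ¬ (Q v x ∧ Q v (x - d)) with hF
  have hFQ : ∀ v, {y | Q v y}.Finite → {y | F v y} = {y | Q v y} := by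
    intro v hv
    refine Set.Subset.antisymm (fun y hy => hy.1) fun y hy => ⟨hy, ?_⟩
    obtain ⟨d, hd⟩ := ((hv.prod hv).image fun p : G × G => p.1 - p.2).exists_notMem
    exact ⟨d, fun x hx => hd ⟨(x, x - d), hx, by simp⟩⟩
  have hFfin : ∀ v, {y | F v y}.Finite := by
    intro v
    rcases h _ r (hQ1 v) (hdet v) with hv | hv
    · rwa [hFQ v hv]
    · refine Set.finite_empty.subset ?_
      rintro y ⟨-, d, hd⟩
      obtain ⟨x, hx⟩ := (hv.union (hv.image fun z => z + d)).exists_notMem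
      refine hd x ⟨?_, ?_⟩
      · by_contra hx'
        exact hx (Or.inl hx')
      · by_contra hx'
        exact hx (Or.inr ⟨x - d, hx', by simp⟩)
  refine h.not_dfn_multiples hadd H hr hu.1 (dfn_multiples hadd hu
    (Nat.card (Fin r → SignType)) (F := F) ?_ hFfin fun l => ?_)
  · refine CoDef.and hQ (CoDef.ex (CoDef.all (CoDef.not (CoDef.and ?_ ?_))))
    · exact hQ.relabel fun o => o.elim none fun i => some (some (some i))
    · exact hQ.comp_option (F := fun w => w none - w (some none))
        (F' := fun w => w none - w (some none)) (v := fun i w => w (some (some (some i))))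
        (v' := fun i w => w (some (some (some i))))
        ((CoDefFun.proj _).sub hadd (CoDefFun.proj _)) fun i => CoDefFun.proj _
  · obtain ⟨v, hv, hl⟩ := hbig l
    refine ⟨v, ?_, ?_⟩
    · rw [hFQ v hv]
      rw [← hv.cast_ncard_eq] at hl
      exact_mod_cast hl.le
    · have e : ∀ y, F v y ↔ Q v y := fun y => Set.ext_iff.1 (hFQ v hv) y
      simp only [e]
      have := (hdet v).encard_ends_le hu
      have hfin : {y | Q v y ∧ ¬ Q v (y + u)}.Finite := hv.subset fun y hy => hy.1
      change {y | Q v y ∧ ¬ Q v (y + u)}.encard ≤ _ at this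
      rw [← hfin.cast_ncard_eq] at this
      exact_mod_cast this

theorem SignDetFinite.uniformlySmall (h : SignDetFinite L G)
    (hadd : AddCoDef L (id : G → G) (id : G → G))
    (H : Interprets L ordGroupLang (id : G → G) (id : G → G))
    (hr : ∀ m, 0 < m → RegularAt G m) : UniformlySmall L G := by
  intro β _ P hP
  obtain ⟨n, hn, r, hdet⟩ := ((H.dfn hP).basic_sign hr).exists_signDet
  refine ⟨n, hn, ?_⟩
  have hfc := fun b c => h _ r (hP.comp_affine hadd n b c) (hdet b c)
  by_cases hd : ∃ u : G, IsLeastPos u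
  · obtain ⟨u, hu⟩ := hd
    -- The coset representative is treated as one more parameter, so the bound is uniform in it as
    -- well.
    have hQ : Dfn L fun w : Option (Option β) → G =>
        P fun o => o.elim (w (some none) + n • w none) fun i => w (some (some i)) :=
      CoDef.comp_option (P := P) (P' := P) hP (F := fun w => w (some none) + n • w none)
        (F' := fun w => w (some none) + n • w none) (v := fun i w => w (some (some i)))
        (v' := fun i w => w (some (some i)))
        ((CoDefFun.proj _).add hadd ((CoDefFun.proj _).nsmul hadd n)) fun i => CoDefFun.proj _
    obtain ⟨k₁, h₁⟩ := h.exists_encard_le hadd H hr hu (r := r)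
      (Q := fun v y => P fun o => o.elim (v none + n • y) fun i => v (some i)) hQ
      fun v => hdet _ _
    obtain ⟨k₂, h₂⟩ := h.exists_encard_le hadd H hr hu (r := r)
      (Q := fun v y => ¬ P fun o => o.elim (v none + n • y) fun i => v (some i)) hQ.not
      fun v => (hdet _ _).compl
    refine ⟨max k₁ k₂, fun b c => (hfc b c).imp (fun hf => ?_) fun hf => ?_⟩
    · exact (h₁ (fun o => o.elim c b) hf).trans (by exact_mod_cast le_max_left _ _)
    · exact (h₂ (fun o => o.elim c b) hf).trans (by exact_mod_cast le_max_right _ _)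
  · exact ⟨_, fun b c => (hfc b c).imp (fun hf => (hdet b c).encard_le_of_dense hd hf)
      fun hf => (hdet b c).compl.encard_le_of_dense hd hf⟩

theorem UniformlySmall.of_subsingleton {L : FirstOrder.Language} {G : Type*} [L.Structure G]
    [AddCommGroup G] [Subsingleton G] : UniformlySmall L G := fun _ _ _ _ =>
  ⟨1, one_pos, 1, fun _ _ => Or.inl (by
    exact_mod_cast Set.encard_le_one_iff.2 fun a b _ _ => Subsingleton.elim a b)⟩

end UniformBound

/-! ### Unary sets definable in the group -/

section Unary

/-- After elimination, membership of `n • y` depends only on which of finitely many affine functions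
of `y` vanish, and a nonconstant one vanishes at most once. -/
theorem Dfn.finite_or_finite_compl_of_nsmul {G : Type*} [AddCommGroup G] [IsAddTorsionFree G]
    [Infinite G] {D : Set G} (h : Dfn groupLang fun v : Unit → G => v () ∈ D) :
    ∃ n : ℕ, 0 < n ∧ ({y | n • y ∈ D}.Finite ∨ {y | n • y ∈ D}ᶜ.Finite) := by
  have h' : Dfn groupLang fun v : Option Empty → G => v none ∈ D := h.relabel fun _ => none
  obtain ⟨T, hT, hA, n, hn, h⟩ := h'.basic_eq_zero eliminates_eq_zero
  refine ⟨n, hn, ?_⟩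
  let ev : G → Option Empty → G := fun y _ => n • y
  have key : ∀ t ∈ T, ∃ B : Set G, B.Finite ∧ ∀ y ∉ B, ∀ y' ∉ B,
      (t (ev y) = 0) = (t (ev y') = 0) := by
    intro t ht
    obtain ⟨k, E, -, hk⟩ := (hA t ht).exists_split
    have hE : ∀ y, t (ev y) = k • n • y + E Empty.elim := fun y => by
      rw [hk, Subsingleton.elim (fun i => ev y (some i)) Empty.elim]
    simp only [hE]
    by_cases hk0 : k = 0
    · exact ⟨∅, Set.finite_empty, fun y _ y' _ => by simp [hk0]⟩
    · refine ⟨{y | k • n • y + E Empty.elim = 0}, Set.Subsingleton.finite fun a ha b hb => ?_,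
        fun y hy y' hy' => propext (iff_of_false hy hy')⟩
      have h : k • n • a + E Empty.elim = k • n • b + E Empty.elim := ha.trans hb.symm
      rwa [add_left_inj, smul_right_inj hk0, smul_right_inj hn.ne'] at h
  choose! B hB hB' using key
  have hfin : (⋃ t ∈ T, B t).Finite := hT.biUnion hB
  have hiff : ∀ y ∉ ⋃ t ∈ T, B t, ∀ y' ∉ ⋃ t ∈ T, B t, n • y ∈ D → n • y' ∈ D := by
    intro y hy y' hy'
    refine h (ev y) (ev y') (fun t ht => hB' t ht y (fun h => hy (Set.mem_biUnion ht h)) y'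
      fun h => hy' (Set.mem_biUnion ht h)) fun i => ⟨y' - y, ?_⟩
    simp only [ev]
    rw [smul_sub]
    abel
  by_cases hy : ∃ y ∉ ⋃ t ∈ T, B t, n • y ∈ D
  · obtain ⟨y, hy, hyD⟩ := hy
    refine Or.inr (hfin.subset fun z hz => ?_)
    by_contra hz'
    exact hz (hiff y hy z hz' hyD)
  · push Not at hy
    refine Or.inl (hfin.subset fun z hz => ?_)
    by_contra hz'
    exact hy z hz' hz

theorem Dfn.of_finite_or_finite_compl {L : FirstOrder.Language} {G α : Type*} [L.Structure G]
    {S : Set G} (hS : S.Finite ∨ Sᶜ.Finite) (i : α) : Dfn L fun v : α → G => v i ∈ S := by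
  have key : ∀ S : Set G, S.Finite → Dfn L fun v : α → G => v i ∈ S := by
    intro S hS
    have : Finite S := hS
    have h : Dfn L fun v : α → G => ∃ s : S, v i = s :=
      CoDef.finite_exists fun s => CoDef.eq (CoDefFun.proj i) (DfnFun.const (s : G))
    exact h.congr (fun v => by simp) (fun v => by simp)
  rcases hS with hS | hS
  · exact key S hS
  · exact (key _ hS).not.congr (fun v => by simp) (fun v => by simp)

theorem definable₁_of_finite_or_finite_compl {G : Type*} [AddCommGroup G] {n k : ℕ}
    (hrep : HasReps G n k) {D : Set G}
    (h : ∀ c, {y | c + n • y ∈ D}.Finite ∨ {y | c + n • y ∈ D}ᶜ.Finite) :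
    (Set.univ : Set G).Definable₁ groupLang D := by
  obtain ⟨r, hr⟩ := hrep
  rw [definable₁_iff_dfn]
  have hadd := addCoDef_groupLang (id : G → G) (id : G → G)
  have hD : Dfn groupLang fun v : Unit → G =>
      ∃ i : Fin k, ∃ y, v () = r i + n • y ∧ y ∈ {y | r i + n • y ∈ D} :=
    CoDef.finite_exists fun i => CoDef.ex (CoDef.and
      (CoDef.eq (CoDefFun.proj _) (CoDefFun.add hadd (DfnFun.const (r i))
        ((CoDefFun.proj none).nsmul hadd n)))
      (Dfn.of_finite_or_finite_compl (h (r i)) none))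
  have hiff : ∀ v : Unit → G, (∃ i : Fin k, ∃ y, v () = r i + n • y ∧
      y ∈ {y | r i + n • y ∈ D}) ↔ v () ∈ D := by
    intro v
    constructor
    · rintro ⟨i, y, e, hy⟩
      rw [e]; exact hy
    · intro hv
      obtain ⟨i, y, e⟩ := hr (v ())
      exact ⟨i, y, e, show r i + n • y ∈ D from e ▸ hv⟩
  exact hD.congr hiff hiff

variable {L : FirstOrder.Language} {G : Type*} [L.Structure G] [AddCommGroup G]

theorem UniformlySmall.noNewUnarySets (h : UniformlySmall L G)
    (hrep : ∀ n, 0 < n → ∃ k, HasReps G n k) : NoNewUnarySets groupLang L G := by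
  intro D hD
  obtain ⟨n, hn, k, hk⟩ := h Empty (fun w => w none ∈ D)
    ((definable₁_iff_dfn.1 hD).relabel fun _ => none)
  obtain ⟨K, hK⟩ := hrep n hn
  exact definable₁_of_finite_or_finite_compl hK fun c =>
    (hk Empty.elim c).imp Set.finite_of_encard_le_coe Set.finite_of_encard_le_coe

variable [LinearOrder G] {𝒢 : Type*} [AddCommGroup 𝒢] [LinearOrder 𝒢]

/-- Parameters outside `G` do no harm: for fixed `n` and `k` the bound over all parameters of `G` is
a first-order statement, which elementarity extends to all parameters of `𝒢`. -/
theorem UniformlySmall.noNewUnarySets_reductStructure (h : UniformlySmall L G)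
    (hL : IsReductOver (Set.univ : Set G) L ordGroupLang) (f : G ↪ₑ[ordGroupLang] 𝒢)
    (hrep : ∀ n, 0 < n → ∃ k, HasReps 𝒢 n k) :
    @NoNewUnarySets groupLang L 𝒢 _ (reductStructure L f) := by
  let _ := reductStructure L f
  have H : Interprets L ordGroupLang (id : G → G) f := hL.interprets_reductStructure f
  intro D hD
  obtain ⟨A, φ, hφ⟩ := (definable₁_iff_dfn.1 hD).exists_finset
  obtain ⟨l, ⟨e⟩⟩ := Finite.exists_equiv_fin A
  let ψ : L.Formula (Option (Fin l)) :=
    φ.relabel (Sum.elim (fun a => some (e a)) fun _ => none)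
  have hψ : ∀ y, y ∈ D ↔ ψ.Realize fun o => o.elim y fun i => (e.symm i : 𝒢) := by
    intro y
    rw [Formula.realize_relabel]
    refine (hφ fun _ => y).trans (iff_of_eq (congrArg _ (funext fun x => ?_)))
    rcases x with x | x <;> simp
  obtain ⟨n, hn, k, hk⟩ := h (Fin l) (fun w => ψ.Realize w) (Dfn.of_formula ψ)
  have hadd := addCoDef_ordGroupLang (id : G → G) f
  have hc : CoDef ordGroupLang (id : G → G) f
      (fun w : Option (Option (Empty ⊕ Fin l)) → G => ψ.Realize fun o => o.elim
        (w (some none) + n • w none) fun i => w (some (some (Sum.inr i))))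
      (fun w : Option (Option (Empty ⊕ Fin l)) → 𝒢 => ψ.Realize fun o => o.elim
        (w (some none) + n • w none) fun i => w (some (some (Sum.inr i)))) :=
    (H.formula ψ).comp_option
      ((CoDefFun.proj (some none)).add hadd ((CoDefFun.proj none).nsmul hadd n))
      fun i => CoDefFun.proj (some (some (Sum.inr i)))
  have hk' := (CoDef.transfer_elementary f (CoDef.forall_tuple (α := Empty)
    (P := fun _ (b : Fin l → G) => ∀ c,
      {y | ψ.Realize fun o => o.elim (c + n • y) b}.encard ≤ k ∨
        {y | ¬ ψ.Realize fun o => o.elim (c + n • y) b}.encard ≤ k)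
    (P' := fun _ (b : Fin l → 𝒢) => ∀ c,
      {y | ψ.Realize fun o => o.elim (c + n • y) b}.encard ≤ k ∨
        {y | ¬ ψ.Realize fun o => o.elim (c + n • y) b}.encard ≤ k)
    (CoDef.all (CoDef.or (CoDef.encard_le hc k) (CoDef.encard_le hc.not k))))).1 hk
  obtain ⟨K, hK⟩ := hrep n hn
  refine definable₁_of_finite_or_finite_compl hK fun c => ?_
  have := hk' (fun i => (e.symm i : 𝒢)) c
  simp only [← hψ] at this
  exact this.imp Set.finite_of_encard_le_coe Set.finite_of_encard_le_coe

/-- The formula of `D`, read in `𝒢`, defines a set with trace `D` on `G`. Finiteness or cofiniteness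
on `n𝒢` pulls back along the injection `f` with the same `n`. -/
theorem finite_or_finite_compl_of_reductStructure [IsAddTorsionFree 𝒢] [Infinite 𝒢]
    (hL : IsReductOver (Set.univ : Set G) L ordGroupLang) (f : G ↪ₑ[ordGroupLang] 𝒢)
    (h : @NoNewUnarySets groupLang L 𝒢 _ (reductStructure L f)) {D : Set G}
    (hD : Dfn L fun v : Unit → G => v () ∈ D) :
    ∃ n : ℕ, 0 < n ∧ ({y | n • y ∈ D}.Finite ∨ {y | n • y ∈ D}ᶜ.Finite) := by
  let _ := reductStructure L f
  have H : Interprets L ordGroupLang (id : G → G) f := hL.interprets_reductStructure f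
  obtain ⟨θ, hθ, -⟩ := hD
  have h𝒟 : Dfn L fun v : Unit → 𝒢 => v () ∈ {x | θ.Realize (Sum.elim f fun _ => x)} := by
    have : ∀ v : Unit → 𝒢, (θ.relabel (Sum.map f id)).Realize (Sum.elim id v) ↔
        v () ∈ {x | θ.Realize (Sum.elim f fun _ => x)} := by
      intro v
      rw [Formula.realize_relabel]
      exact iff_of_eq (congrArg _ (funext fun x => by rcases x with x | x <;> rfl))
    exact ⟨_, this, this⟩
  obtain ⟨n, hn, hfin⟩ :=
    (definable₁_iff_dfn.1 (h _ (definable₁_iff_dfn.2 h𝒟))).finite_or_finite_compl_of_nsmul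
  have hmem : ∀ y : G, f y ∈ {x | θ.Realize (Sum.elim f fun _ => x)} ↔ y ∈ D := by
    intro y
    obtain ⟨η, h₁, h₂⟩ := (H.formula θ).reindex (α := Unit) id
    refine (h₂ fun _ => f y).symm.trans (Iff.trans ?_ ((h₁ fun _ => y).trans (hθ fun _ => y)))
    rw [← f.map_formula]
    exact iff_of_eq (congrArg _ (funext fun x => by rcases x with x | x <;> rfl))
  have hadd : ∀ x y, f (x + y) = f x + f y := fun x y =>
    f.map_fun (L := ordGroupLang) PlusFunc.add ![x, y]
  have hnsmul : ∀ y, f (n • y) = n • f y := fun y => map_nsmul (AddMonoidHom.mk' f hadd) n y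
  refine ⟨n, hn, hfin.imp (fun hf => ?_) fun hf => ?_⟩
  · refine (hf.preimage f.injective.injOn).subset fun y hy => ?_
    rw [Set.mem_preimage, Set.mem_ofPred_eq, ← hnsmul, hmem]
    exact hy
  · refine (hf.preimage f.injective.injOn).subset fun y hy => ?_
    rw [Set.mem_preimage, Set.mem_compl_iff, Set.mem_ofPred_eq, ← hnsmul, hmem]
    exact hy

end Unary

/-! ### The main equivalence -/

theorem IsReductOver.addCoDef {L : FirstOrder.Language} {G : Type*} [L.Structure G]
    [AddCommGroup G] (h : IsReductOver (Set.univ : Set G) groupLang L) :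
    AddCoDef L (id : G → G) (id : G → G) := by
  refine dfn_iff_definable.2 (h 3 _ (Set.empty_definable_iff.2
    ⟨Term.equal (Functions.apply₂ (L := groupLang) PlusFunc.add (Term.var 0)
      (Term.var 1)) (Term.var 2), ?_⟩))
  ext v
  rw [Set.mem_ofPred_eq, Set.mem_ofPred_eq, Formula.realize_equal]
  exact Iff.rfl

theorem mainTheorem5
    -- an archimedean ordered abelian group with small quotients
    {H : Type*} [AddCommGroup H] [LinearOrder H] [IsOrderedAddMonoid H] [Archimedean H]
    (hH : HasSmallQuotients H)
    -- `N = (G, +, <)`, elementarily equivalent to it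
    {G : Type*} [AddCommGroup G] [LinearOrder G] [IsOrderedAddMonoid G]
    (hGH : G ≅[ordGroupLang] H)
    -- `M`, an `L`-structure on `G` which is a reduct of `N` and an expansion of `(G, +)`
    (L : FirstOrder.Language) [L.Structure G]
    (hMN : IsReductOver (Set.univ : Set G) L ordGroupLang)
    (hGM : IsReductOver (Set.univ : Set G) groupLang L)
    -- `𝒩 = (𝒢, +, <)`, a monster model of the theory of `N`, with `N` as a small elementary submodel
    {𝒢 : Type*} [AddCommGroup 𝒢] [LinearOrder 𝒢] [IsOrderedAddMonoid 𝒢]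
    (f : G ↪ₑ[ordGroupLang] 𝒢) (κ : Cardinal)
    (hκ : IsMonsterModel κ ordGroupLang 𝒢) (hsmall : #(Set.range f) < κ) :
    List.TFAE [
      IsStableStructure L G,
      NoNewUnarySets groupLang L G,
      -- the reduct of `𝒩` to the language of `M`
      @NoNewUnarySets groupLang L 𝒢 _ (reductStructure L f)] := by
  have hr : ∀ m, 0 < m → RegularAt G m := fun m hm => (regularAt_of_archimedean H hm).of_equiv hGH
  have hrep : ∀ n, 0 < n → ∃ k, HasReps G n k := fun n hn =>
    (hH.exists_hasReps hn).imp fun _ h => h.of_equiv hGH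
  have hrep' : ∀ n, 0 < n → ∃ k, HasReps 𝒢 n k := fun n hn =>
    (hrep n hn).imp fun _ h => h.of_equiv f.elementarilyEquivalent.symm
  have hadd := hGM.addCoDef
  have key : IsStableStructure L G ∨ NoNewUnarySets groupLang L G ∨
      @NoNewUnarySets groupLang L 𝒢 _ (reductStructure L f) → UniformlySmall L G := by
    -- Elimination in the pure group requires it to be infinite, so the trivial group is set apart.
    rcases subsingleton_or_nontrivial G with hG | hG
    · exact fun _ => UniformlySmall.of_subsingleton
    · have : Nontrivial 𝒢 := f.injective.nontrivial
      have hfc : IsStableStructure L G ∨ NoNewUnarySets groupLang L G ∨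
          @NoNewUnarySets groupLang L 𝒢 _ (reductStructure L f) → SignDetFinite L G := by
        rintro (h | h | h)
        · exact h.signDetFinite hadd hr
        · exact signDetFinite_of_nsmul hr fun D hD =>
            (definable₁_iff_dfn.1 (h D (definable₁_iff_dfn.2 hD))).finite_or_finite_compl_of_nsmul
        · exact signDetFinite_of_nsmul hr fun D hD =>
            finite_or_finite_compl_of_reductStructure hMN f h hD
      exact fun h => (hfc h).uniformlySmall hadd hMN.interprets_id hr
  have h₁ : UniformlySmall L G → IsStableStructure L G := fun h => h.isStableStructure hadd hrep
  have h₂ : UniformlySmall L G → NoNewUnarySets groupLang L G := fun h => h.noNewUnarySets hrep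
  have h₃ : UniformlySmall L G → @NoNewUnarySets groupLang L 𝒢 _ (reductStructure L f) :=
    fun h => h.noNewUnarySets_reductStructure hMN f hrep'
  tfae_have 1 → 2 := fun h => h₂ (key (Or.inl h))
  tfae_have 2 → 3 := fun h => h₃ (key (Or.inr (Or.inl h)))
  tfae_have 3 → 1 := fun h => h₁ (key (Or.inr (Or.inr h)))
  tfae_finish
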